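/- **Setting.** Let $\Bbbk$ be a field of characteristic $0$; all gradings are by $\mathbb Z$ and $|x|$ denotes the degree of a homogeneous element. Let $(A,\delta)$ be a commutative unital DG algebra over $\Bbbk$. Let $(\mathcal K,\delta_0)$ be a DG Lie–Rinehart algebra over $(A,\delta)$: a DG $A$-module with a graded Lie bracket $[\cdot,\cdot]$ and a Lie action $q\otimes a\mapsto q\cdot a$ on $A$ such that $(aq)\cdot b=a(q\cdot b)$, $q\cdot(ab)=(q\cdot a)b+(-1)^{|a||q|}a(q\cdot b)$, $[aq,r]=a[q,r]-(-1)^{|r|(|a|+|q|)}(r\cdot a)q$, and such that $\delta_0$ is a derivation of the bracket and $\delta(q\cdot a)=(\delta_0q)\cdot a+(-1)^{|q|}q\cdot\delta a$. Let $(\underline{\mathcal K},\underline\delta)$ be a DG $A$-module, and let $(p_0,j_0,h_0)$ be $A$-linear contraction data for $\mathcal K$ over $\underline{\mathcal K}$: $p_0:\mathcal K\to\underline{\mathcal K}$ and $j_0:\underline{\mathcal K}\to\mathcal K$ are $A$-linear cochain maps of degree $0$, $h_0$ has degree $-1$ with $h_0(aq)=(-1)^{|a|}a\,h_0(q)$,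 and $p_0j_0=\mathrm{id}$, $h_0\delta_0+\delta_0h_0=\mathrm{id}-j_0p_0$, $h_0^2=0$, $h_0j_0=0$, $p_0h_0=0$. **Transfer.** For a complex $(V,d)$ with a bracket $[\cdot,\cdot]$, a complex $(W,\underline d)$ and contraction data $(p,j,h)$ for $V$ over $W$, the transferred operations on $W$ are $\lambda_1=\underline d$ and $\lambda_k=p\,\phi_k$ for $k\ge2$, where $\psi_1=-j$, $\psi_k=h\phi_k$ $(k\ge 2)$ and $$\phi_k(x_1,\dots,x_k)=\sum_{\ell+m=k,\ \ell,m\ge1}\ \sum_{\sigma\in S_{\ell,m}}(-1)^{b}\chi(\sigma,x)\,[\psi_\ell(x_{\sigma(1)},\dots,x_{\sigma(\ell)}),\psi_m(x_{\sigma(\ell+1)},\dots,x_{\sigma(k)})],$$ $b=\ell-1+(m-1)(|x_{\sigma(1)}|+\dots+|x_{\sigma(\ell)}|)$, $S_{\ell,m}$ is the set of $(\ell,m)$-unshuffles and $\chi(\sigma,x)$ is defined by $x_{\sigma(1)}\wedge\dots\wedge x_{\sigma(k)}=\chi(\sigma,x)\,x_1\wedge\dots\wedge x_k$ in the graded exterior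 algebra. **The structure $\mathscr P$.** Transferring the DG Lie algebra $\mathcal K$ along $(p_0,j_0,h_0)$ gives operations $\lambda^{\mathscr Q}_k$ on $\underline{\mathcal K}$. Transferring the semidirect product DG Lie algebra $A\oplus\mathcal K$ (with $[a,b]=0$ and $[q,a]=q\cdot a$) along $(\mathrm{id}\oplus p_0,\mathrm{id}\oplus j_0,0\oplus h_0)$ to $A\oplus\underline{\mathcal K}$ gives operations whose $A$-component on $(q_1,\dots,q_{k-1},a)$ is denoted $\nu_k(q_1,\dots,q_{k-1}\,|\,a)$. These are the $LR_\infty$-operations on $\underline{\mathcal K}$. Let $\mathscr P=\{\Lambda_k\}_{k\ge1}$ be the family of graded skew-symmetric multiderivations $\Lambda_k$ of degree $2-k$ of the graded symmetric algebra $S_A\underline{\mathcal K}$ such that $\Lambda_k(q_1,\dots,q_k)=\lambda^{\mathscr Q}_k(q_1,\dots,q_k)$, $\Lambda_k(q_1,\dots,q_{k-1},a)=\nu_k(q_1,\dots,q_{k-1}\,|\,a)$ for $q_i\in\underline{\mathcal K}$, $a\in A$, and $\Lambda_k$ vanishes on elements of $A\cup\underline{\mathcal K}$ at least two of which lie in $A$.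 **The structure $\mathscr L$.** Extend $\delta_0$ (together with $\delta$) to $S_A\mathcal K$ and $\underline\delta$ (together with $\delta$) to $S_A\underline{\mathcal K}$ as derivations, extend the Lie bracket and the action to the Poisson bracket $\{\cdot,\cdot\}$ of $S_A\mathcal K$ as a biderivation, and extend $p_0$ and $j_0$ as $A$-algebra morphisms. Let $h'$ be the derivation of $S_A\mathcal K$ that extends $h_0$ and vanishes on $A$. With $\mathcal Z=\ker p_0$, so that $S_A\mathcal K\simeq S_A\underline{\mathcal K}\otimes_AS_A\mathcal Z$, extend $h_0$ to $S_A\mathcal K$ by $h_0=\frac1i h'$ on $S_A\underline{\mathcal K}\otimes_AS^i_A\mathcal Z$ for $i>0$ and $h_0=0$ for $i=0$. Let $\mathscr L=\{\lambda_k\}_{k\ge1}$ be the operations on $S_A\underline{\mathcal K}$ transferred from $(S_A\mathcal K,\delta_0,\{\cdot,\cdot\})$ along the extended $(p_0,j_0,h_0)$. **Proposition.** The extended $(p_0,j_0,h_0)$ are contraction data for $(S_A\mathcal K,\delta_0)$ over $(S_A\underline{\mathcal K},\underline\delta)$; the operations $\mathscr L$ make $S_A\underline{\mathcal K}$ a Poisson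 $L_\infty$-algebra (an $L_\infty$-algebra whose operations are multiderivations of the graded commutative product), where the $L_\infty$-relations are $$\sum_{i+j=k}(-1)^{ij}\sum_{\sigma\in S_{i,j}}\chi(\sigma,v)\,\lambda_{j+1}(\lambda_i(v_{\sigma(1)},\dots,v_{\sigma(i)}),v_{\sigma(i+1)},\dots,v_{\sigma(k)})=0,\qquad k\ge 1;$$ and $\mathscr P$ and $\mathscr L$ coincide: the family $\mathscr P$ exists, is unique, and $\Lambda_k=\lambda_k$ for all $k\ge1$. -/

import Mathlib

set_option linter.unusedSectionVars false
set_option linter.unusedSimpArgs false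
set_option linter.unreachableTactic false
set_option linter.unusedTactic false

open scoped DirectSum TensorProduct

namespace StrongHomotopy

noncomputable section

/-! ### Graded vector spaces, complexes, contraction data -/

section Graded

variable {𝕜 V W : Type*} [Field 𝕜] [AddCommGroup V] [Module 𝕜 V] [AddCommGroup W] [Module 𝕜 W]

theorem map_sign_smul (f : V →ₗ[𝕜] W) (u : ℤˣ) (v : V) : f (u • v) = u • f v := by
  rw [Units.smul_def, map_zsmul, ← Units.smul_def]

theorem sign_smul_mem (P : Submodule 𝕜 V) (u : ℤˣ) {v : V} (hv : v ∈ P) : u • v ∈ P := by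
  rw [Units.smul_def]; exact zsmul_mem hv _

/-- `signTwist 𝒱 n` is the linear map sending a homogeneous `v` of degree `i` to `(-1)^(n*i) v`. -/
def signTwist (𝒱 : ℤ → Submodule 𝕜 V) [DirectSum.Decomposition 𝒱] (n : ℤ) : V →ₗ[𝕜] V :=
  DirectSum.toModule 𝕜 ℤ V (fun i => ((n * i).negOnePow : ℤˣ) • (𝒱 i).subtype) ∘ₗ
    (DirectSum.decomposeLinearEquiv 𝒱).toLinearMap

theorem signTwist_of_mem (𝒱 : ℤ → Submodule 𝕜 V) [DirectSum.Decomposition 𝒱] (n : ℤ)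
    {i : ℤ} {v : V} (hv : v ∈ 𝒱 i) : signTwist 𝒱 n v = (n * i).negOnePow • v := by
  simp only [signTwist, LinearMap.comp_apply, LinearEquiv.coe_coe,
    DirectSum.decomposeLinearEquiv_apply, DirectSum.decompose_of_mem 𝒱 hv]
  rw [← DirectSum.lof_eq_of 𝕜, DirectSum.toModule_lof]
  rfl

theorem signTwist_signTwist (𝒱 : ℤ → Submodule 𝕜 V) [DirectSum.Decomposition 𝒱] (m n : ℤ) (v : V) :
    signTwist 𝒱 m (signTwist 𝒱 n v) = signTwist 𝒱 (m + n) v := by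
  induction v using DirectSum.Decomposition.inductionOn 𝒱 with
  | zero => simp only [map_zero]
  | add x y hx hy => simp only [map_add, hx, hy]
  | homogeneous x =>
    rw [signTwist_of_mem 𝒱 n x.2, map_sign_smul, signTwist_of_mem 𝒱 m x.2,
      signTwist_of_mem 𝒱 _ x.2, smul_smul, add_mul, Int.negOnePow_add, mul_comm]

theorem signTwist_mem (𝒱 : ℤ → Submodule 𝕜 V) [DirectSum.Decomposition 𝒱] (n : ℤ) {i : ℤ} {v : V}
    (hv : v ∈ 𝒱 i) : signTwist 𝒱 n v ∈ 𝒱 i := by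
  rw [signTwist_of_mem 𝒱 n hv]; exact sign_smul_mem _ _ hv

/-- Two biadditive maps that agree on homogeneous elements are equal. -/
theorem bilinear_ext {X Y Z : Type*} [AddCommGroup X] [Module 𝕜 X] [AddCommGroup Y] [Module 𝕜 Y]
    [AddCommGroup Z] [Module 𝕜 Z]
    (𝒳 : ℤ → Submodule 𝕜 X) [DirectSum.Decomposition 𝒳]
    (𝒴 : ℤ → Submodule 𝕜 Y) [DirectSum.Decomposition 𝒴] (f g : X → Y → Z)
    (hf1 : ∀ x x' y, f (x + x') y = f x y + f x' y) (hf2 : ∀ x y y', f x (y + y') = f x y + f x y')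
    (hg1 : ∀ x x' y, g (x + x') y = g x y + g x' y) (hg2 : ∀ x y y', g x (y + y') = g x y + g x y')
    (h : ∀ i j x y, x ∈ 𝒳 i → y ∈ 𝒴 j → f x y = g x y) (x : X) (y : Y) : f x y = g x y := by
  induction x using DirectSum.Decomposition.inductionOn 𝒳 with
  | zero =>
    have h1 := hf1 0 0 y
    have h2 := hg1 0 0 y
    rw [add_zero] at h1 h2
    rw [left_eq_add.1 h1, left_eq_add.1 h2]
  | add x x' hx hx' => rw [hf1, hg1, hx, hx']
  | homogeneous x =>
    induction y using DirectSum.Decomposition.inductionOn 𝒴 with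
    | zero =>
      have h1 := hf2 x 0 0
      have h2 := hg2 x 0 0
      rw [add_zero] at h1 h2
      rw [left_eq_add.1 h1, left_eq_add.1 h2]
    | add y y' hy hy' => rw [hf2, hg2, hy, hy']
    | homogeneous y => exact h _ _ _ _ x.2 y.2

/-- `d` is a differential on the graded vector space `(V, 𝒱)`: degree `1` and square zero. -/
structure IsDifferential (𝒱 : ℤ → Submodule 𝕜 V) (d : V →ₗ[𝕜] V) : Prop where
  mem : ∀ {i : ℤ} {v : V}, v ∈ 𝒱 i → d v ∈ 𝒱 (i + 1)
  sq : ∀ v : V, d (d v) = 0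

/-- `(p, j, h)` are contraction data for the cochain complex `(V, d)` over the cochain complex
`(W, d')`. -/
structure IsContraction (𝒱 : ℤ → Submodule 𝕜 V) (d : V →ₗ[𝕜] V)
    (𝒲 : ℤ → Submodule 𝕜 W) (d' : W →ₗ[𝕜] W)
    (p : V →ₗ[𝕜] W) (j : W →ₗ[𝕜] V) (h : V →ₗ[𝕜] V) : Prop where
  diff_source : IsDifferential 𝒱 d
  diff_target : IsDifferential 𝒲 d'
  p_mem : ∀ {i : ℤ} {v : V}, v ∈ 𝒱 i → p v ∈ 𝒲 i
  j_mem : ∀ {i : ℤ} {w : W}, w ∈ 𝒲 i → j w ∈ 𝒱 i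
  h_mem : ∀ {i : ℤ} {v : V}, v ∈ 𝒱 i → h v ∈ 𝒱 (i - 1)
  p_d : ∀ v, p (d v) = d' (p v)
  j_d : ∀ w, j (d' w) = d (j w)
  p_j : ∀ w, p (j w) = w
  homotopy : ∀ v, h (d v) + d (h v) = v - j (p v)
  h_h : ∀ v, h (h v) = 0
  h_j : ∀ w, h (j w) = 0
  p_h : ∀ v, p (h v) = 0

/-! ### Unshuffles, signs, and strong homotopy Lie structures -/

/-- The sign `χ(σ, v)` with `v_{σ(1)} ∧ ⋯ ∧ v_{σ(k)} = χ(σ, v) v_1 ∧ ⋯ ∧ v_k` in the graded exterior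
algebra, for homogeneous `v_i` of degree `d i`: every inversion of `σ` contributes `-(-1)^(d d')`. -/
def chi {k : ℕ} (σ : Equiv.Perm (Fin k)) (d : Fin k → ℤ) : ℤˣ :=
  ∏ a : Fin k, ∏ b : Fin k,
    if a < b ∧ σ b < σ a then -(d (σ a) * d (σ b)).negOnePow else 1

/-- `σ` is an `(a, k - a)`-unshuffle: it is increasing on the first `a` indices and on the last
`k - a` indices. -/
def IsUnshuffle {k : ℕ} (a : ℕ) (σ : Equiv.Perm (Fin k)) : Prop :=
  ∀ s t : Fin k, s < t → ((t : ℕ) < a ∨ a ≤ (s : ℕ)) → σ s < σ t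

open Classical in
/-- The finite set `S_{a, k - a}` of `(a, k - a)`-unshuffles. -/
def unshuffles (k a : ℕ) : Finset (Equiv.Perm (Fin k)) :=
  Finset.univ.filter (fun σ => IsUnshuffle a σ)

/-- For a permutation `σ` of `k = a + b` letters, the reindexing
`(s in the first block) ↦ σ (s)`, `(t in the second block) ↦ σ (a + t)`. -/
def blocks {a b k : ℕ} (hk : a + b = k) (σ : Equiv.Perm (Fin k)) : Fin a ⊕ Fin b ≃ Fin k :=
  (finSumFinEquiv.trans (finCongr hk)).trans σ

/-- The multilinear map `x ↦ ⟨f (x restricted to the first block), g (x restricted to the second)⟩`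
for a bilinear map `⟨·,·⟩`. -/
def blockProduct (br : V →ₗ[𝕜] V →ₗ[𝕜] V) {a b k : ℕ}
    (f : MultilinearMap 𝕜 (fun _ : Fin a => W) V) (g : MultilinearMap 𝕜 (fun _ : Fin b => W) V)
    (e : Fin a ⊕ Fin b ≃ Fin k) : MultilinearMap 𝕜 (fun _ : Fin k => W) V :=
  ((TensorProduct.lift br).compMultilinearMap (f.domCoprod g)).domDomCongr e

@[simp]
theorem blockProduct_apply (br : V →ₗ[𝕜] V →ₗ[𝕜] V) {a b k : ℕ}
    (f : MultilinearMap 𝕜 (fun _ : Fin a => W) V) (g : MultilinearMap 𝕜 (fun _ : Fin b => W) V)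
    (e : Fin a ⊕ Fin b ≃ Fin k) (x : Fin k → W) :
    blockProduct br f g e x =
      br (f (fun s => x (e (Sum.inl s)))) (g (fun t => x (e (Sum.inr t)))) := rfl

/-- A family of operations: one `k`-ary multilinear operation for each `k`. Only the operations with
`k ≥ 1` are relevant. -/
abbrev Operations (𝕜 V : Type*) [Field 𝕜] [AddCommGroup V] [Module 𝕜 V] : Type _ :=
  (k : ℕ) → MultilinearMap 𝕜 (fun _ : Fin k => V) V

/-- A `k`-ary operation has degree `n`. -/
def HasDegree (𝒱 : ℤ → Submodule 𝕜 V) {k : ℕ} (n : ℤ)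
    (f : MultilinearMap 𝕜 (fun _ : Fin k => V) V) : Prop :=
  ∀ (d : Fin k → ℤ) (x : Fin k → V), (∀ s, x s ∈ 𝒱 (d s)) → f x ∈ 𝒱 ((∑ s, d s) + n)

/-- A `k`-ary operation is graded skew-symmetric. -/
def IsGradedSkew (𝒱 : ℤ → Submodule 𝕜 V) {k : ℕ}
    (f : MultilinearMap 𝕜 (fun _ : Fin k => V) V) : Prop :=
  ∀ (d : Fin k → ℤ) (x : Fin k → V), (∀ s, x s ∈ 𝒱 (d s)) →
    ∀ σ : Equiv.Perm (Fin k), f (fun s => x (σ s)) = chi σ d • f x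

/-- `L_∞`-algebras: graded skew-symmetric operations `λ_k` of degree `2 - k`, `k ≥ 1`, such that
`∑_{i+j=k} (-1)^{ij} ∑_{σ ∈ S_{i,j}} χ(σ,v) λ_{j+1}(λ_i(v_{σ(1)},…,v_{σ(i)}),v_{σ(i+1)},…) = 0`. -/
structure IsLInfinity (𝒱 : ℤ → Submodule 𝕜 V) (lam : Operations 𝕜 V) : Prop where
  degree : ∀ k : ℕ, 1 ≤ k → HasDegree 𝒱 (2 - (k : ℤ)) (lam k)
  skew : ∀ k : ℕ, 1 ≤ k → IsGradedSkew 𝒱 (lam k)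
  relation : ∀ k : ℕ, 1 ≤ k → ∀ (d : Fin k → ℤ) (v : Fin k → V), (∀ s, v s ∈ 𝒱 (d s)) →
    ∑ i ∈ (Finset.Icc 1 k).attach, ∑ σ ∈ unshuffles k i.1,
      ((i.1 : ℤ) * ((k - i.1 : ℕ) : ℤ)).negOnePow • chi σ d •
        lam ((k - i.1) + 1) (Fin.cons
          (lam i.1 (fun s => v (blocks (Nat.add_sub_of_le (Finset.mem_Icc.1 i.2).2) σ (Sum.inl s))))
          (fun t => v (blocks (Nat.add_sub_of_le (Finset.mem_Icc.1 i.2).2) σ (Sum.inr t)))) = 0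

/-! ### Homotopy transfer of a bracket -/

/-- The maps `ψ_k`: `ψ_1 = -j` and `ψ_k = h φ_k` for `k ≥ 2`, where
`φ_k(x_1,…,x_k) = ∑_{ℓ+m=k} ∑_{σ ∈ S_{ℓ,m}} (-1)^b χ(σ,x)
  [ψ_ℓ(x_{σ(1)},…,x_{σ(ℓ)}), ψ_m(x_{σ(ℓ+1)},…,x_{σ(k)})]`, `ℓ, m ≥ 1`,
`b = ℓ - 1 + (m - 1)(|x_{σ(1)}| + ⋯ + |x_{σ(ℓ)}|)`. The signs are evaluated on prescribed
degrees `d s` of the arguments `x s`. -/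
def psi (br : V →ₗ[𝕜] V →ₗ[𝕜] V) (j : W →ₗ[𝕜] V) (h : V →ₗ[𝕜] V) :
    (k : ℕ) → (Fin k → ℤ) → MultilinearMap 𝕜 (fun _ : Fin k => W) V
  | 0, _ => 0
  | 1, _ => -(j.compMultilinearMap (MultilinearMap.ofSubsingleton 𝕜 W W (0 : Fin 1) LinearMap.id))
  | k + 2, d => h.compMultilinearMap
      (∑ l ∈ (Finset.Ioo 0 (k + 2)).attach, ∑ σ ∈ unshuffles (k + 2) l.1,
        have hl := Finset.mem_Ioo.1 l.2
        let e := blocks (Nat.add_sub_of_le hl.2.le) σ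
        ((l.1 : ℤ) - 1 + (((k + 2 - l.1 : ℕ) : ℤ) - 1) * ∑ s, d (e (Sum.inl s))).negOnePow •
          chi σ d •
            blockProduct br
              (psi br j h l.1 (fun s => d (e (Sum.inl s))))
              (psi br j h (k + 2 - l.1) (fun t => d (e (Sum.inr t)))) e)
  termination_by k => k
  decreasing_by all_goals omega

/-- The maps `φ_k`, see `psi`. -/
def phi (br : V →ₗ[𝕜] V →ₗ[𝕜] V) (j : W →ₗ[𝕜] V) (h : V →ₗ[𝕜] V) (k : ℕ) (d : Fin k → ℤ) :
    MultilinearMap 𝕜 (fun _ : Fin k => W) V :=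
  ∑ l ∈ (Finset.Ioo 0 k).attach, ∑ σ ∈ unshuffles k l.1,
    have hl := Finset.mem_Ioo.1 l.2
    let e := blocks (Nat.add_sub_of_le hl.2.le) σ
    ((l.1 : ℤ) - 1 + (((k - l.1 : ℕ) : ℤ) - 1) * ∑ s, d (e (Sum.inl s))).negOnePow •
      chi σ d •
        blockProduct br
          (psi br j h l.1 (fun s => d (e (Sum.inl s))))
          (psi br j h (k - l.1) (fun t => d (e (Sum.inr t)))) e

theorem psi_one_apply (br : V →ₗ[𝕜] V →ₗ[𝕜] V) (j : W →ₗ[𝕜] V) (h : V →ₗ[𝕜] V)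
    (d : Fin 1 → ℤ) (x : Fin 1 → W) : psi br j h 1 d x = -(j (x 0)) := by
  simp [psi]

theorem psi_add_two (br : V →ₗ[𝕜] V →ₗ[𝕜] V) (j : W →ₗ[𝕜] V) (h : V →ₗ[𝕜] V) (k : ℕ)
    (d : Fin (k + 2) → ℤ) :
    psi br j h (k + 2) d = h.compMultilinearMap (phi br j h (k + 2) d) := by
  rw [psi, phi]

/-- The multilinear map whose value on homogeneous arguments of degrees `d` is given by `f d`. -/
def assemble (𝒲 : ℤ → Submodule 𝕜 W) [DirectSum.Decomposition 𝒲] {k : ℕ}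
    (f : (Fin k → ℤ) → MultilinearMap 𝕜 (fun _ : Fin k => W) V) :
    MultilinearMap 𝕜 (fun _ : Fin k => W) V :=
  (MultilinearMap.fromDFinsuppEquiv (fun _ : Fin k => ℤ) 𝕜
    (M := fun (_ : Fin k) (i : ℤ) => 𝒲 i)
    (fun d => (f d).compLinearMap (fun s => (𝒲 (d s)).subtype))).compLinearMap
      (fun _ => (DirectSum.decomposeLinearEquiv 𝒲).toLinearMap)

theorem assemble_of_mem (𝒲 : ℤ → Submodule 𝕜 W) [DirectSum.Decomposition 𝒲] {k : ℕ}
    (f : (Fin k → ℤ) → MultilinearMap 𝕜 (fun _ : Fin k => W) V) (d : Fin k → ℤ) (x : Fin k → W)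
    (hx : ∀ s, x s ∈ 𝒲 (d s)) : assemble 𝒲 f x = f d x := by
  have key : (fun s => (DirectSum.decomposeLinearEquiv 𝒲) (x s)) =
      fun s => (DFinsupp.single (d s) (⟨x s, hx s⟩ : 𝒲 (d s)) : Π₀ i, 𝒲 i) := by
    funext s
    rw [DirectSum.decomposeLinearEquiv_apply, DirectSum.decompose_of_mem 𝒲 (hx s)]
    rfl
  simp only [assemble, MultilinearMap.compLinearMap_apply, LinearEquiv.coe_coe]
  rw [key]
  exact (MultilinearMap.fromDFinsuppEquiv_single (R := 𝕜) (κ := fun _ : Fin k => ℤ)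
    (M := fun (_ : Fin k) (i : ℤ) => 𝒲 i)
    (fun d => (f d).compLinearMap (fun s => (𝒲 (d s)).subtype)) d
    (fun s => (⟨x s, hx s⟩ : 𝒲 (d s)))).trans rfl

/-- The operations transferred along `(p, j, h)` from a complex with bracket `br` to the complex
`(W, d')`: `λ_1 = d'` and `λ_k = p φ_k` for `k ≥ 2`. -/
def transfer (𝒲 : ℤ → Submodule 𝕜 W) [DirectSum.Decomposition 𝒲]
    (br : V →ₗ[𝕜] V →ₗ[𝕜] V) (d' : W →ₗ[𝕜] W)
    (p : V →ₗ[𝕜] W) (j : W →ₗ[𝕜] V) (h : V →ₗ[𝕜] V) : Operations 𝕜 W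
  | 0 => 0
  | 1 => d'.compMultilinearMap (MultilinearMap.ofSubsingleton 𝕜 W W (0 : Fin 1) LinearMap.id)
  | k + 2 => assemble 𝒲 (fun d => p.compMultilinearMap (phi br j h (k + 2) d))

end Graded

/-! ### Poisson `L_∞`-algebras -/

section Poisson

variable {𝕜 S : Type*} [Field 𝕜] [Ring S] [Algebra 𝕜 S]

/-- Graded commutativity: `a b = (-1)^{|a||b|} b a`. -/
def IsGradedComm (𝒮 : ℤ → Submodule 𝕜 S) : Prop :=
  ∀ (i j : ℤ) (a b : S), a ∈ 𝒮 i → b ∈ 𝒮 j → a * b = (i * j).negOnePow • (b * a)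

theorem signTwist_one (𝒮 : ℤ → Submodule 𝕜 S) [GradedAlgebra 𝒮] (n : ℤ) :
    signTwist 𝒮 n 1 = 1 := by
  rw [signTwist_of_mem 𝒮 n SetLike.GradedOne.one_mem]
  simp

theorem signTwist_mul (𝒮 : ℤ → Submodule 𝕜 S) [GradedAlgebra 𝒮] (n : ℤ) (x y : S) :
    signTwist 𝒮 n (x * y) = signTwist 𝒮 n x * signTwist 𝒮 n y := by
  refine bilinear_ext 𝒮 𝒮 (fun x y => signTwist 𝒮 n (x * y))
    (fun x y => signTwist 𝒮 n x * signTwist 𝒮 n y) ?_ ?_ ?_ ?_ ?_ x y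
  · intro x x' y; simp only [add_mul, map_add]
  · intro x y y'; simp only [mul_add, map_add]
  · intro x x' y; simp only [add_mul, map_add]
  · intro x y y'; simp only [mul_add, map_add]
  · intro i j x y hx hy
    simp only [signTwist_of_mem 𝒮 n hx, signTwist_of_mem 𝒮 n hy,
      signTwist_of_mem 𝒮 n (SetLike.GradedMul.mul_mem hx hy)]
    rw [smul_mul_assoc, mul_smul_comm, smul_smul, mul_add, Int.negOnePow_add]

/-- `f` is a graded multiderivation with `k` entries, as needed for an operation of an
`L_∞`-algebra: it has degree `2 - k`, is graded skew-symmetric, and is a graded derivation in each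
entry. -/
structure IsGradedMultiderivation (𝒮 : ℤ → Submodule 𝕜 S) {k : ℕ}
    (f : MultilinearMap 𝕜 (fun _ : Fin k => S) S) : Prop where
  degree : HasDegree 𝒮 (2 - (k : ℤ)) f
  skew : IsGradedSkew 𝒮 f
  leibniz : ∀ (d : Fin k → ℤ) (x : Fin k → S), (∀ s, x s ∈ 𝒮 (d s)) →
    ∀ (s : Fin k) (i j : ℤ) (u v : S), u ∈ 𝒮 i → v ∈ 𝒮 j →
      f (Function.update x s (u * v)) =
        (i * ((k : ℤ) + ∑ t ∈ Finset.univ.filter (fun t => t < s), d t)).negOnePow •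
            (u * f (Function.update x s v)) +
          (j * ∑ t ∈ Finset.univ.filter (fun t => s < t), d t).negOnePow •
            (f (Function.update x s u) * v)

/-- Poisson `L_∞`-algebras: `L_∞`-algebras with a graded commutative product such that the operations
are multiderivations. -/
structure IsPoissonLInfinity (𝒮 : ℤ → Submodule 𝕜 S) [GradedAlgebra 𝒮]
    (lam : Operations 𝕜 S) : Prop where
  gradedComm : IsGradedComm 𝒮
  isLInfinity : IsLInfinity 𝒮 lam
  multiderivation : ∀ k : ℕ, 1 ≤ k → IsGradedMultiderivation 𝒮 (lam k)

end Poisson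

/-! ### DG commutative algebras, DG modules, DG Lie-Rinehart algebras -/

section ProdGrading

variable {𝕜 A M : Type*} [Field 𝕜] [AddCommGroup A] [Module 𝕜 A] [AddCommGroup M] [Module 𝕜 M]

/-- The grading of `A × M`, with components `𝒜 i × ℳ i`. -/
def prodGrading (𝒜 : ℤ → Submodule 𝕜 A) (ℳ : ℤ → Submodule 𝕜 M) (i : ℤ) : Submodule 𝕜 (A × M) :=
  (𝒜 i).prod (ℳ i)

theorem mem_prodGrading {𝒜 : ℤ → Submodule 𝕜 A} {ℳ : ℤ → Submodule 𝕜 M} {i : ℤ} {x : A × M} :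
    x ∈ prodGrading 𝒜 ℳ i ↔ x.1 ∈ 𝒜 i ∧ x.2 ∈ ℳ i := Iff.rfl

instance prodGrading.decomposition (𝒜 : ℤ → Submodule 𝕜 A) [DirectSum.Decomposition 𝒜]
    (ℳ : ℤ → Submodule 𝕜 M) [DirectSum.Decomposition ℳ] :
    DirectSum.Decomposition (prodGrading 𝒜 ℳ) := by
  refine DirectSum.Decomposition.ofLinearMap (prodGrading 𝒜 ℳ)
    (LinearMap.coprod
      (DirectSum.toModule 𝕜 ℤ (⨁ i, prodGrading 𝒜 ℳ i) (fun i =>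
        DirectSum.lof 𝕜 ℤ (fun i => prodGrading 𝒜 ℳ i) i ∘ₗ
          (((LinearMap.inl 𝕜 A M).comp (𝒜 i).subtype).codRestrict (prodGrading 𝒜 ℳ i)
            (fun a => ⟨a.2, (ℳ i).zero_mem⟩))) ∘ₗ
        (DirectSum.decomposeLinearEquiv 𝒜).toLinearMap)
      (DirectSum.toModule 𝕜 ℤ (⨁ i, prodGrading 𝒜 ℳ i) (fun i =>
        DirectSum.lof 𝕜 ℤ (fun i => prodGrading 𝒜 ℳ i) i ∘ₗ
          (((LinearMap.inr 𝕜 A M).comp (ℳ i).subtype).codRestrict (prodGrading 𝒜 ℳ i)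
            (fun m => ⟨(𝒜 i).zero_mem, m.2⟩))) ∘ₗ
        (DirectSum.decomposeLinearEquiv ℳ).toLinearMap)) ?_ ?_
  · apply LinearMap.prod_ext
    · ext1 a
      induction a using DirectSum.Decomposition.inductionOn 𝒜 with
      | zero => simp only [map_zero]
      | add x y hx hy => simp only [map_add, hx, hy]
      | homogeneous x =>
        simp
        rfl
    · ext1 a
      induction a using DirectSum.Decomposition.inductionOn ℳ with
      | zero => simp only [map_zero]
      | add x y hx hy => simp only [map_add, hx, hy]
      | homogeneous x =>
        simp
        rfl
  · apply DirectSum.linearMap_ext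
    intro i
    ext1 x
    obtain ⟨⟨a, m⟩, ha, hm⟩ := x
    simp only [LinearMap.comp_apply, DirectSum.coeLinearMap_lof, LinearMap.coprod_apply,
      LinearEquiv.coe_coe, DirectSum.decomposeLinearEquiv_apply,
      DirectSum.decompose_of_mem 𝒜 ha, DirectSum.decompose_of_mem ℳ hm, LinearMap.id_apply]
    rw [← DirectSum.lof_eq_of 𝕜, ← DirectSum.lof_eq_of 𝕜, DirectSum.toModule_lof,
      DirectSum.toModule_lof, LinearMap.comp_apply, LinearMap.comp_apply, ← map_add]
    congr 1
    ext
    · exact add_zero a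
    · exact zero_add m

end ProdGrading

section LieRinehart

variable {𝕜 A M N : Type*} [Field 𝕜] [Ring A] [Algebra 𝕜 A]
  [AddCommGroup M] [Module 𝕜 M] [Module A M] [IsScalarTower 𝕜 A M]
  [AddCommGroup N] [Module 𝕜 N] [Module A N] [IsScalarTower 𝕜 A N]

/-- A differential turning the graded algebra `(A, 𝒜)` into a commutative DG algebra. -/
structure DGCommStructure (𝒜 : ℤ → Submodule 𝕜 A) [GradedAlgebra 𝒜] where
  gradedComm : IsGradedComm 𝒜
  d : A →ₗ[𝕜] A
  isDifferential : IsDifferential 𝒜 d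
  leibniz : ∀ (i : ℤ) (a b : A), a ∈ 𝒜 i → d (a * b) = d a * b + i.negOnePow • (a * d b)

variable {𝒜 : ℤ → Submodule 𝕜 A} [GradedAlgebra 𝒜]

/-- A differential turning the graded module `(M, ℳ)` into a DG module over a commutative
DG algebra. -/
structure DGModuleStructure (D : DGCommStructure 𝒜) (ℳ : ℤ → Submodule 𝕜 M)
    [DirectSum.Decomposition ℳ] [SetLike.GradedSMul 𝒜 ℳ] where
  d : M →ₗ[𝕜] M
  isDifferential : IsDifferential ℳ d
  leibniz : ∀ (i : ℤ) (a : A) (m : M), a ∈ 𝒜 i → d (a • m) = D.d a • m + i.negOnePow • (a • d m)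

/-- A DG Lie-Rinehart algebra `(M, ℳ)` over a commutative DG algebra: a DG module with a graded Lie
bracket and an action on `A` such that the graded Lie-Rinehart axioms hold, and such that the
differentials are derivations of the bracket and of the action. -/
structure DGLieRinehartStructure (D : DGCommStructure 𝒜) (ℳ : ℤ → Submodule 𝕜 M)
    [DirectSum.Decomposition ℳ] [SetLike.GradedSMul 𝒜 ℳ] extends DGModuleStructure D ℳ where
  bracket : M →ₗ[𝕜] M →ₗ[𝕜] M
  act : M →ₗ[𝕜] A →ₗ[𝕜] A
  bracket_mem : ∀ (i j : ℤ) (q r : M), q ∈ ℳ i → r ∈ ℳ j → bracket q r ∈ ℳ (i + j)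
  act_mem : ∀ (i j : ℤ) (q : M) (a : A), q ∈ ℳ i → a ∈ 𝒜 j → act q a ∈ 𝒜 (i + j)
  skew : ∀ (i j : ℤ) (q r : M), q ∈ ℳ i → r ∈ ℳ j →
    bracket q r = -((i * j).negOnePow • bracket r q)
  jacobi : ∀ (i j : ℤ) (q r s : M), q ∈ ℳ i → r ∈ ℳ j →
    bracket q (bracket r s) =
      bracket (bracket q r) s + (i * j).negOnePow • bracket r (bracket q s)
  bracket_act : ∀ (i j : ℤ) (q r : M) (a : A), q ∈ ℳ i → r ∈ ℳ j →
    act (bracket q r) a = act q (act r a) - (i * j).negOnePow • act r (act q a)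
  smul_act : ∀ (a : A) (q : M) (b : A), act (a • q) b = a * act q b
  act_mul : ∀ (i j : ℤ) (q : M) (a b : A), q ∈ ℳ i → a ∈ 𝒜 j →
    act q (a * b) = act q a * b + (j * i).negOnePow • (a * act q b)
  smul_bracket : ∀ (i j l : ℤ) (a : A) (q r : M), a ∈ 𝒜 i → q ∈ ℳ j → r ∈ ℳ l →
    bracket (a • q) r = a • bracket q r - (l * (i + j)).negOnePow • (act r a • q)
  d_bracket : ∀ (i : ℤ) (q r : M), q ∈ ℳ i →
    d (bracket q r) = bracket (d q) r + i.negOnePow • bracket q (d r)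
  d_act : ∀ (i : ℤ) (q : M) (a : A), q ∈ ℳ i →
    D.d (act q a) = act (d q) a + i.negOnePow • act q (D.d a)

/-- `A`-linear contraction data for the DG module `(M, X.d)` over the DG module `(N, Y.d)`. -/
structure LinearContraction {D : DGCommStructure 𝒜} {ℳ : ℤ → Submodule 𝕜 M}
    [DirectSum.Decomposition ℳ] [SetLike.GradedSMul 𝒜 ℳ] {𝒩 : ℤ → Submodule 𝕜 N}
    [DirectSum.Decomposition 𝒩] [SetLike.GradedSMul 𝒜 𝒩]
    (X : DGModuleStructure D ℳ) (Y : DGModuleStructure D 𝒩) where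
  p : M →ₗ[𝕜] N
  j : N →ₗ[𝕜] M
  h : M →ₗ[𝕜] M
  isContraction : IsContraction ℳ X.d 𝒩 Y.d p j h
  p_smul : ∀ (a : A) (m : M), p (a • m) = a • p m
  j_smul : ∀ (a : A) (n : N), j (a • n) = a • j n
  h_smul : ∀ (i : ℤ) (a : A) (m : M), a ∈ 𝒜 i → h (a • m) = i.negOnePow • (a • h m)

variable {D : DGCommStructure 𝒜} {ℳ : ℤ → Submodule 𝕜 M} [DirectSum.Decomposition ℳ]
  [SetLike.GradedSMul 𝒜 ℳ]

/-- The bilinear map `(a, q) ↦ (-1)^{|a||q|} q · a`. -/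
def DGLieRinehartStructure.flipAct (X : DGLieRinehartStructure D ℳ) : A →ₗ[𝕜] M →ₗ[𝕜] A :=
  DirectSum.toModule 𝕜 ℤ (M →ₗ[𝕜] A)
      (fun i => (X.act ∘ₗ signTwist ℳ i).flip ∘ₗ (𝒜 i).subtype) ∘ₗ
    (DirectSum.decomposeLinearEquiv 𝒜).toLinearMap

theorem DGLieRinehartStructure.flipAct_apply (X : DGLieRinehartStructure D ℳ) {i j : ℤ} {a : A}
    {q : M} (ha : a ∈ 𝒜 i) (hq : q ∈ ℳ j) :
    X.flipAct a q = (i * j).negOnePow • X.act q a := by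
  simp only [flipAct, LinearMap.comp_apply, LinearEquiv.coe_coe,
    DirectSum.decomposeLinearEquiv_apply, DirectSum.decompose_of_mem 𝒜 ha]
  rw [← DirectSum.lof_eq_of 𝕜, DirectSum.toModule_lof]
  simp only [LinearMap.comp_apply, LinearMap.flip_apply, Submodule.subtype_apply,
    signTwist_of_mem ℳ i hq, map_sign_smul, LinearMap.smul_apply]

/-- The graded Lie bracket on `A ⊕ M`, the semidirect product of the graded Lie algebra `M` and the
`M`-module `A`: `[a, b] = 0`, `[q, a] = q · a = -(-1)^{|a||q|} [a, q]`, and `[q, r]` is the bracket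
of `M`. -/
def DGLieRinehartStructure.semidirect (X : DGLieRinehartStructure D ℳ) :
    A × M →ₗ[𝕜] A × M →ₗ[𝕜] A × M :=
  LinearMap.mk₂ 𝕜
    (fun x y => (X.act x.2 y.1 - X.flipAct x.1 y.2, X.bracket x.2 y.2))
    (by intro x x' y; ext <;> simp; abel)
    (by intro c x y; ext <;> simp [smul_sub])
    (by intro x y y'; ext <;> simp; abel)
    (by intro c x y; ext <;> simp [smul_sub])

theorem DGLieRinehartStructure.semidirect_apply (X : DGLieRinehartStructure D ℳ) (x y : A × M) :
    X.semidirect x y = (X.act x.2 y.1 - X.flipAct x.1 y.2, X.bracket x.2 y.2) := rfl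

theorem DGLieRinehartStructure.semidirect_mem (X : DGLieRinehartStructure D ℳ) {i j : ℤ}
    {x y : A × M} (hx : x ∈ prodGrading 𝒜 ℳ i) (hy : y ∈ prodGrading 𝒜 ℳ j) :
    X.semidirect x y ∈ prodGrading 𝒜 ℳ (i + j) := by
  rw [semidirect_apply, mem_prodGrading, X.flipAct_apply hx.1 hy.2]
  refine ⟨sub_mem (X.act_mem _ _ _ _ hx.2 hy.1) ?_, X.bracket_mem _ _ _ _ hx.2 hy.2⟩
  rw [Units.smul_def]
  exact zsmul_mem (by rw [add_comm]; exact X.act_mem _ _ _ _ hy.2 hx.1) _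

end LieRinehart

/-! ### The graded symmetric algebra -/

section Sym

variable {𝕜 A M : Type*} [Field 𝕜] [Ring A] [Algebra 𝕜 A]
  [AddCommGroup M] [Module 𝕜 M] [Module A M]

/-- The relations defining the graded symmetric algebra of the graded `A`-module `M` as a quotient of
the tensor algebra of the `𝕜`-vector space `A ⊕ M`: the unit, the product of `A` and the action of
`A` on `M` are the ones of the symmetric algebra, and homogeneous generators commute up to the
sign `(-1)^{ij}`. -/
inductive GradedSym.Rel (𝒜 : ℤ → Submodule 𝕜 A) (ℳ : ℤ → Submodule 𝕜 M) :
    TensorAlgebra 𝕜 (A × M) → TensorAlgebra 𝕜 (A × M) → Prop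
  | one : GradedSym.Rel 𝒜 ℳ (TensorAlgebra.ι 𝕜 ((1, 0) : A × M)) 1
  | mul (a b : A) : GradedSym.Rel 𝒜 ℳ
      (TensorAlgebra.ι 𝕜 ((a, 0) : A × M) * TensorAlgebra.ι 𝕜 ((b, 0) : A × M))
      (TensorAlgebra.ι 𝕜 ((a * b, 0) : A × M))
  | smul (a : A) (m : M) : GradedSym.Rel 𝒜 ℳ
      (TensorAlgebra.ι 𝕜 ((a, 0) : A × M) * TensorAlgebra.ι 𝕜 ((0, m) : A × M))
      (TensorAlgebra.ι 𝕜 ((0, a • m) : A × M))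
  | comm (i j : ℤ) (x y : A × M) (hx : x ∈ prodGrading 𝒜 ℳ i) (hy : y ∈ prodGrading 𝒜 ℳ j) :
      GradedSym.Rel 𝒜 ℳ (TensorAlgebra.ι 𝕜 x * TensorAlgebra.ι 𝕜 y)
        ((i * j).negOnePow • (TensorAlgebra.ι 𝕜 y * TensorAlgebra.ι 𝕜 x))

/-- The graded symmetric algebra `S_A M` of the graded module `(M, ℳ)` over the graded algebra
`(A, 𝒜)`. -/
def GradedSym (𝒜 : ℤ → Submodule 𝕜 A) (ℳ : ℤ → Submodule 𝕜 M) : Type _ :=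
  RingQuot (GradedSym.Rel 𝒜 ℳ)

namespace GradedSym

variable (𝒜 : ℤ → Submodule 𝕜 A) (ℳ : ℤ → Submodule 𝕜 M)

instance instRing : Ring (GradedSym 𝒜 ℳ) := inferInstanceAs (Ring (RingQuot (GradedSym.Rel 𝒜 ℳ)))

instance instAlgebra : Algebra 𝕜 (GradedSym 𝒜 ℳ) :=
  inferInstanceAs (Algebra 𝕜 (RingQuot (GradedSym.Rel 𝒜 ℳ)))

/-- The canonical map `A ⊕ M → S_A M`. -/
def gen : A × M →ₗ[𝕜] GradedSym 𝒜 ℳ :=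
  (RingQuot.mkAlgHom 𝕜 (GradedSym.Rel 𝒜 ℳ)).toLinearMap ∘ₗ TensorAlgebra.ι 𝕜

theorem gen_one : gen 𝒜 ℳ (1, 0) = 1 :=
  (RingQuot.mkAlgHom_rel 𝕜 (GradedSym.Rel.one (𝒜 := 𝒜) (ℳ := ℳ))).trans (map_one _)

theorem gen_mul_gen (a b : A) : gen 𝒜 ℳ (a, 0) * gen 𝒜 ℳ (b, 0) = gen 𝒜 ℳ (a * b, 0) :=
  (map_mul (RingQuot.mkAlgHom 𝕜 (GradedSym.Rel 𝒜 ℳ)) _ _).symm.trans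
    (RingQuot.mkAlgHom_rel 𝕜 (GradedSym.Rel.mul a b))

theorem gen_mul_gen_smul (a : A) (m : M) :
    gen 𝒜 ℳ (a, 0) * gen 𝒜 ℳ (0, m) = gen 𝒜 ℳ (0, a • m) :=
  (map_mul (RingQuot.mkAlgHom 𝕜 (GradedSym.Rel 𝒜 ℳ)) _ _).symm.trans
    (RingQuot.mkAlgHom_rel 𝕜 (GradedSym.Rel.smul a m))

theorem gen_comm {i j : ℤ} {x y : A × M} (hx : x ∈ prodGrading 𝒜 ℳ i)
    (hy : y ∈ prodGrading 𝒜 ℳ j) :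
    gen 𝒜 ℳ x * gen 𝒜 ℳ y = (i * j).negOnePow • (gen 𝒜 ℳ y * gen 𝒜 ℳ x) := by
  have h1 := RingQuot.mkAlgHom_rel 𝕜 (GradedSym.Rel.comm (𝒜 := 𝒜) (ℳ := ℳ) i j x y hx hy)
  rw [map_mul] at h1
  refine h1.trans ?_
  refine (map_sign_smul (RingQuot.mkAlgHom 𝕜 (GradedSym.Rel 𝒜 ℳ)).toLinearMap _ _).trans ?_
  exact congrArg _ (map_mul (RingQuot.mkAlgHom 𝕜 (GradedSym.Rel 𝒜 ℳ)) _ _)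

/-- A linear map `f` from the generators `A ⊕ M` to an algebra `B` is compatible with the defining
relations of `S_A M`. -/
structure Compatible {B : Type*} [Ring B] [Algebra 𝕜 B] (f : A × M →ₗ[𝕜] B) : Prop where
  one : f (1, 0) = 1
  mul : ∀ a b : A, f (a, 0) * f (b, 0) = f (a * b, 0)
  smul : ∀ (a : A) (m : M), f (a, 0) * f (0, m) = f (0, a • m)
  comm : ∀ (i j : ℤ) (x y : A × M), x ∈ prodGrading 𝒜 ℳ i → y ∈ prodGrading 𝒜 ℳ j →
    f x * f y = (i * j).negOnePow • (f y * f x)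

variable {𝒜 ℳ}

/-- The universal property of `S_A M`. -/
def lift {B : Type*} [Ring B] [Algebra 𝕜 B] (f : A × M →ₗ[𝕜] B) (hf : Compatible 𝒜 ℳ f) :
    GradedSym 𝒜 ℳ →ₐ[𝕜] B :=
  RingQuot.liftAlgHom 𝕜 ⟨TensorAlgebra.lift 𝕜 f, by
    intro x y h
    induction h with
    | one => simpa using hf.one
    | mul a b => simpa using hf.mul a b
    | smul a m => simpa using hf.smul a m
    | comm i j x y hx hy =>
      rw [map_mul, TensorAlgebra.lift_ι_apply, TensorAlgebra.lift_ι_apply, hf.comm i j x y hx hy]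
      refine Eq.trans ?_ (map_sign_smul (TensorAlgebra.lift 𝕜 f).toLinearMap _ _).symm
      simp⟩

@[simp]
theorem lift_gen {B : Type*} [Ring B] [Algebra 𝕜 B] (f : A × M →ₗ[𝕜] B) (hf : Compatible 𝒜 ℳ f)
    (x : A × M) : lift f hf (gen 𝒜 ℳ x) = f x := by
  refine (RingQuot.liftAlgHom_mkAlgHom_apply 𝕜 (TensorAlgebra.lift 𝕜 f) _
    (TensorAlgebra.ι 𝕜 x)).trans ?_
  exact TensorAlgebra.lift_ι_apply f x

theorem hom_ext {B : Type*} [Ring B] [Algebra 𝕜 B] {f g : GradedSym 𝒜 ℳ →ₐ[𝕜] B}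
    (h : ∀ x, f (gen 𝒜 ℳ x) = g (gen 𝒜 ℳ x)) : f = g := by
  apply RingQuot.ringQuot_ext'
  apply TensorAlgebra.hom_ext
  exact LinearMap.ext h

/-- Induction principle: `S_A M` is generated as an algebra by the image of `A ⊕ M`. -/
theorem induction {motive : GradedSym 𝒜 ℳ → Prop} (hgen : ∀ x, motive (gen 𝒜 ℳ x))
    (hadd : ∀ x y, motive x → motive y → motive (x + y))
    (hmul : ∀ x y, motive x → motive y → motive (x * y)) (x : GradedSym 𝒜 ℳ) : motive x := by
  have h0 : ∀ r : 𝕜, motive (algebraMap 𝕜 _ r) := by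
    intro r
    have := hgen (r • (1, 0))
    rwa [map_smul, gen_one, ← Algebra.algebraMap_eq_smul_one] at this
  let T : Subalgebra 𝕜 (GradedSym 𝒜 ℳ) :=
    { carrier := {x | motive x}
      mul_mem' := fun {a b} ha hb => hmul a b ha hb
      add_mem' := fun {a b} ha hb => hadd a b ha hb
      algebraMap_mem' := h0 }
  let f : GradedSym 𝒜 ℳ →ₐ[𝕜] T := lift ((gen 𝒜 ℳ).codRestrict (Subalgebra.toSubmodule T) hgen)
    { one := Subtype.ext (gen_one 𝒜 ℳ)
      mul := fun a b => Subtype.ext (gen_mul_gen 𝒜 ℳ a b)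
      smul := fun a m => Subtype.ext (gen_mul_gen_smul 𝒜 ℳ a m)
      comm := fun i j x y hx hy => Subtype.ext (by
        refine (gen_comm 𝒜 ℳ hx hy).trans ?_
        exact (map_sign_smul T.val.toLinearMap (i * j).negOnePow
          ((⟨gen 𝒜 ℳ y, hgen y⟩ : T) * ⟨gen 𝒜 ℳ x, hgen x⟩)).symm) }
  have hf : T.val.comp f = AlgHom.id 𝕜 _ := by
    apply hom_ext
    intro x
    simp only [f, AlgHom.comp_apply, lift_gen]
    rfl
  have := DFunLike.congr_fun hf x
  rw [← show T.val (f x) = x from this]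
  exact (f x).2

/-! The grading of `S_A M`. -/

variable (𝒜 ℳ)

/-- The map `A ⊕ M → (S_A M)[T, T⁻¹]` with `x ↦ T^i x` for `x` homogeneous of degree `i`. -/
def coGen [DirectSum.Decomposition 𝒜] [DirectSum.Decomposition ℳ] :
    A × M →ₗ[𝕜] AddMonoidAlgebra (GradedSym 𝒜 ℳ) ℤ :=
  DirectSum.toModule 𝕜 ℤ _ (fun i =>
      AddMonoidAlgebra.lsingle i ∘ₗ gen 𝒜 ℳ ∘ₗ (prodGrading 𝒜 ℳ i).subtype) ∘ₗ
    (DirectSum.decomposeLinearEquiv (prodGrading 𝒜 ℳ)).toLinearMap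

variable {𝒜 ℳ}

theorem coGen_of_mem [DirectSum.Decomposition 𝒜] [DirectSum.Decomposition ℳ] {i : ℤ} {x : A × M}
    (hx : x ∈ prodGrading 𝒜 ℳ i) : coGen 𝒜 ℳ x = AddMonoidAlgebra.single i (gen 𝒜 ℳ x) := by
  simp only [coGen, LinearMap.comp_apply, LinearEquiv.coe_coe,
    DirectSum.decomposeLinearEquiv_apply, DirectSum.decompose_of_mem _ hx]
  rw [← DirectSum.lof_eq_of 𝕜, DirectSum.toModule_lof]
  rfl

theorem inl_mem {i : ℤ} {a : A} (ha : a ∈ 𝒜 i) : ((a, 0) : A × M) ∈ prodGrading 𝒜 ℳ i :=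
  ⟨ha, (ℳ i).zero_mem⟩

theorem inr_mem {i : ℤ} {m : M} (hm : m ∈ ℳ i) : ((0, m) : A × M) ∈ prodGrading 𝒜 ℳ i :=
  ⟨(𝒜 i).zero_mem, hm⟩

variable [GradedAlgebra 𝒜] [DirectSum.Decomposition ℳ] [SetLike.GradedSMul 𝒜 ℳ]

theorem gen_inl_add (a b : A) :
    (((a + b, 0) : A × M)) = (a, 0) + (b, 0) := by simp

theorem gen_inr_add (m n : M) :
    (((0, m + n) : A × M)) = (0, m) + (0, n) := by simp

/-- A linear map on generators is compatible with the relations as soon as this holds for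
homogeneous elements. -/
theorem Compatible.of_homogeneous {B : Type*} [Ring B] [Algebra 𝕜 B] {f : A × M →ₗ[𝕜] B}
    (one : f (1, 0) = 1)
    (mul : ∀ (i j : ℤ) (a b : A), a ∈ 𝒜 i → b ∈ 𝒜 j → f (a, 0) * f (b, 0) = f (a * b, 0))
    (smul : ∀ (i j : ℤ) (a : A) (m : M), a ∈ 𝒜 i → m ∈ ℳ j →
      f (a, 0) * f (0, m) = f (0, a • m))
    (comm : ∀ (i j : ℤ) (x y : A × M), x ∈ prodGrading 𝒜 ℳ i → y ∈ prodGrading 𝒜 ℳ j →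
      f x * f y = (i * j).negOnePow • (f y * f x)) : Compatible 𝒜 ℳ f where
  one := one
  mul := by
    refine bilinear_ext 𝒜 𝒜 (fun a b => f (a, 0) * f (b, 0)) (fun a b => f (a * b, 0))
      ?_ ?_ ?_ ?_ mul
    · intro x x' y; simp only [gen_inl_add, map_add, add_mul]
    · intro x y y'; simp only [gen_inl_add, map_add, mul_add]
    · intro x x' y; simp only [gen_inl_add, map_add, add_mul]
    · intro x y y'; simp only [gen_inl_add, map_add, mul_add]
  smul := by
    refine bilinear_ext 𝒜 ℳ (fun a b => f (a, 0) * f (0, b)) (fun a b => f (0, a • b))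
      ?_ ?_ ?_ ?_ smul
    · intro x x' y; simp only [gen_inl_add, map_add, add_mul]
    · intro x y y'; simp only [gen_inr_add, map_add, mul_add]
    · intro x x' y; simp only [add_smul, gen_inr_add, map_add]
    · intro x y y'; simp only [smul_add, gen_inr_add, map_add]
  comm := comm

theorem coGen_compatible : Compatible 𝒜 ℳ (coGen 𝒜 ℳ) := by
  apply Compatible.of_homogeneous
  · rw [coGen_of_mem (inl_mem SetLike.GradedOne.one_mem), gen_one]
    rfl
  · intro i j a b ha hb
    rw [coGen_of_mem (inl_mem ha), coGen_of_mem (inl_mem hb),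
      coGen_of_mem (inl_mem (SetLike.GradedMul.mul_mem ha hb)), AddMonoidAlgebra.single_mul_single,
      gen_mul_gen]
  · intro i j a m ha hm
    rw [coGen_of_mem (inl_mem ha), coGen_of_mem (inr_mem hm),
      coGen_of_mem (inr_mem (SetLike.GradedSMul.smul_mem ha hm)),
      AddMonoidAlgebra.single_mul_single, gen_mul_gen_smul, vadd_eq_add]
  · intro i j x y hx hy
    rw [coGen_of_mem hx, coGen_of_mem hy, AddMonoidAlgebra.single_mul_single,
      AddMonoidAlgebra.single_mul_single, gen_comm 𝒜 ℳ hx hy, add_comm j i]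
    rcases Int.units_eq_one_or (i * j).negOnePow with h | h <;> rw [h] <;>
      simp [AddMonoidAlgebra.single_neg]

variable (𝒜 ℳ)

/-- The algebra morphism `S_A M → (S_A M)[T, T⁻¹]` with `x ↦ T^i x` for every generator
`x ∈ A ⊕ M` of degree `i`. -/
def coaction : GradedSym 𝒜 ℳ →ₐ[𝕜] AddMonoidAlgebra (GradedSym 𝒜 ℳ) ℤ :=
  lift (coGen 𝒜 ℳ) coGen_compatible

/-- The component of degree `n` of `S_A M`. It is spanned by the products of homogeneous generators
whose degrees add up to `n`; equivalently it consists of the `x` with `coaction x = T^n x`. -/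
def deg (n : ℤ) : Submodule 𝕜 (GradedSym 𝒜 ℳ) :=
  LinearMap.ker ((coaction 𝒜 ℳ).toLinearMap - AddMonoidAlgebra.lsingle n)

variable {𝒜 ℳ}

theorem mem_deg {n : ℤ} {x : GradedSym 𝒜 ℳ} :
    x ∈ deg 𝒜 ℳ n ↔ coaction 𝒜 ℳ x = AddMonoidAlgebra.single n x := by
  rw [deg, LinearMap.mem_ker, LinearMap.sub_apply, sub_eq_zero]
  rfl

theorem gen_mem {i : ℤ} {x : A × M} (hx : x ∈ prodGrading 𝒜 ℳ i) :
    gen 𝒜 ℳ x ∈ deg 𝒜 ℳ i := by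
  rw [mem_deg, coaction, lift_gen, coGen_of_mem hx]

instance gradedMonoid : SetLike.GradedMonoid (deg 𝒜 ℳ) where
  one_mem := by rw [mem_deg, map_one]; rfl
  mul_mem := by
    intro i j x y hx hy
    rw [mem_deg] at hx hy ⊢
    rw [map_mul, hx, hy, AddMonoidAlgebra.single_mul_single]

/-- Induction over homogeneous products of homogeneous generators. -/
theorem homogeneous_induction {motive : GradedSym 𝒜 ℳ → Prop}
    (hgen : ∀ i x, x ∈ prodGrading 𝒜 ℳ i → motive (gen 𝒜 ℳ x))
    (hadd : ∀ x y, motive x → motive y → motive (x + y))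
    (hmul : ∀ x y, motive x → motive y → motive (x * y)) (x : GradedSym 𝒜 ℳ) : motive x := by
  refine induction (fun x => ?_) hadd hmul x
  induction x using DirectSum.Decomposition.inductionOn (prodGrading 𝒜 ℳ) with
  | zero => exact hgen 0 0 (zero_mem _)
  | add x y hx hy => rw [map_add]; exact hadd _ _ hx hy
  | homogeneous x => exact hgen _ _ x.2

theorem mem_iSup_deg (x : GradedSym 𝒜 ℳ) : x ∈ ⨆ n, deg 𝒜 ℳ n := by
  refine homogeneous_induction (fun i x hx => Submodule.mem_iSup_of_mem i (gen_mem hx))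
    (fun x y hx hy => add_mem hx hy) (fun x y hx hy => ?_) x
  refine Submodule.iSup_induction _ (motive := fun x => x * y ∈ ⨆ n, deg 𝒜 ℳ n) hx
    (fun i x hx => ?_) (by simp) (fun a b ha hb => by rw [add_mul]; exact add_mem ha hb)
  refine Submodule.iSup_induction _ (motive := fun y => x * y ∈ ⨆ n, deg 𝒜 ℳ n) hy
    (fun j y hy => ?_) (by simp) (fun a b ha hb => by rw [mul_add]; exact add_mem ha hb)
  exact Submodule.mem_iSup_of_mem (i + j) (SetLike.GradedMul.mul_mem hx hy)

theorem coaction_coeff_mem (x : GradedSym 𝒜 ℳ) (n : ℤ) :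
    (coaction 𝒜 ℳ x).coeff n ∈ deg 𝒜 ℳ n := by
  refine Submodule.iSup_induction _ (motive := fun x => (coaction 𝒜 ℳ x).coeff n ∈ deg 𝒜 ℳ n)
    (mem_iSup_deg x) (fun i x hx => ?_) (by simp) (fun a b ha hb => ?_)
  · rw [mem_deg.1 hx, AddMonoidAlgebra.coeff_single, Finsupp.single_apply]
    split_ifs with h
    · exact h ▸ hx
    · exact zero_mem _
  · rw [map_add, AddMonoidAlgebra.coeff_add, Finsupp.add_apply]
    exact add_mem ha hb

theorem deg_isInternal : DirectSum.IsInternal (deg 𝒜 ℳ) := by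
  rw [DirectSum.isInternal_submodule_iff_iSupIndep_and_iSup_eq_top]
  refine ⟨?_, eq_top_iff.2 fun x _ => mem_iSup_deg x⟩
  refine iSupIndep_of_dfinsupp_lsum_injective _ ?_
  rw [injective_iff_map_eq_zero]
  intro f hf
  have key : ∀ (n : ℤ) (f : Π₀ i, deg 𝒜 ℳ i),
      (coaction 𝒜 ℳ (DFinsupp.lsum ℕ (fun i => (deg 𝒜 ℳ i).subtype) f)).coeff n = f n := by
    intro n f
    induction f using DFinsupp.induction with
    | h0 => simp
    | ha i b f _ _ ih =>
      rw [map_add, map_add, AddMonoidAlgebra.coeff_add, Finsupp.add_apply, ih]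
      rw [DFinsupp.add_apply, Submodule.coe_add, DFinsupp.lsum_single, Submodule.subtype_apply,
        mem_deg.1 b.2, AddMonoidAlgebra.coeff_single, Finsupp.single_apply, DFinsupp.single_apply]
      congr 1
      split_ifs with h
      · subst h; rfl
      · rfl
  ext n
  rw [← key n f, hf]
  simp

instance gradedAlgebra : GradedAlgebra (deg 𝒜 ℳ) :=
  { gradedMonoid, deg_isInternal.chooseDecomposition with }

theorem gradedComm : IsGradedComm (deg 𝒜 ℳ) := by
  have h1 : ∀ (i : ℤ) (g : A × M), g ∈ prodGrading 𝒜 ℳ i → ∀ y : GradedSym 𝒜 ℳ,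
      gen 𝒜 ℳ g * y = signTwist (deg 𝒜 ℳ) i y * gen 𝒜 ℳ g := by
    intro i g hg y
    induction y using homogeneous_induction with
    | hgen j x hx =>
      rw [signTwist_of_mem _ i (gen_mem hx), gen_comm 𝒜 ℳ hg hx, smul_mul_assoc]
    | hadd x y hx hy => rw [mul_add, hx, hy, map_add, add_mul]
    | hmul x y hx hy => rw [← mul_assoc, hx, mul_assoc, hy, signTwist_mul, mul_assoc]
  intro i j x y hx hy
  have h2 : ∀ x : GradedSym 𝒜 ℳ, x * y = y * signTwist (deg 𝒜 ℳ) j x := by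
    intro x
    induction x using homogeneous_induction with
    | hgen i x hx =>
      rw [h1 i x hx, signTwist_of_mem _ i hy, signTwist_of_mem _ j (gen_mem hx), mul_smul_comm,
        smul_mul_assoc, mul_comm i j]
    | hadd x x' hx hx' => rw [add_mul, hx, hx', map_add, mul_add]
    | hmul x x' hx hx' => rw [mul_assoc, hx', ← mul_assoc, hx, mul_assoc, signTwist_mul]
  rw [h2, signTwist_of_mem _ j hx, mul_smul_comm, mul_comm i j]

theorem mul_eq_signTwist_mul {i : ℤ} {x : GradedSym 𝒜 ℳ} (hx : x ∈ deg 𝒜 ℳ i) (y : GradedSym 𝒜 ℳ) :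
    x * y = signTwist (deg 𝒜 ℳ) i y * x := by
  induction y using DirectSum.Decomposition.inductionOn (deg 𝒜 ℳ) with
  | zero => simp
  | add y y' hy hy' => rw [mul_add, hy, hy', map_add, add_mul]
  | homogeneous y =>
    rw [signTwist_of_mem _ i y.2, gradedComm _ _ _ _ hx y.2, smul_mul_assoc]

/-- Induction over the homogeneous elements of `S_A M`. -/
theorem deg_induction {motive : ℤ → GradedSym 𝒜 ℳ → Prop}
    (hgen : ∀ i x, x ∈ prodGrading 𝒜 ℳ i → motive i (gen 𝒜 ℳ x))
    (hzero : ∀ n, motive n 0)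
    (hadd : ∀ n x y, motive n x → motive n y → motive n (x + y))
    (hmul : ∀ i j x y, x ∈ deg 𝒜 ℳ i → y ∈ deg 𝒜 ℳ j → motive i x → motive j y →
      motive (i + j) (x * y)) {n : ℤ} {x : GradedSym 𝒜 ℳ} (hx : x ∈ deg 𝒜 ℳ n) : motive n x := by
  let Q : ℤ → AddSubmonoid (GradedSym 𝒜 ℳ) := fun n =>
    { carrier := {x | x ∈ deg 𝒜 ℳ n ∧ motive n x}
      zero_mem' := ⟨zero_mem _, hzero n⟩
      add_mem' := fun {a b} ha hb => ⟨add_mem ha.1 hb.1, hadd n _ _ ha.2 hb.2⟩ }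
  have h1 : ∀ x, x ∈ ⨆ n, Q n := by
    intro x
    refine homogeneous_induction
      (fun i x hx => AddSubmonoid.mem_iSup_of_mem i (show gen 𝒜 ℳ x ∈ Q i from ?_))
      (fun x y hx hy => add_mem hx hy) (fun x y hx hy => ?_) x
    · exact ⟨gen_mem hx, hgen i x hx⟩
    · refine AddSubmonoid.iSup_induction _ (motive := fun x => x * y ∈ ⨆ n, Q n) hx
        (fun i x hx => ?_) (by simp) (fun a b ha hb => by rw [add_mul]; exact add_mem ha hb)
      refine AddSubmonoid.iSup_induction _ (motive := fun y => x * y ∈ ⨆ n, Q n) hy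
        (fun j y hy => ?_) (by simp) (fun a b ha hb => by rw [mul_add]; exact add_mem ha hb)
      exact AddSubmonoid.mem_iSup_of_mem (i + j)
        ⟨SetLike.GradedMul.mul_mem hx.1 hy.1, hmul i j _ _ hx.1 hy.1 hx.2 hy.2⟩
  have h2 : ∀ x : GradedSym 𝒜 ℳ, ∀ n, (DirectSum.decompose (deg 𝒜 ℳ) x n : GradedSym 𝒜 ℳ) ∈ Q n := by
    intro x n
    refine AddSubmonoid.iSup_induction _
      (motive := fun x => (DirectSum.decompose (deg 𝒜 ℳ) x n : GradedSym 𝒜 ℳ) ∈ Q n) (h1 x)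
      (fun i x hx => ?_) ?_ (fun a b ha hb => ?_)
    · by_cases h : i = n
      · subst h
        rw [DirectSum.decompose_of_mem_same _ hx.1]
        exact hx
      · rw [DirectSum.decompose_of_mem_ne _ hx.1 h]
        exact zero_mem _
    · rw [DirectSum.decompose_zero]
      exact zero_mem _
    · rw [DirectSum.decompose_add]
      exact add_mem ha hb
  have h3 := h2 x n
  rw [DirectSum.decompose_of_mem_same _ hx] at h3
  exact h3.2

/-! Derivations of `S_A M`. -/

/-- `T` is a graded derivation of degree `e` (as far as the Leibniz rule is concerned):
`T(xy) = T(x) y + (-1)^{e|x|} x T(y)`. -/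
def IsDerivation (e : ℤ) (T : GradedSym 𝒜 ℳ →ₗ[𝕜] GradedSym 𝒜 ℳ) : Prop :=
  ∀ x y, T (x * y) = T x * y + signTwist (deg 𝒜 ℳ) e x * T y

theorem IsDerivation.ext {e : ℤ} {T T' : GradedSym 𝒜 ℳ →ₗ[𝕜] GradedSym 𝒜 ℳ} (hT : IsDerivation e T)
    (hT' : IsDerivation e T')
    (h : ∀ i x, x ∈ prodGrading 𝒜 ℳ i → T (gen 𝒜 ℳ x) = T' (gen 𝒜 ℳ x)) : T = T' := by
  ext x
  induction x using homogeneous_induction with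
  | hgen i x hx => exact h i x hx
  | hadd x y hx hy => rw [map_add, map_add, hx, hy]
  | hmul x y hx hy => rw [hT, hT', hx, hy]

theorem IsDerivation.add {e : ℤ} {T T' : GradedSym 𝒜 ℳ →ₗ[𝕜] GradedSym 𝒜 ℳ} (hT : IsDerivation e T)
    (hT' : IsDerivation e T') : IsDerivation e (T + T') := by
  intro x y
  simp only [LinearMap.add_apply, hT x y, hT' x y, add_mul, mul_add]
  abel

theorem IsDerivation.smul {e : ℤ} {T : GradedSym 𝒜 ℳ →ₗ[𝕜] GradedSym 𝒜 ℳ} (hT : IsDerivation e T)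
    (c : 𝕜) : IsDerivation e (c • T) := by
  intro x y
  simp only [LinearMap.smul_apply, hT x y, smul_add, smul_mul_assoc, mul_smul_comm]

theorem IsDerivation.sign_smul {e : ℤ} {T : GradedSym 𝒜 ℳ →ₗ[𝕜] GradedSym 𝒜 ℳ} (hT : IsDerivation e T)
    (u : ℤˣ) : IsDerivation e (u • T) := by
  intro x y
  simp only [LinearMap.smul_apply, hT x y, smul_add, smul_mul_assoc, mul_smul_comm]

theorem IsDerivation.mulLeft {i e : ℤ} {T : GradedSym 𝒜 ℳ →ₗ[𝕜] GradedSym 𝒜 ℳ} (hT : IsDerivation e T)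
    {z : GradedSym 𝒜 ℳ} (hz : z ∈ deg 𝒜 ℳ i) :
    IsDerivation (i + e) (LinearMap.mulLeft 𝕜 z ∘ₗ T) := by
  intro x y
  simp only [LinearMap.comp_apply, LinearMap.mulLeft_apply, hT x y, mul_add]
  rw [← mul_assoc, ← mul_assoc z (signTwist _ _ _), mul_eq_signTwist_mul hz (signTwist _ _ _),
    signTwist_signTwist, mul_assoc (signTwist _ _ _)]

/-- Prescribed values `D` on the generators that extend to a graded derivation of `S_A M` of degree
`e`. -/
structure DerivationData (e : ℤ) (D : A × M →ₗ[𝕜] GradedSym 𝒜 ℳ) : Prop where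
  mem : ∀ i x, x ∈ prodGrading 𝒜 ℳ i → D x ∈ deg 𝒜 ℳ (i + e)
  mul : ∀ i j a b, a ∈ 𝒜 i → b ∈ 𝒜 j → D (a * b, 0) =
    D (a, 0) * gen 𝒜 ℳ (b, 0) + (e * i).negOnePow • (gen 𝒜 ℳ (a, 0) * D (b, 0))
  smul : ∀ i j a m, a ∈ 𝒜 i → m ∈ ℳ j → D (0, a • m) =
    D (a, 0) * gen 𝒜 ℳ (0, m) + (e * i).negOnePow • (gen 𝒜 ℳ (a, 0) * D (0, m))

/-- The matrices `(± x, D x; 0, x)` used to extend derivations. -/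
def matGen (e : ℤ) (D : A × M →ₗ[𝕜] GradedSym 𝒜 ℳ) :
    A × M →ₗ[𝕜] Matrix (Fin 2) (Fin 2) (GradedSym 𝒜 ℳ) where
  toFun x := !![signTwist (deg 𝒜 ℳ) e (gen 𝒜 ℳ x), D x; 0, gen 𝒜 ℳ x]
  map_add' x y := by
    ext s t; fin_cases s <;> fin_cases t <;> simp
  map_smul' c x := by
    ext s t; fin_cases s <;> fin_cases t <;> simp

theorem matGen_compatible {e : ℤ} {D : A × M →ₗ[𝕜] GradedSym 𝒜 ℳ} (hD : DerivationData e D) :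
    Compatible 𝒜 ℳ (matGen e D) := by
  have h1 : D (1, 0) = 0 := by
    have := hD.mul 0 0 1 1 SetLike.GradedOne.one_mem SetLike.GradedOne.one_mem
    rw [one_mul, gen_one, mul_one, one_mul, mul_zero, Int.negOnePow_zero, one_smul] at this
    exact left_eq_add.1 this
  apply Compatible.of_homogeneous
  · simp only [matGen, LinearMap.coe_mk, AddHom.coe_mk, h1, gen_one, signTwist_one]
    exact Matrix.one_fin_two.symm
  · intro i j a b ha hb
    simp only [matGen, LinearMap.coe_mk, AddHom.coe_mk, Matrix.mul_fin_two, mul_zero, zero_mul,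
      add_zero, zero_add, ← signTwist_mul, gen_mul_gen]
    rw [hD.mul i j a b ha hb, signTwist_of_mem _ e (gen_mem (ℳ := ℳ) (inl_mem ha)), smul_mul_assoc, add_comm]
  · intro i j a m ha hm
    simp only [matGen, LinearMap.coe_mk, AddHom.coe_mk, Matrix.mul_fin_two, mul_zero, zero_mul,
      add_zero, zero_add, ← signTwist_mul, gen_mul_gen_smul]
    rw [hD.smul i j a m ha hm, signTwist_of_mem _ e (gen_mem (ℳ := ℳ) (inl_mem ha)), smul_mul_assoc, add_comm]
  · intro i j x y hx hy
    simp only [matGen, LinearMap.coe_mk, AddHom.coe_mk, Matrix.mul_fin_two, mul_zero, zero_mul,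
      add_zero, zero_add, ← signTwist_mul]
    rw [gen_comm 𝒜 ℳ hx hy, map_sign_smul]
    have key : signTwist (deg 𝒜 ℳ) e (gen 𝒜 ℳ x) * D y + D x * gen 𝒜 ℳ y =
        (i * j).negOnePow •
          (signTwist (deg 𝒜 ℳ) e (gen 𝒜 ℳ y) * D x + D y * gen 𝒜 ℳ x) := by
      rw [signTwist_of_mem _ e (gen_mem hx), signTwist_of_mem _ e (gen_mem hy), smul_mul_assoc,
        smul_mul_assoc, gradedComm _ _ _ _ (gen_mem hx) (hD.mem j y hy),
        gradedComm _ _ _ _ (hD.mem i x hx) (gen_mem hy), smul_add, smul_smul, smul_smul,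
        ← Int.negOnePow_add, ← Int.negOnePow_add, add_comm]
      congr 2
      · congr 1; ring
      · rw [show e * i + i * (j + e) = i * j + 2 * (e * i) by ring, Int.negOnePow_add,
          Int.negOnePow_two_mul, mul_one]
    rw [key]
    ext s t; fin_cases s <;> fin_cases t <;> simp

/-- The graded derivation of `S_A M` of degree `e` with prescribed values on the generators. -/
def derivExt (e : ℤ) (D : A × M →ₗ[𝕜] GradedSym 𝒜 ℳ) (hD : DerivationData e D) :
    GradedSym 𝒜 ℳ →ₗ[𝕜] GradedSym 𝒜 ℳ :=
  Matrix.entryLinearMap 𝕜 (GradedSym 𝒜 ℳ) (0 : Fin 2) (1 : Fin 2) ∘ₗ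
    (lift (matGen e D) (matGen_compatible hD)).toLinearMap

@[simp]
theorem derivExt_gen (e : ℤ) (D : A × M →ₗ[𝕜] GradedSym 𝒜 ℳ) (hD : DerivationData e D) (x : A × M) :
    derivExt e D hD (gen 𝒜 ℳ x) = D x := by
  simp [derivExt, matGen]

theorem lift_matGen (e : ℤ) (D : A × M →ₗ[𝕜] GradedSym 𝒜 ℳ) (hD : DerivationData e D)
    (x : GradedSym 𝒜 ℳ) : lift (matGen e D) (matGen_compatible hD) x =
      !![signTwist (deg 𝒜 ℳ) e x, derivExt e D hD x; 0, x] := by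
  induction x using homogeneous_induction with
  | hgen i x hx => rw [lift_gen, derivExt_gen]; rfl
  | hadd x y hx hy =>
    rw [map_add, hx, hy]
    ext s t; fin_cases s <;> fin_cases t <;> simp
  | hmul x y hx hy =>
    have h1 : derivExt e D hD (x * y) =
        derivExt e D hD x * y + signTwist (deg 𝒜 ℳ) e x * derivExt e D hD y := by
      conv_lhs => rw [derivExt, LinearMap.comp_apply, AlgHom.toLinearMap_apply, map_mul, hx, hy,
        Matrix.mul_fin_two]
      simp [add_comm]
    rw [map_mul, hx, hy, Matrix.mul_fin_two, h1, signTwist_mul]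
    ext s t; fin_cases s <;> fin_cases t <;> simp [add_comm]

theorem derivExt_isDerivation (e : ℤ) (D : A × M →ₗ[𝕜] GradedSym 𝒜 ℳ) (hD : DerivationData e D) :
    IsDerivation e (derivExt e D hD) := by
  intro x y
  conv_lhs => rw [derivExt, LinearMap.comp_apply, AlgHom.toLinearMap_apply, map_mul,
    lift_matGen e D hD, lift_matGen e D hD, Matrix.mul_fin_two]
  simp [add_comm]

theorem derivExt_mem (e : ℤ) (D : A × M →ₗ[𝕜] GradedSym 𝒜 ℳ) (hD : DerivationData e D) {n : ℤ}
    {x : GradedSym 𝒜 ℳ} (hx : x ∈ deg 𝒜 ℳ n) : derivExt e D hD x ∈ deg 𝒜 ℳ (n + e) := by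
  refine deg_induction (motive := fun n x => derivExt e D hD x ∈ deg 𝒜 ℳ (n + e))
    (fun i x hx => ?_) (fun n => ?_) (fun n x y hx hy => ?_) (fun i j x y hx hy h1 h2 => ?_) hx
  · rw [derivExt_gen]; exact hD.mem i x hx
  · rw [map_zero]; exact zero_mem _
  · rw [map_add]; exact add_mem hx hy
  · rw [derivExt_isDerivation e D hD]
    refine add_mem ?_ ?_
    · rw [add_right_comm]; exact SetLike.GradedMul.mul_mem h1 hy
    · rw [add_assoc]; exact SetLike.GradedMul.mul_mem (signTwist_mem _ _ hx) h2

end GradedSym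

end Sym

/-! ### The DG Poisson algebra `S_A M` -/

section SymPoisson

open GradedSym

variable {𝕜 A M : Type*} [Field 𝕜] [Ring A] [Algebra 𝕜 A]
  [AddCommGroup M] [Module 𝕜 M] [Module A M] [IsScalarTower 𝕜 A M]
  {𝒜 : ℤ → Submodule 𝕜 A} [GradedAlgebra 𝒜] {D : DGCommStructure 𝒜}
  {ℳ : ℤ → Submodule 𝕜 M} [DirectSum.Decomposition ℳ] [SetLike.GradedSMul 𝒜 ℳ]

theorem DGModuleStructure.derivationData (X : DGModuleStructure D ℳ) :
    DerivationData 1 (gen 𝒜 ℳ ∘ₗ D.d.prodMap X.d) where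
  mem i x hx := gen_mem ⟨D.isDifferential.mem hx.1, X.isDifferential.mem hx.2⟩
  mul i j a b ha hb := by
    simp only [LinearMap.comp_apply, LinearMap.prodMap_apply, map_zero, gen_mul_gen,
      D.leibniz i a b ha, one_mul, ← map_sign_smul (gen 𝒜 ℳ), ← map_add]
    congr 1
    simp [Prod.smul_mk]
  smul i j a m ha hm := by
    simp only [LinearMap.comp_apply, LinearMap.prodMap_apply, map_zero, gen_mul_gen_smul,
      X.leibniz i a m ha, one_mul, ← map_sign_smul (gen 𝒜 ℳ), ← map_add]
    congr 1
    simp [Prod.smul_mk]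

/-- The differential of `S_A M`: the derivation extending the differentials of `A` and `M`. -/
def DGModuleStructure.symDiff (X : DGModuleStructure D ℳ) : GradedSym 𝒜 ℳ →ₗ[𝕜] GradedSym 𝒜 ℳ :=
  derivExt 1 (gen 𝒜 ℳ ∘ₗ D.d.prodMap X.d) X.derivationData

namespace DGLieRinehartStructure

variable (X : DGLieRinehartStructure D ℳ)

theorem bracket_smul {i j l : ℤ} {q r : M} {a : A} (hq : q ∈ ℳ i) (ha : a ∈ 𝒜 j) (hr : r ∈ ℳ l) :
    X.bracket q (a • r) = X.act q a • r + (i * j).negOnePow • (a • X.bracket q r) := by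
  have har : a • r ∈ ℳ (j + l) := SetLike.GradedSMul.smul_mem ha hr
  rw [X.skew i (j + l) q (a • r) hq har, X.smul_bracket j l i a r q ha hr hq,
    X.skew l i r q hr hq]
  rcases Int.units_eq_one_or (i * j).negOnePow with h1 | h1 <;>
  rcases Int.units_eq_one_or (l * i).negOnePow with h2 | h2 <;>
  simp only [mul_add, Int.negOnePow_add, mul_comm i l, h1, h2, one_smul, smul_neg, mul_one,
    one_mul, Units.neg_smul, neg_neg, neg_sub, sub_eq_add_neg, neg_add_rev, mul_neg, neg_mul] <;>
  abel

theorem flipAct_act {i j l : ℤ} {a b : A} {m : M} (ha : a ∈ 𝒜 i) (hb : b ∈ 𝒜 j) (hm : m ∈ ℳ l) :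
    X.flipAct a (b • m) = (i * j).negOnePow • (b * X.flipAct a m) := by
  rw [X.flipAct_apply ha (SetLike.GradedSMul.smul_mem hb hm), X.flipAct_apply ha hm, X.smul_act,
    mul_smul_comm, smul_smul, vadd_eq_add, mul_add, Int.negOnePow_add]

theorem adData {i : ℤ} {x : A × M} (hx : x ∈ prodGrading 𝒜 ℳ i) :
    DerivationData i (gen 𝒜 ℳ ∘ₗ X.semidirect x) where
  mem j y hy := by rw [add_comm]; exact gen_mem (X.semidirect_mem hx hy)
  mul j l a b ha hb := by
    simp only [LinearMap.comp_apply, semidirect_apply, map_zero, sub_zero, gen_mul_gen,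
      ← map_sign_smul (gen 𝒜 ℳ), ← map_add]
    congr 1
    ext
    · simp only [X.act_mul i j _ _ _ hx.2 ha, mul_comm j i, Prod.fst_add, Prod.smul_fst]
    · simp
  smul j l a m ha hm := by
    simp only [LinearMap.comp_apply, semidirect_apply, map_zero, sub_zero, zero_sub]
    rw [show ((-X.flipAct x.1 m, X.bracket x.2 m) : A × M) =
      (-X.flipAct x.1 m, 0) + (0, X.bracket x.2 m) by simp, map_add, mul_add, gen_mul_gen,
      gen_mul_gen_smul, gen_mul_gen_smul, ← map_add, ← map_sign_smul (gen 𝒜 ℳ), ← map_add]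
    congr 1
    ext
    · simp only [X.flipAct_act hx.1 ha hm, mul_neg, Prod.fst_add, Prod.smul_fst, add_zero, zero_add,
        smul_neg]
    · simp only [X.bracket_smul hx.2 ha hm, Prod.snd_add, Prod.smul_snd, zero_add]

/-- For a homogeneous generator `x`, the derivation `{x, ·}` of `S_A M`. -/
def adDeg (i : ℤ) : prodGrading 𝒜 ℳ i →ₗ[𝕜] GradedSym 𝒜 ℳ →ₗ[𝕜] GradedSym 𝒜 ℳ where
  toFun x := derivExt i (gen 𝒜 ℳ ∘ₗ X.semidirect x.1) (X.adData x.2)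
  map_add' x y := by
    refine IsDerivation.ext (derivExt_isDerivation _ _ _)
      ((derivExt_isDerivation _ _ _).add (derivExt_isDerivation _ _ _)) (fun j z _ => ?_)
    simp
  map_smul' c x := by
    refine IsDerivation.ext (derivExt_isDerivation _ _ _)
      ((derivExt_isDerivation _ _ _).smul c) (fun j z _ => ?_)
    simp

/-- For a generator `x`, the endomorphism `{x, ·}` of `S_A M`. -/
def ad : A × M →ₗ[𝕜] GradedSym 𝒜 ℳ →ₗ[𝕜] GradedSym 𝒜 ℳ :=
  DirectSum.toModule 𝕜 ℤ _ (fun i => X.adDeg i) ∘ₗ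
    (DirectSum.decomposeLinearEquiv (prodGrading 𝒜 ℳ)).toLinearMap

theorem ad_of_mem {i : ℤ} {x : A × M} (hx : x ∈ prodGrading 𝒜 ℳ i) :
    X.ad x = derivExt i (gen 𝒜 ℳ ∘ₗ X.semidirect x) (X.adData hx) := by
  simp only [ad, LinearMap.comp_apply, LinearEquiv.coe_coe,
    DirectSum.decomposeLinearEquiv_apply, DirectSum.decompose_of_mem _ hx]
  rw [← DirectSum.lof_eq_of 𝕜, DirectSum.toModule_lof]
  rfl

theorem ad_isDerivation {i : ℤ} {x : A × M} (hx : x ∈ prodGrading 𝒜 ℳ i) :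
    IsDerivation i (X.ad x) := by
  rw [X.ad_of_mem hx]; exact derivExt_isDerivation _ _ _

theorem ad_gen (x y : A × M) : X.ad x (gen 𝒜 ℳ y) = gen 𝒜 ℳ (X.semidirect x y) := by
  induction x using DirectSum.Decomposition.inductionOn (prodGrading 𝒜 ℳ) with
  | zero => simp
  | add x x' hx hx' => simp only [map_add, LinearMap.add_apply, hx, hx']
  | homogeneous x => rw [X.ad_of_mem x.2, derivExt_gen]; rfl

theorem ad_mul {i j : ℤ} {a b : A} (ha : a ∈ 𝒜 i) (hb : b ∈ 𝒜 j) :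
    X.ad (a * b, 0) = LinearMap.mulLeft 𝕜 (gen 𝒜 ℳ (a, 0)) ∘ₗ X.ad (b, 0) +
      (i * j).negOnePow • (LinearMap.mulLeft 𝕜 (gen 𝒜 ℳ (b, 0)) ∘ₗ X.ad (a, 0)) := by
  have hab : ((a * b, 0) : A × M) ∈ prodGrading 𝒜 ℳ (i + j) :=
    inl_mem (SetLike.GradedMul.mul_mem ha hb)
  refine IsDerivation.ext (X.ad_isDerivation hab)
    (((X.ad_isDerivation (inl_mem hb)).mulLeft (gen_mem (inl_mem ha))).add
      (IsDerivation.sign_smul (by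
        rw [add_comm i j]
        exact (X.ad_isDerivation (inl_mem ha)).mulLeft (gen_mem (inl_mem hb))) _)) ?_
  intro t y hy
  simp only [LinearMap.add_apply, LinearMap.smul_apply, LinearMap.comp_apply,
    LinearMap.mulLeft_apply, ad_gen, semidirect_apply, map_zero, LinearMap.zero_apply, zero_sub,
    gen_mul_gen]
  rw [← map_sign_smul (gen 𝒜 ℳ), ← map_add]
  congr 1
  ext
  · have h1 : b * X.act y.2 a = (j * (t + i)).negOnePow • (X.act y.2 a * b) :=
      D.gradedComm _ _ _ _ hb (X.act_mem _ _ _ _ hy.2 ha)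
    simp only [Prod.fst_add, Prod.smul_fst, mul_neg,
      X.flipAct_apply (SetLike.GradedMul.mul_mem ha hb) hy.2, X.flipAct_apply ha hy.2,
      X.flipAct_apply hb hy.2, X.act_mul t i _ _ _ hy.2 ha, mul_smul_comm, h1]
    rcases Int.units_eq_one_or (i * j).negOnePow with h1 | h1 <;>
    rcases Int.units_eq_one_or (i * t).negOnePow with h2 | h2 <;>
    rcases Int.units_eq_one_or (j * t).negOnePow with h3 | h3 <;>
    simp only [mul_add, add_mul, Int.negOnePow_add, mul_comm j i, h1, h2, h3, one_smul, smul_neg,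
      mul_one, one_mul, Units.neg_smul, neg_neg, smul_add, neg_add_rev, mul_neg] <;>
    abel
  · simp

theorem ad_smul {i j : ℤ} {a : A} {m : M} (ha : a ∈ 𝒜 i) (hm : m ∈ ℳ j) :
    X.ad (0, a • m) = LinearMap.mulLeft 𝕜 (gen 𝒜 ℳ (a, 0)) ∘ₗ X.ad (0, m) +
      (i * j).negOnePow • (LinearMap.mulLeft 𝕜 (gen 𝒜 ℳ (0, m)) ∘ₗ X.ad (a, 0)) := by
  have ham : ((0, a • m) : A × M) ∈ prodGrading 𝒜 ℳ (i + j) :=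
    inr_mem (SetLike.GradedSMul.smul_mem ha hm)
  refine IsDerivation.ext (X.ad_isDerivation ham)
    (((X.ad_isDerivation (inr_mem hm)).mulLeft (gen_mem (inl_mem ha))).add
      (IsDerivation.sign_smul (by
        rw [add_comm i j]
        exact (X.ad_isDerivation (inl_mem ha)).mulLeft (gen_mem (inr_mem hm))) _)) ?_
  intro t y hy
  simp only [LinearMap.add_apply, LinearMap.smul_apply, LinearMap.comp_apply,
    LinearMap.mulLeft_apply, ad_gen, semidirect_apply, map_zero, LinearMap.zero_apply, zero_sub,
    sub_zero]
  have hact : X.flipAct a y.2 ∈ 𝒜 (i + t) := by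
    rw [X.flipAct_apply ha hy.2, add_comm]
    exact sign_smul_mem _ _ (X.act_mem _ _ _ _ hy.2 ha)
  rw [gen_comm 𝒜 ℳ (inr_mem hm) (inl_mem (neg_mem hact)), gen_mul_gen_smul,
    show ((X.act m y.1, X.bracket m y.2) : A × M) = (X.act m y.1, 0) + (0, X.bracket m y.2) by simp,
    map_add, mul_add, gen_mul_gen, gen_mul_gen_smul, ← map_sign_smul (gen 𝒜 ℳ),
    ← map_sign_smul (gen 𝒜 ℳ), ← map_add, ← map_add]
  congr 1
  ext
  · simp [X.smul_act]
  · simp only [Prod.snd_add, Prod.smul_snd, X.flipAct_apply ha hy.2,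
      X.smul_bracket i j t a m y.2 ha hm hy.2, zero_add, neg_smul, smul_assoc]
    rcases Int.units_eq_one_or (i * j).negOnePow with h1 | h1 <;>
    rcases Int.units_eq_one_or (i * t).negOnePow with h2 | h2 <;>
    rcases Int.units_eq_one_or (j * t).negOnePow with h3 | h3 <;>
    simp only [mul_add, Int.negOnePow_add, mul_comm j i, mul_comm t i, mul_comm t j, h1, h2, h3,
      one_smul, smul_neg, mul_one, one_mul, Units.neg_smul, neg_neg, mul_neg, neg_smul] <;>
    abel

theorem poissonData {n : ℤ} {y : GradedSym 𝒜 ℳ} (hy : y ∈ deg 𝒜 ℳ n) :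
    DerivationData n (-((X.ad.flip y) ∘ₗ signTwist (prodGrading 𝒜 ℳ) n)) where
  mem i x hx := by
    rw [LinearMap.neg_apply, LinearMap.comp_apply, signTwist_of_mem _ n hx, map_sign_smul,
      LinearMap.flip_apply, X.ad_of_mem hx, add_comm i n]
    exact neg_mem (sign_smul_mem _ _ (derivExt_mem _ _ _ hy))
  mul i j a b ha hb := by
    have hab : ((a * b, 0) : A × M) ∈ prodGrading 𝒜 ℳ (i + j) :=
      inl_mem (SetLike.GradedMul.mul_mem ha hb)
    have h1 : gen 𝒜 ℳ (b, 0) * X.ad (a, 0) y =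
        (j * (n + i)).negOnePow • (X.ad (a, 0) y * gen 𝒜 ℳ (b, 0)) := by
      refine gradedComm _ _ _ _ (gen_mem (inl_mem hb)) ?_
      rw [X.ad_of_mem (inl_mem ha)]
      exact derivExt_mem _ _ _ hy
    simp only [LinearMap.neg_apply, LinearMap.comp_apply, LinearMap.flip_apply,
      signTwist_of_mem _ n hab, signTwist_of_mem _ n (inl_mem (ℳ := ℳ) ha),
      signTwist_of_mem _ n (inl_mem (ℳ := ℳ) hb), map_sign_smul, X.ad_mul ha hb,
      LinearMap.add_apply, LinearMap.smul_apply, LinearMap.mulLeft_apply, h1, neg_mul, mul_neg,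
      smul_mul_assoc, mul_smul_comm]
    rcases Int.units_eq_one_or (i * j).negOnePow with h1 | h1 <;>
    rcases Int.units_eq_one_or (n * i).negOnePow with h2 | h2 <;>
    rcases Int.units_eq_one_or (n * j).negOnePow with h3 | h3 <;>
    simp only [mul_add, Int.negOnePow_add, mul_comm j i, mul_comm j n, h1, h2, h3,
      one_smul, smul_neg, mul_one, one_mul, Units.neg_smul, neg_neg, mul_neg, smul_add,
      neg_add_rev] <;>
    abel
  smul i j a m ha hm := by
    have ham : ((0, a • m) : A × M) ∈ prodGrading 𝒜 ℳ (i + j) :=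
      inr_mem (SetLike.GradedSMul.smul_mem ha hm)
    have h1 : gen 𝒜 ℳ (0, m) * X.ad (a, 0) y =
        (j * (n + i)).negOnePow • (X.ad (a, 0) y * gen 𝒜 ℳ (0, m)) := by
      refine gradedComm _ _ _ _ (gen_mem (inr_mem hm)) ?_
      rw [X.ad_of_mem (inl_mem ha)]
      exact derivExt_mem _ _ _ hy
    simp only [LinearMap.neg_apply, LinearMap.comp_apply, LinearMap.flip_apply,
      signTwist_of_mem _ n ham, signTwist_of_mem _ n (inl_mem (ℳ := ℳ) ha),
      signTwist_of_mem _ n (inr_mem (𝒜 := 𝒜) hm), map_sign_smul, X.ad_smul ha hm,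
      LinearMap.add_apply, LinearMap.smul_apply, LinearMap.mulLeft_apply, h1, neg_mul, mul_neg,
      smul_mul_assoc, mul_smul_comm]
    rcases Int.units_eq_one_or (i * j).negOnePow with h1 | h1 <;>
    rcases Int.units_eq_one_or (n * i).negOnePow with h2 | h2 <;>
    rcases Int.units_eq_one_or (n * j).negOnePow with h3 | h3 <;>
    simp only [mul_add, Int.negOnePow_add, mul_comm j i, mul_comm j n, h1, h2, h3,
      one_smul, smul_neg, mul_one, one_mul, Units.neg_smul, neg_neg, mul_neg, smul_add,
      neg_add_rev] <;>
    abel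

/-- For homogeneous `y` of degree `n`, the derivation `{y, ·}` of degree `n` of `S_A M`; it is
determined by `{y, x} = -(-1)^{n|x|} {x, y}` for generators `x`. -/
def poissonDeg (n : ℤ) : deg 𝒜 ℳ n →ₗ[𝕜] GradedSym 𝒜 ℳ →ₗ[𝕜] GradedSym 𝒜 ℳ where
  toFun y := derivExt n (-((X.ad.flip y.1) ∘ₗ signTwist (prodGrading 𝒜 ℳ) n)) (X.poissonData y.2)
  map_add' x y := by
    refine IsDerivation.ext (derivExt_isDerivation _ _ _)
      ((derivExt_isDerivation _ _ _).add (derivExt_isDerivation _ _ _)) (fun j z _ => ?_)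
    simp [add_comm]
  map_smul' c x := by
    refine IsDerivation.ext (derivExt_isDerivation _ _ _)
      ((derivExt_isDerivation _ _ _).smul c) (fun j z _ => ?_)
    simp

/-- The Poisson bracket `{·,·}` of `S_A M`: the biderivation extending the Lie bracket of `M` and the
action of `M` on `A`. -/
def poisson : GradedSym 𝒜 ℳ →ₗ[𝕜] GradedSym 𝒜 ℳ →ₗ[𝕜] GradedSym 𝒜 ℳ :=
  DirectSum.toModule 𝕜 ℤ _ (fun n => X.poissonDeg n) ∘ₗ
    (DirectSum.decomposeLinearEquiv (deg 𝒜 ℳ)).toLinearMap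

theorem poisson_of_mem {n : ℤ} {y : GradedSym 𝒜 ℳ} (hy : y ∈ deg 𝒜 ℳ n) :
    X.poisson y = derivExt n (-((X.ad.flip y) ∘ₗ signTwist (prodGrading 𝒜 ℳ) n))
      (X.poissonData hy) := by
  simp only [poisson, LinearMap.comp_apply, LinearEquiv.coe_coe,
    DirectSum.decomposeLinearEquiv_apply, DirectSum.decompose_of_mem _ hy]
  rw [← DirectSum.lof_eq_of 𝕜, DirectSum.toModule_lof]
  rfl

/-- `{y, x x'} = {y, x} x' + (-1)^{|y||x|} x {y, x'}`. -/
theorem poisson_mul {n i : ℤ} {y x : GradedSym 𝒜 ℳ} (hy : y ∈ deg 𝒜 ℳ n) (hx : x ∈ deg 𝒜 ℳ i)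
    (x' : GradedSym 𝒜 ℳ) : X.poisson y (x * x') =
      X.poisson y x * x' + (n * i).negOnePow • (x * X.poisson y x') := by
  rw [X.poisson_of_mem hy, derivExt_isDerivation, signTwist_of_mem _ n hx, smul_mul_assoc]

theorem semidirect_skew {i j : ℤ} {x y : A × M} (hx : x ∈ prodGrading 𝒜 ℳ i)
    (hy : y ∈ prodGrading 𝒜 ℳ j) :
    X.semidirect x y = -((i * j).negOnePow • X.semidirect y x) := by
  rw [semidirect_apply, semidirect_apply, X.flipAct_apply hx.1 hy.2, X.flipAct_apply hy.1 hx.2,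
    X.skew i j _ _ hx.2 hy.2]
  ext
  · simp only [Prod.fst_neg, Prod.smul_fst, smul_sub, smul_smul, mul_comm j i, Int.units_mul_self,
      one_smul, neg_sub]
  · simp

/-- On generators, the Poisson bracket is given by the bracket of `M` and the action on `A`. -/
theorem poisson_gen_gen (x y : A × M) :
    X.poisson (gen 𝒜 ℳ x) (gen 𝒜 ℳ y) = gen 𝒜 ℳ (X.semidirect x y) := by
  refine bilinear_ext (prodGrading 𝒜 ℳ) (prodGrading 𝒜 ℳ)
    (fun x y => X.poisson (gen 𝒜 ℳ x) (gen 𝒜 ℳ y)) (fun x y => gen 𝒜 ℳ (X.semidirect x y))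
    ?_ ?_ ?_ ?_ ?_ x y
  · intro x x' y; simp only [map_add, LinearMap.add_apply]
  · intro x y y'; simp only [map_add]
  · intro x x' y; simp only [map_add, LinearMap.add_apply]
  · intro x y y'; simp only [map_add]
  · intro i j x y hx hy
    simp only [X.poisson_of_mem (gen_mem hx), derivExt_gen, LinearMap.neg_apply,
      LinearMap.comp_apply, signTwist_of_mem _ i hy, map_sign_smul, LinearMap.flip_apply, LinearMap.smul_apply, ad_gen,
      X.semidirect_skew hx hy, map_neg]

end DGLieRinehartStructure

end SymPoisson

/-! ### Extension of contraction data to symmetric algebras -/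

section SymContraction

open GradedSym

variable {𝕜 A M N : Type*} [Field 𝕜] [Ring A] [Algebra 𝕜 A]
  [AddCommGroup M] [Module 𝕜 M] [Module A M] [IsScalarTower 𝕜 A M]
  [AddCommGroup N] [Module 𝕜 N] [Module A N] [IsScalarTower 𝕜 A N]
  {𝒜 : ℤ → Submodule 𝕜 A} [GradedAlgebra 𝒜]
  {ℳ : ℤ → Submodule 𝕜 M} [DirectSum.Decomposition ℳ] [SetLike.GradedSMul 𝒜 ℳ]
  {𝒩 : ℤ → Submodule 𝕜 N} [DirectSum.Decomposition 𝒩] [SetLike.GradedSMul 𝒜 𝒩]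

theorem GradedSym.map_compatible (f : M →ₗ[𝕜] N) (hs : ∀ (a : A) (m : M), f (a • m) = a • f m)
    (hd : ∀ (i : ℤ) (m : M), m ∈ ℳ i → f m ∈ 𝒩 i) :
    Compatible 𝒜 ℳ (gen 𝒜 𝒩 ∘ₗ LinearMap.id.prodMap f) where
  one := by simp [gen_one]
  mul a b := by simp [gen_mul_gen]
  smul a m := by simp [gen_mul_gen_smul, hs]
  comm i j x y hx hy := gen_comm 𝒜 𝒩 ⟨hx.1, hd i _ hx.2⟩ ⟨hy.1, hd j _ hy.2⟩

/-- The `A`-algebra morphism `S_A M → S_A N` extending a degree `0` `A`-linear map `M → N`. -/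
def GradedSym.map (f : M →ₗ[𝕜] N) (hs : ∀ (a : A) (m : M), f (a • m) = a • f m)
    (hd : ∀ (i : ℤ) (m : M), m ∈ ℳ i → f m ∈ 𝒩 i) : GradedSym 𝒜 ℳ →ₐ[𝕜] GradedSym 𝒜 𝒩 :=
  lift (gen 𝒜 𝒩 ∘ₗ LinearMap.id.prodMap f) (map_compatible f hs hd)

variable {D : DGCommStructure 𝒜} {X : DGModuleStructure D ℳ} {Y : DGModuleStructure D 𝒩}

namespace LinearContraction

variable (c : LinearContraction X Y)

/-- The algebra morphism `S_A M → S_A N` extending `p`. -/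
def symP : GradedSym 𝒜 ℳ →ₐ[𝕜] GradedSym 𝒜 𝒩 :=
  GradedSym.map c.p c.p_smul (fun _ _ h => c.isContraction.p_mem h)

/-- The algebra morphism `S_A N → S_A M` extending `j`. -/
def symJ : GradedSym 𝒜 𝒩 →ₐ[𝕜] GradedSym 𝒜 ℳ :=
  GradedSym.map c.j c.j_smul (fun _ _ h => c.isContraction.j_mem h)

theorem hData : DerivationData (-1) (gen 𝒜 ℳ ∘ₗ (0 : A →ₗ[𝕜] A).prodMap c.h) where
  mem i x hx := gen_mem ⟨zero_mem _, c.isContraction.h_mem hx.2⟩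
  mul i j a b ha hb := by
    simp [show (((0 : A), (0 : M)) : A × M) = 0 from rfl]
  smul i j a m ha hm := by
    simp only [LinearMap.comp_apply, LinearMap.prodMap_apply, LinearMap.zero_apply, map_zero,
      Prod.mk_zero_zero, zero_mul, zero_add, gen_mul_gen_smul, c.h_smul i a m ha,
      ← map_sign_smul (gen 𝒜 ℳ), neg_mul, one_mul, Int.negOnePow_neg]
    congr 1
    simp [Prod.smul_mk]

/-- The derivation `h'` of `S_A M` extending `h` (and vanishing on `A`). -/
def symH' : GradedSym 𝒜 ℳ →ₗ[𝕜] GradedSym 𝒜 ℳ :=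
  derivExt (-1) (gen 𝒜 ℳ ∘ₗ (0 : A →ₗ[𝕜] A).prodMap c.h) c.hData

/-- The map `A ⊕ M → (S_A M)[t]`, `a + m ↦ a + j p m + t (m - j p m)`. -/
def weightGen : A × M →ₗ[𝕜] Polynomial (GradedSym 𝒜 ℳ) where
  toFun x := Polynomial.C (gen 𝒜 ℳ (x.1, c.j (c.p x.2))) +
    Polynomial.C (gen 𝒜 ℳ (0, x.2 - c.j (c.p x.2))) * Polynomial.X
  map_add' x y := by
    have h1 : ((x + y).1, c.j (c.p (x + y).2)) =
      (x.1, c.j (c.p x.2)) + (y.1, c.j (c.p y.2)) := by simp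
    have h2 : (((0 : A), (x + y).2 - c.j (c.p (x + y).2)) : A × M) =
      (0, x.2 - c.j (c.p x.2)) + (0, y.2 - c.j (c.p y.2)) := by simp; abel
    rw [h1, h2, map_add, map_add, map_add, map_add, add_mul]
    abel
  map_smul' r x := by
    have h1 : ((r • x).1, c.j (c.p (r • x).2)) = r • (x.1, c.j (c.p x.2)) := by simp
    have h2 : (((0 : A), (r • x).2 - c.j (c.p (r • x).2)) : A × M) =
      r • (0, x.2 - c.j (c.p x.2)) := by simp [smul_sub]
    rw [h1, h2, map_smul (gen 𝒜 ℳ), map_smul (gen 𝒜 ℳ), ← Polynomial.smul_C, ← Polynomial.smul_C, smul_mul_assoc,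
      ← smul_add, RingHom.id_apply]

theorem weightGen_compatible : Compatible 𝒜 ℳ c.weightGen where
  one := by
    simp only [weightGen, LinearMap.coe_mk, AddHom.coe_mk, map_zero, sub_zero, gen_one, map_one]
    rw [show (((0 : A), (0 : M)) : A × M) = 0 from rfl, map_zero, map_zero, zero_mul, add_zero]
  mul a b := by
    simp only [weightGen, LinearMap.coe_mk, AddHom.coe_mk, map_zero, sub_zero]
    rw [show (((0 : A), (0 : M)) : A × M) = 0 from rfl, map_zero, map_zero, zero_mul, add_zero,
      add_zero, add_zero, ← map_mul, gen_mul_gen]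
  smul a m := by
    simp only [weightGen, LinearMap.coe_mk, AddHom.coe_mk, map_zero, sub_zero]
    rw [show (((0 : A), (0 : M)) : A × M) = 0 from rfl, map_zero, map_zero, zero_mul, add_zero,
      mul_add, ← mul_assoc, ← Polynomial.C_mul, ← Polynomial.C_mul, gen_mul_gen_smul, gen_mul_gen_smul, c.p_smul,
      c.j_smul, smul_sub]
  comm i j x y hx hy := by
    have hjp : ∀ (i : ℤ) (m : M), m ∈ ℳ i → c.j (c.p m) ∈ ℳ i := fun i m hm =>
      c.isContraction.j_mem (c.isContraction.p_mem hm)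
    have hx1 : (x.1, c.j (c.p x.2)) ∈ prodGrading 𝒜 ℳ i := ⟨hx.1, hjp i _ hx.2⟩
    have hy1 : (y.1, c.j (c.p y.2)) ∈ prodGrading 𝒜 ℳ j := ⟨hy.1, hjp j _ hy.2⟩
    have hx2 : (0, x.2 - c.j (c.p x.2)) ∈ prodGrading 𝒜 ℳ i :=
      ⟨zero_mem _, sub_mem hx.2 (hjp i _ hx.2)⟩
    have hy2 : (0, y.2 - c.j (c.p y.2)) ∈ prodGrading 𝒜 ℳ j :=
      ⟨zero_mem _, sub_mem hy.2 (hjp j _ hy.2)⟩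
    have key : ∀ a a' b b' : GradedSym 𝒜 ℳ,
        (Polynomial.C a + Polynomial.C a' * Polynomial.X) *
          (Polynomial.C b + Polynomial.C b' * Polynomial.X) =
        Polynomial.C (a * b) + Polynomial.C (a * b' + a' * b) * Polynomial.X +
          Polynomial.C (a' * b') * Polynomial.X ^ 2 := by
      intro a a' b b'
      have hX : ∀ u : GradedSym 𝒜 ℳ, Polynomial.X * Polynomial.C u =
        Polynomial.C u * Polynomial.X := fun u => Polynomial.X_mul_C u
      simp only [map_add, map_mul, mul_add, add_mul, pow_two]
      rw [mul_assoc _ Polynomial.X (Polynomial.C b), hX, mul_assoc _ Polynomial.X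
        (Polynomial.C b' * Polynomial.X), ← mul_assoc Polynomial.X, hX]
      simp only [mul_assoc]
      abel
    simp only [weightGen, LinearMap.coe_mk, AddHom.coe_mk]
    rw [key, key, gen_comm 𝒜 ℳ hx1 hy1, gen_comm 𝒜 ℳ hx1 hy2, gen_comm 𝒜 ℳ hx2 hy1,
      gen_comm 𝒜 ℳ hx2 hy2]
    rcases Int.units_eq_one_or (i * j).negOnePow with h | h <;> rw [h]
    · simp only [one_smul]
      rw [add_comm (gen 𝒜 ℳ (0, y.2 - c.j (c.p y.2)) * _)]
    · simp only [Units.neg_smul, one_smul, map_neg, map_add, neg_mul, neg_add, add_mul]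
      abel

/-- The algebra morphism `ω : S_A M → (S_A M)[t]` with `ω a = a`, `ω (j u) = j u` and `ω z = t z` for
`a ∈ A`, `u ∈ N` and `z ∈ ker p`. The coefficient of `t^i` in `ω Σ` is the component of `Σ` in
`S_A N ⊗_A S_A^i (ker p) ⊆ S_A N ⊗_A S_A (ker p) ≅ S_A M`. -/
def weightMap : GradedSym 𝒜 ℳ →ₐ[𝕜] Polynomial (GradedSym 𝒜 ℳ) :=
  lift c.weightGen c.weightGen_compatible

/-- The homotopy of `S_A M`: it is `h' / i` on `S_A N ⊗_A S_A^i (ker p)` for `i > 0` and `0` on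
`S_A N`. (For `i = 0` the coefficient is `0⁻¹ = 0`.) -/
def symH : GradedSym 𝒜 ℳ →ₗ[𝕜] GradedSym 𝒜 ℳ :=
  Polynomial.lsum (fun i => ((i : 𝕜)⁻¹) • c.symH') ∘ₗ c.weightMap.toLinearMap

theorem weightMap_symJ (u : GradedSym 𝒜 𝒩) : c.weightMap (c.symJ u) = Polynomial.C (c.symJ u) := by
  induction u using homogeneous_induction with
  | hgen i x hx =>
    have h1 : c.symJ (gen 𝒜 𝒩 x) = gen 𝒜 ℳ (x.1, c.j x.2) := by
      simp [symJ, GradedSym.map]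
    rw [h1, weightMap, lift_gen]
    simp only [weightGen, LinearMap.coe_mk, AddHom.coe_mk, c.isContraction.p_j, sub_self]
    rw [show (((0 : A), (0 : M)) : A × M) = 0 from rfl, map_zero, map_zero, zero_mul, add_zero]
  | hadd x y hx hy => simp only [map_add, hx, hy]
  | hmul x y hx hy => simp only [map_mul, hx, hy]

theorem weightMap_prod (l : List M) (hl : ∀ z ∈ l, c.p z = 0) :
    c.weightMap ((l.map (fun z => gen 𝒜 ℳ (0, z))).prod) =
      Polynomial.C ((l.map (fun z => gen 𝒜 ℳ (0, z))).prod) * Polynomial.X ^ l.length := by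
  induction l with
  | nil => simp
  | cons z l ih =>
    have h1 : c.weightMap (gen 𝒜 ℳ (0, z)) =
        Polynomial.C (gen 𝒜 ℳ (0, z)) * Polynomial.X := by
      rw [weightMap, lift_gen]
      simp only [weightGen, LinearMap.coe_mk, AddHom.coe_mk, hl z (by simp), map_zero, sub_zero]
      rw [show (((0 : A), (0 : M)) : A × M) = 0 from rfl, map_zero, map_zero, zero_add]
    rw [List.map_cons, List.prod_cons, map_mul, h1, ih (fun y hy => hl y (by simp [hy])), map_mul,
      List.length_cons, pow_succ', mul_assoc, mul_assoc, ← mul_assoc Polynomial.X,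
      Polynomial.X_mul_C, mul_assoc]

/-- On `j Σ ⊙ z_1 ⊙ ⋯ ⊙ z_i` with `z_1, …, z_i ∈ ker p`, the homotopy of `S_A M` is `h' / i` (and
`0` if `i = 0`). -/
theorem symH_apply (u : GradedSym 𝒜 𝒩) (l : List M) (hl : ∀ z ∈ l, c.p z = 0) :
    c.symH (c.symJ u * (l.map (fun z => gen 𝒜 ℳ (0, z))).prod) =
      (l.length : 𝕜)⁻¹ • c.symH' (c.symJ u * (l.map (fun z => gen 𝒜 ℳ (0, z))).prod) := by
  rw [symH, LinearMap.comp_apply, AlgHom.toLinearMap_apply, map_mul, weightMap_symJ,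
    c.weightMap_prod l hl, ← mul_assoc, ← map_mul, Polynomial.lsum_apply,
    Polynomial.C_mul_X_pow_eq_monomial, Polynomial.sum_monomial_index _ _ (by simp)]
  rfl

end LinearContraction

end SymContraction

/-! ### The two structures on `S_A N` -/

section Structures

open GradedSym

variable {𝕜 A M N : Type*} [Field 𝕜] [Ring A] [Algebra 𝕜 A]
  [AddCommGroup M] [Module 𝕜 M] [Module A M] [IsScalarTower 𝕜 A M]
  [AddCommGroup N] [Module 𝕜 N] [Module A N] [IsScalarTower 𝕜 A N]
  {𝒜 : ℤ → Submodule 𝕜 A} [GradedAlgebra 𝒜]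
  {ℳ : ℤ → Submodule 𝕜 M} [DirectSum.Decomposition ℳ] [SetLike.GradedSMul 𝒜 ℳ]
  {𝒩 : ℤ → Submodule 𝕜 N} [DirectSum.Decomposition 𝒩] [SetLike.GradedSMul 𝒜 𝒩]
  {D : DGCommStructure 𝒜}
  (X : DGLieRinehartStructure D ℳ) (Y : DGModuleStructure D 𝒩)
  (c : LinearContraction X.toDGModuleStructure Y)

/-- The operations on `S_A N` transferred from the DG Poisson algebra `S_A M` along the extended
contraction data. -/
def symTransfer : Operations 𝕜 (GradedSym 𝒜 𝒩) :=
  transfer (deg 𝒜 𝒩) X.poisson Y.symDiff c.symP.toLinearMap c.symJ.toLinearMap c.symH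

/-- The operations `λ_k` of the `LR_∞`-structure on `N`, transferred from the DG Lie algebra `M`. -/
def lrBracket : Operations 𝕜 N := transfer 𝒩 X.bracket Y.d c.p c.j c.h

/-- The operations transferred to `A ⊕ N` from the semidirect product DG Lie algebra `A ⊕ M`, along
the contraction data that are the given ones on `M` and trivial on `A`. -/
def semidirectTransfer : Operations 𝕜 (A × N) :=
  transfer (prodGrading 𝒜 𝒩) X.semidirect (D.d.prodMap Y.d)
    (LinearMap.id.prodMap c.p) (LinearMap.id.prodMap c.j) ((0 : A →ₗ[𝕜] A).prodMap c.h)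

/-- The operations `ν_{n+1}(q_1, …, q_n | a)` of the `LR_∞`-structure on `N`, transferred from the
DG Lie module `A` over `M`. -/
def lrAction (n : ℕ) (q : Fin n → N) (a : A) : A :=
  (semidirectTransfer X Y c (n + 1) (Fin.snoc (fun s => (0, q s)) (a, 0))).1

/-- `P` consists of multiderivations of `S_A N` extending the operations `λ_k` and `ν_k` of the
`LR_∞`-structure on `N`: on generators, `P_k` is `λ_k` if all arguments are in `N`, it is `ν_k` if
exactly one argument is in `A`, and it vanishes if at least two arguments are in `A`. -/
structure IsMultiderivationExtension (P : Operations 𝕜 (GradedSym 𝒜 𝒩)) : Prop where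
  multiderivation : ∀ k : ℕ, 1 ≤ k → IsGradedMultiderivation (deg 𝒜 𝒩) (P k)
  bracket : ∀ k : ℕ, 1 ≤ k → ∀ q : Fin k → N,
    P k (fun s => gen 𝒜 𝒩 (0, q s)) = gen 𝒜 𝒩 (0, lrBracket X Y c k q)
  action : ∀ (n : ℕ) (q : Fin n → N) (a : A),
    P (n + 1) (Fin.snoc (fun s => gen 𝒜 𝒩 (0, q s)) (gen 𝒜 𝒩 (a, 0))) =
      gen 𝒜 𝒩 (lrAction X Y c n q a, 0)
  vanish : ∀ (k : ℕ) (x : Fin k → A × N) (s t : Fin k), s ≠ t → (x s).2 = 0 → (x t).2 = 0 →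
    P k (fun r => gen 𝒜 𝒩 (x r)) = 0

end Structures

end

end StrongHomotopy

open StrongHomotopy

namespace StrongHomotopy

noncomputable section

/-! All arities are treated at once by means of nilpotent parameters. For arguments `x i` of degrees
`d i`, let Λ be the graded commutative algebra on generators ε_i of degree `1 - d i` with squares
zero. The sum of the x_i ε_i has total degree 1, and once the décalage sign `theta` is inserted, the
recursion for ψ and φ becomes the sign-free system Ψ = -jx + hΦ, Φ = -[Ψ,Ψ] in V ⊗ Λ (`bigPsi_eq`,
`bigPhi_eq`). The transferred operations are the coefficients of λ(x) = d'x + pΦ. Functions on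
`Finset (Fin n)` model V ⊗ Λ, sums over unshuffles become sums over subsets, and signs are compared
through their exponents in `ZMod 2`.

The L∞-relations come from the curvature B = δΨ + [Ψ,Ψ]. The Bianchi identity and the homotopy
formula give B = -jλ - 2h[Ψ,B] and d'λ = 2p[Ψ,B] (`curvature_equations`). The derivative of Ψ in the
direction λ solves the same linear equation as B, and the solution is unique because Ψ has no
constant term. Hence the derivative of λ in the direction λ vanishes (`sum_rho_linLam`), and its top
coefficient is the L∞-relation.

For S_A M, the Poisson bracket is a DG Lie bracket because commutators of derivations are
derivations, so that all identities can be tested on generators. The extended homotopy is controlled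
by the Euler derivation E = h'δ + δh', which is 1 - jp on M and multiplication by i in weight i, the
weight being the number of factors in ker p; there h is h'/i.

The delicate point is that the transferred operations are multiderivations although h is not a
derivation. The derivative of λ in the direction y is δy - P t j y, where δ is the differential of
S_A N, t = -2{Ψ,·} and P = p Σ (th)^k is the perturbed projection (`linLam_eq`). Since t is a
derivation and Pj = id, it suffices that P is multiplicative (`perturbedP_convMul`). The relation PE
= P t h' involves derivations only. Applied to a product, it shows that the defect of
multiplicativity is killed by the total weight, up to terms of higher order in the ε_i. In
characteristic 0 a descending induction on that order leaves only weight zero, the image of j, where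
P is multiplicative.

Finally, the generators A ⊕ M are preserved by the bracket and the contraction data, so on
generators the operations are those transferred from the semidirect product (`symTransfer_gen`). A
multiderivation is determined by its values on generators, which yields existence, uniqueness and
the coincidence of the two structures. -/

theorem negOnePow_congr {a b : ℤ} (h : (a : ZMod 2) = b) : a.negOnePow = b.negOnePow := by
  rw [Int.negOnePow_eq_iff, ← ZMod.intCast_eq_zero_iff_even]; simp [h]

/-! ### Sums over ordered decompositions of a finite set -/

section Decompositions

variable {ι E : Type*} [DecidableEq ι] [AddCommMonoid E]

/-- The sum of `F I J` over all decompositions `L = I ⊔ J`. -/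
def sum2 (L : Finset ι) (F : Finset ι → Finset ι → E) : E := ∑ I ∈ L.powerset, F I (L \ I)

/-- The sum of `F I J K` over all decompositions `L = I ⊔ J ⊔ K`. -/
def sum3 (L : Finset ι) (F : Finset ι → Finset ι → Finset ι → E) : E :=
  sum2 L (fun I S => sum2 S (F I))

theorem sum2_congr {L : Finset ι} {F G : Finset ι → Finset ι → E}
    (h : ∀ I J, Disjoint I J → I ∪ J = L → F I J = G I J) : sum2 L F = sum2 L G :=
  Finset.sum_congr rfl fun I hI => h _ _ Finset.disjoint_sdiff
    (Finset.union_sdiff_of_subset (Finset.mem_powerset.1 hI))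

theorem sum3_congr {L : Finset ι} {F G : Finset ι → Finset ι → Finset ι → E}
    (h : ∀ I J K, Disjoint I J → Disjoint I K → Disjoint J K → I ∪ (J ∪ K) = L →
      F I J K = G I J K) : sum3 L F = sum3 L G :=
  sum2_congr fun I S hIS hL => sum2_congr fun J K hJK hS => by
    subst hS
    rw [Finset.disjoint_union_right] at hIS
    exact h _ _ _ hIS.1 hIS.2 hJK hL

theorem sum2_comm (L : Finset ι) (F : Finset ι → Finset ι → E) :
    sum2 L F = sum2 L (fun I J => F J I) := by
  refine Finset.sum_nbij' (fun I => L \ I) (fun I => L \ I) ?_ ?_ ?_ ?_ ?_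
  · intro I _; exact Finset.mem_powerset.2 Finset.sdiff_subset
  · intro I _; exact Finset.mem_powerset.2 Finset.sdiff_subset
  · intro I hI; exact Finset.sdiff_sdiff_eq_self (Finset.mem_powerset.1 hI)
  · intro I hI; exact Finset.sdiff_sdiff_eq_self (Finset.mem_powerset.1 hI)
  · intro I hI
    simp only [Finset.sdiff_sdiff_eq_self (Finset.mem_powerset.1 hI)]

/-- Both nestings enumerate ordered decompositions into three blocks: a chain I ⊆ S ⊆ L corresponds
to the blocks I, S ∖ I and L ∖ S. This is the associativity behind double brackets. -/
theorem sum2_sum2_left (L : Finset ι) (F : Finset ι → Finset ι → Finset ι → E) :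
    sum2 L (fun S K => sum2 S (fun I J => F I J K)) = sum3 L F := by
  simp only [sum3, sum2, Finset.sum_sigma']
  refine Finset.sum_nbij' (fun p => ⟨p.2, p.1 \ p.2⟩) (fun p => ⟨p.1 ∪ p.2, p.1⟩) ?_ ?_ ?_ ?_ ?_
  · rintro ⟨S, I⟩ h
    simp only [Finset.mem_sigma, Finset.mem_powerset] at h ⊢
    exact ⟨h.2.trans h.1, Finset.sdiff_subset_sdiff h.1 le_rfl⟩
  · rintro ⟨I, J⟩ h
    simp only [Finset.mem_sigma, Finset.mem_powerset] at h ⊢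
    exact ⟨Finset.union_subset h.1 (h.2.trans Finset.sdiff_subset), Finset.subset_union_left⟩
  · rintro ⟨S, I⟩ h
    simp only [Finset.mem_sigma, Finset.mem_powerset] at h
    simp only [Finset.union_sdiff_of_subset h.2]
  · rintro ⟨I, J⟩ h
    simp only [Finset.mem_sigma, Finset.mem_powerset] at h
    simp only [Finset.union_sdiff_cancel_left (Finset.disjoint_of_subset_right h.2
      Finset.disjoint_sdiff)]
  · rintro ⟨S, I⟩ h
    simp only [Finset.mem_sigma, Finset.mem_powerset] at h
    simp only
    congr 1
    ext x
    have := @h.2 x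
    simp only [Finset.mem_sdiff]
    tauto

theorem sum3_swap (L : Finset ι) (F : Finset ι → Finset ι → Finset ι → E) :
    sum3 L F = sum3 L (fun I J K => F J I K) := by
  rw [← sum2_sum2_left, ← sum2_sum2_left]
  exact sum2_congr fun S K _ _ => sum2_comm S _

theorem sum2_add (L : Finset ι) (F G : Finset ι → Finset ι → E) :
    sum2 L F + sum2 L G = sum2 L (fun I J => F I J + G I J) := Finset.sum_add_distrib.symm

theorem sum3_add (L : Finset ι) (F G : Finset ι → Finset ι → Finset ι → E) :
    sum3 L F + sum3 L G = sum3 L (fun I J K => F I J K + G I J K) := by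
  simp only [sum3, sum2_add]

theorem map_sum2 {E' H : Type*} [AddCommMonoid E'] [FunLike H E E'] [AddMonoidHomClass H E E']
    (f : H) (L : Finset ι) (F : Finset ι → Finset ι → E) :
    f (sum2 L F) = sum2 L (fun I J => f (F I J)) := map_sum f _ _

theorem smul_sum2 {R : Type*} [DistribSMul R E] (r : R) (L : Finset ι)
    (F : Finset ι → Finset ι → E) : r • sum2 L F = sum2 L (fun I J => r • F I J) :=
  Finset.smul_sum

theorem sum2_eq_single_left {L : Finset ι} {F : Finset ι → Finset ι → E}
    (h : ∀ I J, I ≠ ∅ → F I J = 0) : sum2 L F = F ∅ L := by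
  rw [sum2, Finset.sum_eq_single ∅ (fun I _ hI => h _ _ hI) (by simp)]
  simp

end Decompositions

/-! ### Graded parameters

For degrees `d` of `n` arguments, functions `Finset (Fin n) → V` are regarded as elements of `V ⊗ Λ`,
where `Λ` is the graded commutative algebra with generators `ε_i` of degree `1 - d i` and relations
`ε_i ^ 2 = 0`. -/

section Parameters

variable {n : ℕ} (d : Fin n → ℤ)

/-- The degree of the monomial `ε_I`. -/
def eps (I : Finset (Fin n)) : ℤ := ∑ i ∈ I, (1 - d i)

/-- The exponent of the sign in `ε_I ε_J = ± ε_{I ⊔ J}`. -/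
def gam (I J : Finset (Fin n)) : ℤ :=
  ∑ i ∈ I, ∑ j ∈ J, if i < j then (1 - d i) * (1 - d j) else 0

@[simp] theorem eps_empty : eps d ∅ = 0 := rfl

@[simp] theorem gam_empty_left (J : Finset (Fin n)) : gam d ∅ J = 0 := rfl

@[simp] theorem gam_empty_right (I : Finset (Fin n)) : gam d I ∅ = 0 := by simp [gam]

theorem eps_union {I J : Finset (Fin n)} (h : Disjoint I J) :
    eps d (I ∪ J) = eps d I + eps d J := Finset.sum_union h

theorem gam_union_left {I J : Finset (Fin n)} (h : Disjoint I J) (K : Finset (Fin n)) :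
    gam d (I ∪ J) K = gam d I K + gam d J K := Finset.sum_union h

theorem gam_union_right (I : Finset (Fin n)) {J K : Finset (Fin n)} (h : Disjoint J K) :
    gam d I (J ∪ K) = gam d I J + gam d I K := by
  simp only [gam, Finset.sum_union h, Finset.sum_add_distrib]

/-- Disjointness excludes i = j, so each pair is counted in exactly one of the two sums. This is the
graded commutativity of ε_I and ε_J. -/
theorem gam_add_gam {I J : Finset (Fin n)} (h : Disjoint I J) :
    gam d I J + gam d J I = eps d I * eps d J := by
  rw [gam, gam, Finset.sum_comm (s := J), ← Finset.sum_add_distrib, eps, eps, Finset.sum_mul_sum]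
  refine Finset.sum_congr rfl fun i hi => ?_
  rw [← Finset.sum_add_distrib]
  refine Finset.sum_congr rfl fun j hj => ?_
  have hij : i ≠ j := fun h' => Finset.disjoint_left.1 h hi (h' ▸ hj)
  rcases lt_or_gt_of_ne hij with h1 | h1
  · simp [h1, h1.not_gt]
  · simp [h1, h1.not_gt, mul_comm]

theorem gam_comm_cast {I J : Finset (Fin n)} (h : Disjoint I J) :
    (gam d J I : ZMod 2) = gam d I J + eps d I * eps d J := by
  have := congrArg (Int.cast (R := ZMod 2)) (gam_add_gam d h)
  push_cast at this
  grind

end Parameters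

/-! ### Koszul extension of linear and bilinear operations to V ⊗ Λ -/

section Convolution

variable {𝕜 X Y Z : Type*} [Field 𝕜] [AddCommGroup X] [Module 𝕜 X] [AddCommGroup Y] [Module 𝕜 Y]
  [AddCommGroup Z] [Module 𝕜 Z] {n : ℕ} (d : Fin n → ℤ)

/-- The extension of a bilinear map `b` to functions `Finset (Fin n) → X`, by the Koszul rule. -/
def conv (𝒴 : ℤ → Submodule 𝕜 Y) [DirectSum.Decomposition 𝒴] (b : X →ₗ[𝕜] Y →ₗ[𝕜] Z) :
    (Finset (Fin n) → X) →ₗ[𝕜] (Finset (Fin n) → Y) →ₗ[𝕜] (Finset (Fin n) → Z) :=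
  LinearMap.mk₂ 𝕜
    -- The value `f I` is the coefficient of ε_I, written to the left of it. The twist moves ε_I
    -- past `g J`, and `gam` is the sign of reordering ε_I ε_J; since pairs i < j contribute,
    -- monomials are ordered by decreasing index.
    (fun f g L => sum2 L (fun I J =>
      (gam d I J).negOnePow • b (f I) (signTwist 𝒴 (eps d I) (g J))))
    (by intro f f' g; ext L; simp [sum2_add])
    (by intro c f g; ext L; simp [smul_sum2, smul_comm c])
    (by intro f f' g; ext L; simp [sum2_add])
    (by intro c f g; ext L; simp [smul_sum2, smul_comm c])

theorem conv_apply (𝒴 : ℤ → Submodule 𝕜 Y) [DirectSum.Decomposition 𝒴] (b : X →ₗ[𝕜] Y →ₗ[𝕜] Z)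
    (f : Finset (Fin n) → X) (g : Finset (Fin n) → Y) (L : Finset (Fin n)) :
    conv d 𝒴 b f g L = sum2 L (fun I J =>
      (gam d I J).negOnePow • b (f I) (signTwist 𝒴 (eps d I) (g J))) := rfl

/-- `f` is homogeneous of total degree `m`. -/
def IsTotal (𝒳 : ℤ → Submodule 𝕜 X) (m : ℤ) (f : Finset (Fin n) → X) : Prop :=
  ∀ I, f I ∈ 𝒳 (m - eps d I)

/-- The componentwise extension of a linear map. -/
def comp (f : X →ₗ[𝕜] Y) : (Finset (Fin n) → X) →ₗ[𝕜] (Finset (Fin n) → Y) :=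
  LinearMap.compLeft f _

@[simp] theorem comp_apply (f : X →ₗ[𝕜] Y) (g : Finset (Fin n) → X) (I : Finset (Fin n)) :
    comp f g I = f (g I) := rfl

/-- The parity operator for the total degree. -/
def totalTwist (𝒳 : ℤ → Submodule 𝕜 X) [DirectSum.Decomposition 𝒳] :
    (Finset (Fin n) → X) →ₗ[𝕜] (Finset (Fin n) → X) where
  toFun f I := (eps d I).negOnePow • signTwist 𝒳 1 (f I)
  map_add' f g := by ext I; simp
  map_smul' c f := by ext I; simp [smul_comm c]

theorem totalTwist_apply (𝒳 : ℤ → Submodule 𝕜 X) [DirectSum.Decomposition 𝒳]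
    (f : Finset (Fin n) → X) (I : Finset (Fin n)) :
    totalTwist d 𝒳 f I = (eps d I).negOnePow • signTwist 𝒳 1 (f I) := rfl

/-- A bilinear map between graded vector spaces is compatible with the gradings. -/
def IsBigraded (𝒳 : ℤ → Submodule 𝕜 X) (𝒴 : ℤ → Submodule 𝕜 Y) (𝒵 : ℤ → Submodule 𝕜 Z)
    (b : X →ₗ[𝕜] Y →ₗ[𝕜] Z) : Prop :=
  ∀ i j x y, x ∈ 𝒳 i → y ∈ 𝒴 j → b x y ∈ 𝒵 (i + j)

variable {d} {𝒳 : ℤ → Submodule 𝕜 X} {𝒴 : ℤ → Submodule 𝕜 Y} {𝒵 : ℤ → Submodule 𝕜 Z}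

theorem sum2_mem (P : Submodule 𝕜 X) {L : Finset (Fin n)}
    {F : Finset (Fin n) → Finset (Fin n) → X}
    (h : ∀ I J, Disjoint I J → I ∪ J = L → F I J ∈ P) : sum2 L F ∈ P :=
  Submodule.sum_mem _ fun I hI => h _ _ Finset.disjoint_sdiff
    (Finset.union_sdiff_of_subset (Finset.mem_powerset.1 hI))

theorem IsTotal.comp {f : X →ₗ[𝕜] Y} {e : ℤ} (hf : ∀ i x, x ∈ 𝒳 i → f x ∈ 𝒴 (i + e)) {m : ℤ}
    {g : Finset (Fin n) → X} (hg : IsTotal d 𝒳 m g) : IsTotal d 𝒴 (m + e) (comp f g) := fun I => by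
  have := hf _ _ (hg I)
  rwa [sub_add_eq_add_sub] at this

theorem IsTotal.conv [DirectSum.Decomposition 𝒴] {b : X →ₗ[𝕜] Y →ₗ[𝕜] Z}
    (hb : IsBigraded 𝒳 𝒴 𝒵 b) {l m : ℤ}
    {f : Finset (Fin n) → X} {g : Finset (Fin n) → Y} (hf : IsTotal d 𝒳 l f)
    (hg : IsTotal d 𝒴 m g) : IsTotal d 𝒵 (l + m) (conv d 𝒴 b f g) := fun L => by
  rw [conv_apply]
  refine sum2_mem _ fun I J hd hL => sign_smul_mem _ _ ?_
  have := hb _ _ _ _ (hf I) (signTwist_mem 𝒴 (eps d I) (hg J))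
  rwa [show l - eps d I + (m - eps d J) = l + m - eps d L by rw [← hL, eps_union d hd]; ring]
    at this

theorem signTwist_bilinear [DirectSum.Decomposition 𝒳] [DirectSum.Decomposition 𝒴]
    [DirectSum.Decomposition 𝒵] {b : X →ₗ[𝕜] Y →ₗ[𝕜] Z} (hb : IsBigraded 𝒳 𝒴 𝒵 b) (m : ℤ)
    (x : X) (y : Y) :
    signTwist 𝒵 m (b x y) = b (signTwist 𝒳 m x) (signTwist 𝒴 m y) := by
  refine bilinear_ext 𝒳 𝒴 (fun x y => signTwist 𝒵 m (b x y))
    (fun x y => b (signTwist 𝒳 m x) (signTwist 𝒴 m y)) ?_ ?_ ?_ ?_ ?_ x y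
  · intro x x' y; simp
  · intro x y y'; simp
  · intro x x' y; simp
  · intro x y y'; simp
  · intro i j x y hx hy
    simp only [signTwist_of_mem _ m hx, signTwist_of_mem _ m hy, signTwist_of_mem _ m (hb _ _ _ _ hx hy),
      map_sign_smul, LinearMap.map_smul_of_tower, LinearMap.smul_apply, smul_smul, mul_add,
      Int.negOnePow_add]

theorem signTwist_neg_one_pow [DirectSum.Decomposition 𝒳] (m : ℤ) (u : ℤˣ) (x : X) :
    signTwist 𝒳 m (u • x) = u • signTwist 𝒳 m x := map_sign_smul _ _ _

variable {X' Y' Z' : Type*} [AddCommGroup X'] [Module 𝕜 X'] [AddCommGroup Y'] [Module 𝕜 Y']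
  [AddCommGroup Z'] [Module 𝕜 Z']
  {𝒳' : ℤ → Submodule 𝕜 X'} {𝒴' : ℤ → Submodule 𝕜 Y'} {𝒵' : ℤ → Submodule 𝕜 Z'}

/-- Expansion of `b(f, b'(g, h))`. -/
theorem conv_conv_right [DirectSum.Decomposition 𝒳'] [DirectSum.Decomposition 𝒴]
    [DirectSum.Decomposition 𝒴'] {b : X →ₗ[𝕜] Y →ₗ[𝕜] Z} {b' : X' →ₗ[𝕜] Y' →ₗ[𝕜] Y}
    (hb' : IsBigraded 𝒳' 𝒴' 𝒴 b') (f : Finset (Fin n) → X) (g : Finset (Fin n) → X')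
    (h : Finset (Fin n) → Y') (L : Finset (Fin n)) :
    conv d 𝒴 b f (conv d 𝒴' b' g h) L = sum3 L (fun I J K =>
      (gam d I J + gam d I K + gam d J K).negOnePow •
        b (f I) (b' (signTwist 𝒳' (eps d I) (g J)) (signTwist 𝒴' (eps d I + eps d J) (h K)))) := by
  rw [conv_apply, sum3]
  refine sum2_congr fun I S _ _ => ?_
  rw [conv_apply, map_sum2, map_sum2, smul_sum2]
  refine sum2_congr fun J K hJK hS => ?_
  rw [signTwist_neg_one_pow, map_sign_smul, smul_smul, signTwist_bilinear hb', signTwist_signTwist,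
    ← hS, gam_union_right d I hJK, ← Int.negOnePow_add]

/-- Expansion of `b(b'(f, g), h)`. -/
theorem conv_conv_left [DirectSum.Decomposition 𝒴]
    [DirectSum.Decomposition 𝒴'] {b : X →ₗ[𝕜] Y →ₗ[𝕜] Z} {b' : X' →ₗ[𝕜] Y' →ₗ[𝕜] X}
    (f : Finset (Fin n) → X') (g : Finset (Fin n) → Y')
    (h : Finset (Fin n) → Y) (L : Finset (Fin n)) :
    conv d 𝒴 b (conv d 𝒴' b' f g) h L = sum3 L (fun I J K =>
      (gam d I J + gam d I K + gam d J K).negOnePow •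
        b (b' (f I) (signTwist 𝒴' (eps d I) (g J))) (signTwist 𝒴 (eps d I + eps d J) (h K))) := by
  rw [conv_apply, ← sum2_sum2_left]
  refine sum2_congr fun S K _ _ => ?_
  rw [conv_apply, ← LinearMap.flip_apply, map_sum2, smul_sum2]
  refine sum2_congr fun I J hIJ hS => ?_
  rw [LinearMap.flip_apply, map_sign_smul, LinearMap.smul_apply, smul_smul, ← Int.negOnePow_add,
    ← hS, gam_union_left d hIJ, eps_union d hIJ]
  congr 2
  ring

/-- Exchanging the two blocks produces the sign of the coefficients, the two Koszul twists and the
sign of commuting ε_I with ε_J; by `gam_comm_cast` these combine into a sign depending on the total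
degrees only. In particular an element of odd total degree need not have vanishing bracket with
itself. -/
theorem conv_skew [DirectSum.Decomposition 𝒳] {b : X →ₗ[𝕜] X →ₗ[𝕜] Z}
    (hb : ∀ i j v w, v ∈ 𝒳 i → w ∈ 𝒳 j → b v w = -((i * j).negOnePow • b w v))
    {l m : ℤ} {f g : Finset (Fin n) → X} (hf : IsTotal d 𝒳 l f) (hg : IsTotal d 𝒳 m g) :
    conv d 𝒳 b f g = -((l * m).negOnePow • conv d 𝒳 b g f) := by
  ext L
  rw [Pi.neg_apply, Pi.smul_apply, conv_apply, conv_apply, sum2_comm, smul_sum2,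
    show ∀ x : Z, -x = (-1 : ℤˣ) • x from fun x => by simp, smul_sum2]
  refine sum2_congr fun I J hIJ _ => ?_
  rw [signTwist_of_mem _ _ (hg I), signTwist_of_mem _ _ (hf J), map_sign_smul, map_sign_smul,
    hb _ _ _ _ (hf J) (hg I)]
  simp only [smul_neg, smul_smul, ← Int.negOnePow_add, neg_mul, one_mul, Units.neg_smul]
  congr 2
  apply negOnePow_congr
  have := gam_comm_cast d hIJ
  push_cast
  grind

/-- The identity holds separately for every decomposition into three blocks; in the last term the
first two blocks are exchanged so that the same block feeds `f` throughout. -/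
theorem conv_jacobi [DirectSum.Decomposition 𝒳] {b : X →ₗ[𝕜] X →ₗ[𝕜] X}
    (hb : IsBigraded 𝒳 𝒳 𝒳 b)
    (hj : ∀ i j v w u, v ∈ 𝒳 i → w ∈ 𝒳 j →
      b v (b w u) = b (b v w) u + (i * j).negOnePow • b w (b v u))
    {l m : ℤ} {f g : Finset (Fin n) → X} (h : Finset (Fin n) → X)
    (hf : IsTotal d 𝒳 l f) (hg : IsTotal d 𝒳 m g) :
    conv d 𝒳 b f (conv d 𝒳 b g h) = conv d 𝒳 b (conv d 𝒳 b f g) h +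
      (l * m).negOnePow • conv d 𝒳 b g (conv d 𝒳 b f h) := by
  ext L
  rw [Pi.add_apply, Pi.smul_apply, conv_conv_right hb, conv_conv_right hb, conv_conv_left,
    sum3_swap L (fun I J K => (gam d I J + gam d I K + gam d J K).negOnePow •
        b (g I) (b (signTwist 𝒳 (eps d I) (f J)) (signTwist 𝒳 (eps d I + eps d J) (h K)))),
    sum3, sum3, sum3, smul_sum2]
  simp only [smul_sum2]
  change _ = sum3 _ _ + sum3 _ _
  rw [sum3_add]
  refine sum3_congr fun I J K hIJ _ _ _ => ?_
  rw [signTwist_of_mem _ _ (hg J), signTwist_of_mem _ _ (hf I)]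
  simp only [map_sign_smul, LinearMap.smul_apply, hj _ _ _ _ _ (hf I) (hg J), smul_add, smul_smul,
    ← Int.negOnePow_add, add_comm (eps d J) (eps d I)]
  congr 2
  apply negOnePow_congr
  have := gam_comm_cast d hIJ
  push_cast
  grind

theorem map_signTwist [DirectSum.Decomposition 𝒳] [DirectSum.Decomposition 𝒴] {e : ℤ}
    {D : X →ₗ[𝕜] Y} (hD : ∀ i x, x ∈ 𝒳 i → D x ∈ 𝒴 (i + e)) (m : ℤ) (x : X) :
    D (signTwist 𝒳 m x) = (m * e).negOnePow • signTwist 𝒴 m (D x) := by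
  induction x using DirectSum.Decomposition.inductionOn 𝒳 with
  | zero => simp
  | add x y hx hy => simp only [map_add, hx, hy, smul_add]
  | homogeneous x =>
    rw [signTwist_of_mem _ _ x.2, signTwist_of_mem _ _ (hD _ _ x.2), map_sign_smul, smul_smul,
      ← Int.negOnePow_add]
    congr 1
    apply negOnePow_congr
    push_cast
    grind

/-- The operator acts from the left, so it passes the coefficient `f I` and then, inside the twist,
the monomial ε_I. The two signs add up to the one of the total degree m. -/
theorem comp_conv_derivation [DirectSum.Decomposition 𝒴] [DirectSum.Decomposition 𝒵]
    {b : X →ₗ[𝕜] Y →ₗ[𝕜] Z}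
    {DX : X →ₗ[𝕜] X} {DY : Y →ₗ[𝕜] Y} {DZ : Z →ₗ[𝕜] Z}
    {e : ℤ} (hDY : ∀ i x, x ∈ 𝒴 i → DY x ∈ 𝒴 (i + e))
    (hder : ∀ i v w, v ∈ 𝒳 i → DZ (b v w) = b (DX v) w + (e * i).negOnePow • b v (DY w))
    {m : ℤ} {f : Finset (Fin n) → X} (hf : IsTotal d 𝒳 m f) (g : Finset (Fin n) → Y) :
    comp DZ (conv d 𝒴 b f g) = conv d 𝒴 b (comp DX f) g +
      (e * m).negOnePow • conv d 𝒴 b f (comp DY g) := by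
  ext L
  rw [Pi.add_apply, Pi.smul_apply, comp_apply, conv_apply, conv_apply, conv_apply, smul_sum2,
    sum2_add, map_sum2]
  refine sum2_congr fun I J _ _ => ?_
  rw [map_sign_smul, hder _ _ _ (hf I), map_signTwist hDY]
  simp only [comp_apply, map_sign_smul, smul_add, smul_smul, ← Int.negOnePow_add]
  congr 2
  apply negOnePow_congr
  push_cast
  grind

/-- A degree zero map compatible with bilinear operations is compatible with their extensions. -/
theorem comp_conv [DirectSum.Decomposition 𝒴] [DirectSum.Decomposition 𝒴']
    {b : X →ₗ[𝕜] Y →ₗ[𝕜] Z} {b' : X' →ₗ[𝕜] Y' →ₗ[𝕜] Z'} {φ : X →ₗ[𝕜] X'} {χ : Y →ₗ[𝕜] Y'}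
    {ω : Z →ₗ[𝕜] Z'} (hχ : ∀ i x, x ∈ 𝒴 i → χ x ∈ 𝒴' i)
    (hb : ∀ x y, ω (b x y) = b' (φ x) (χ y)) (f : Finset (Fin n) → X) (g : Finset (Fin n) → Y) :
    comp ω (conv d 𝒴 b f g) = conv d 𝒴' b' (comp φ f) (comp χ g) := by
  ext L
  rw [comp_apply, conv_apply, conv_apply, map_sum2]
  refine sum2_congr fun I J _ _ => ?_
  have := map_signTwist (D := χ) (𝒳 := 𝒴) (𝒴 := 𝒴') (e := 0) (by simpa using hχ) (eps d I) (g J)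
  rw [mul_zero, Int.negOnePow_zero, one_smul] at this
  rw [map_sign_smul, hb, this]
  rfl

/-- Right multiplication by `ε_J`. -/
def rho (d : Fin n → ℤ) (J : Finset (Fin n)) :
    (Finset (Fin n) → X) →ₗ[𝕜] (Finset (Fin n) → X) where
  toFun f K := if J ⊆ K then (gam d (K \ J) J).negOnePow • f (K \ J) else 0
  map_add' f g := by ext K; simp only [Pi.add_apply]; split_ifs <;> simp
  map_smul' c f := by
    ext K; simp only [Pi.smul_apply, RingHom.id_apply]; split_ifs <;> simp [smul_comm c]

theorem rho_apply (J : Finset (Fin n)) (f : Finset (Fin n) → X) (K : Finset (Fin n)) :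
    rho (𝕜 := 𝕜) d J f K = if J ⊆ K then (gam d (K \ J) J).negOnePow • f (K \ J) else 0 := rfl

theorem comp_rho (φ : X →ₗ[𝕜] Y) (J : Finset (Fin n)) (f : Finset (Fin n) → X) :
    comp φ (rho (𝕜 := 𝕜) d J f) = rho (𝕜 := 𝕜) d J (comp φ f) := by
  ext K
  simp only [comp_apply, rho_apply]
  split_ifs
  · rw [map_sign_smul]
  · simp

/-- Operations extended from V are linear for the right multiplication by Λ. Only decompositions
with S contained in the second block survive, and the signs match because the product of Λ is
associative. -/
theorem conv_rho [DirectSum.Decomposition 𝒴] (b : X →ₗ[𝕜] Y →ₗ[𝕜] Z) (S : Finset (Fin n))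
    (f : Finset (Fin n) → X) (g : Finset (Fin n) → Y) :
    conv d 𝒴 b f (rho (𝕜 := 𝕜) d S g) = rho (𝕜 := 𝕜) d S (conv d 𝒴 b f g) := by
  ext L
  rw [conv_apply, rho_apply]
  split_ifs with hS
  · rw [conv_apply, smul_sum2, sum2, sum2, ← Finset.sum_subset
      (Finset.powerset_mono.2 (Finset.sdiff_subset : L \ S ⊆ L))]
    · refine Finset.sum_congr rfl fun I hI => ?_
      rw [Finset.mem_powerset, Finset.subset_sdiff] at hI
      have h1 : S ⊆ L \ I := Finset.subset_sdiff.2 ⟨hS, hI.2.symm⟩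
      have h2 : L \ S = I ∪ ((L \ S) \ I) :=
        (Finset.union_sdiff_of_subset (Finset.subset_sdiff.2 hI)).symm
      have h3 : L \ I = S ∪ ((L \ S) \ I) := by
        rw [sdiff_right_comm, Finset.union_sdiff_of_subset h1]
      have h4 : gam d (L \ S) S = gam d I S + gam d ((L \ S) \ I) S := by
        conv_lhs => rw [h2]
        exact gam_union_left d Finset.disjoint_sdiff S
      have h5 : gam d I (L \ I) = gam d I S + gam d I ((L \ S) \ I) := by
        conv_lhs => rw [h3]
        exact gam_union_right d I (by rw [sdiff_right_comm]; exact Finset.disjoint_sdiff)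
      rw [rho_apply, if_pos h1, map_sign_smul, map_sign_smul, smul_smul, smul_smul,
        ← Int.negOnePow_add, ← Int.negOnePow_add, h4, h5, sdiff_right_comm]
      congr 1
      apply negOnePow_congr
      push_cast
      grind
    · intro I hI hI'
      rw [Finset.mem_powerset] at hI hI'
      rw [rho_apply, if_neg, map_zero, map_zero, smul_zero]
      intro h
      exact hI' (Finset.subset_sdiff.2 ⟨hI, (Finset.subset_sdiff.1 h).2.symm⟩)
  · refine Finset.sum_eq_zero fun I _ => ?_
    beta_reduce
    rw [rho_apply, if_neg, map_zero, map_zero, smul_zero]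
    exact fun h => hS (h.trans Finset.sdiff_subset)

/-- The function supported at the empty set. -/
def const : X →ₗ[𝕜] (Finset (Fin n) → X) := LinearMap.single 𝕜 (fun _ => X) ∅

theorem const_apply (x : X) (I : Finset (Fin n)) :
    const (𝕜 := 𝕜) x I = if I = ∅ then x else 0 := by
  simp [const, Pi.single_apply]

theorem comp_const (φ : X →ₗ[𝕜] Y) (x : X) :
    comp φ (const (𝕜 := 𝕜) (n := n) x) = const (𝕜 := 𝕜) (φ x) := by
  ext I
  simp only [comp_apply, const_apply]
  split_ifs <;> simp

/-- The expansion of an element of V ⊗ Λ in the monomials ε_J. With the right linearity above, it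
reduces linear equations over V ⊗ Λ to constant data. -/
theorem sum_rho_const (f : Finset (Fin n) → X) :
    ∑ J, rho (𝕜 := 𝕜) d J (const (𝕜 := 𝕜) (f J)) = f := by
  ext K
  rw [Finset.sum_apply, Finset.sum_eq_single K]
  · simp [rho_apply, const_apply]
  · intro J _ hJ
    rw [rho_apply]
    split_ifs with h
    · rw [const_apply, if_neg, smul_zero]
      rw [Finset.sdiff_eq_empty_iff_subset]
      exact fun h' => hJ (h.antisymm h')
    · rfl
  · simp

theorem conv_const_left [DirectSum.Decomposition 𝒴] (b : X →ₗ[𝕜] Y →ₗ[𝕜] Z) (x : X)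
    (g : Finset (Fin n) → Y) : conv d 𝒴 b (const (𝕜 := 𝕜) x) g = comp (b x) g := by
  ext L
  rw [conv_apply, sum2_eq_single_left]
  · rw [const_apply, if_pos rfl, gam_empty_left, Int.negOnePow_zero, one_smul, eps_empty,
      comp_apply]
    congr 1
    induction g L using DirectSum.Decomposition.inductionOn 𝒴 with
    | zero => simp
    | add x y hx hy => rw [map_add, hx, hy]
    | homogeneous x => rw [signTwist_of_mem _ _ x.2, zero_mul, Int.negOnePow_zero, one_smul]
  · intro I J hI
    simp [const_apply, hI]

theorem conv_const_right [DirectSum.Decomposition 𝒴] (b : X →ₗ[𝕜] Y →ₗ[𝕜] Z)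
    (f : Finset (Fin n) → X) {y : Y} {m : ℤ} (hy : y ∈ 𝒴 m) (L : Finset (Fin n)) :
    conv d 𝒴 b f (const (𝕜 := 𝕜) y) L = (eps d L * m).negOnePow • b (f L) y := by
  rw [conv_apply, sum2_comm, sum2_eq_single_left]
  · rw [const_apply, if_pos rfl, gam_empty_right, Int.negOnePow_zero, one_smul,
      signTwist_of_mem _ _ hy, map_sign_smul]
  · intro I J hI
    simp [const_apply, hI]

theorem conv_const_const [DirectSum.Decomposition 𝒴] (b : X →ₗ[𝕜] Y →ₗ[𝕜] Z) (x : X) (y : Y) :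
    conv d 𝒴 b (const (𝕜 := 𝕜) x) (const (𝕜 := 𝕜) y) = const (𝕜 := 𝕜) (b x y) := by
  rw [conv_const_left, comp_const]

/-- If `b v` is a derivation for every homogeneous `v`, then so is its extension. -/
theorem conv_leibniz {R : Type*} [Ring R] [Algebra 𝕜 R] {ℛ : ℤ → Submodule 𝕜 R} [GradedAlgebra ℛ]
    {b : R →ₗ[𝕜] R →ₗ[𝕜] R} (hb : IsBigraded ℛ ℛ ℛ b)
    (hl : ∀ i v, v ∈ ℛ i → ∀ x y, b v (x * y) = b v x * y + signTwist ℛ i x * b v y)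
    {f : Finset (Fin n) → R} (hf : IsTotal d ℛ 1 f) (g h : Finset (Fin n) → R) :
    conv d ℛ b f (conv d ℛ (LinearMap.mul 𝕜 R) g h) =
      conv d ℛ (LinearMap.mul 𝕜 R) (conv d ℛ b f g) h +
        conv d ℛ (LinearMap.mul 𝕜 R) (totalTwist d ℛ g) (conv d ℛ b f h) := by
  have hmul : IsBigraded ℛ ℛ ℛ (LinearMap.mul 𝕜 R) :=
    fun i j x y hx hy => SetLike.GradedMul.mul_mem hx hy
  ext L
  rw [Pi.add_apply, conv_conv_right hmul, conv_conv_right hb, conv_conv_left, sum3_swap L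
    (fun I J K => (gam d I J + gam d I K + gam d J K).negOnePow •
      LinearMap.mul 𝕜 R (totalTwist d ℛ g I) (b (signTwist ℛ (eps d I) (f J))
        (signTwist ℛ (eps d I + eps d J) (h K)))), sum3_add]
  refine sum3_congr fun I J K hIJ _ _ _ => ?_
  -- The Leibniz rule twists `g J` by the degree `1 - eps d I` of `f I`, in addition to the Koszul
  -- twist by `eps d I`. The sum is the twist by 1 occurring in `totalTwist`; this is where total
  -- degree 1 of `f` enters.
  simp only [LinearMap.mul_apply', totalTwist_apply, hl _ _ (hf I), signTwist_of_mem _ _ (hf I),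
    signTwist_signTwist, map_sign_smul, LinearMap.smul_apply, smul_mul_assoc, mul_smul_comm,
    smul_add, smul_smul, ← Int.negOnePow_add, add_comm (eps d J) (eps d I), sub_add_cancel]
  congr 2
  apply negOnePow_congr
  have := gam_comm_cast d hIJ
  push_cast
  grind

theorem totalTwist_totalTwist [DirectSum.Decomposition 𝒳] (f : Finset (Fin n) → X) :
    totalTwist d 𝒳 (totalTwist d 𝒳 f) = f := by
  ext I
  rw [totalTwist_apply, totalTwist_apply, signTwist_neg_one_pow, smul_smul, Int.units_mul_self,
    one_smul, signTwist_signTwist]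
  induction f I using DirectSum.Decomposition.inductionOn 𝒳 with
  | zero => simp
  | add x y hx hy => rw [map_add, hx, hy]
  | homogeneous x =>
    rw [signTwist_of_mem _ _ x.2, show ((1 + 1 : ℤ)) = 2 by norm_num, Int.negOnePow_two_mul,
      one_smul]

end Convolution

end

end StrongHomotopy

namespace StrongHomotopy

noncomputable section

/-! ### Sums over unshuffles as sums over subsets -/

section Unshuffles

theorem sum2_map {ι κ E : Type*} [DecidableEq ι] [DecidableEq κ] [AddCommMonoid E] (f : ι ↪ κ)
    (L : Finset ι) (F : Finset κ → Finset κ → E) :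
    sum2 (L.map f) F = sum2 L (fun I J => F (I.map f) (J.map f)) := by
  rw [sum2, sum2]
  have h1 : (L.map f).powerset = L.powerset.map (Finset.mapEmbedding f).toEmbedding := by
    ext S
    simp only [Finset.mem_powerset, Finset.mem_map, RelEmbedding.coe_toEmbedding,
      Finset.mapEmbedding_apply]
    exact Finset.subset_map_iff.trans (by simp [eq_comm])
  rw [h1, Finset.sum_map]
  refine Finset.sum_congr rfl fun I _ => ?_
  simp only [RelEmbedding.coe_toEmbedding, Finset.mapEmbedding_apply]
  congr 1
  ext x
  simp only [Finset.mem_sdiff, Finset.mem_map]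
  constructor
  · rintro ⟨⟨a, ha, rfl⟩, h⟩
    exact ⟨a, ⟨ha, fun h' => h ⟨a, h', rfl⟩⟩, rfl⟩
  · rintro ⟨a, ⟨ha, h⟩, rfl⟩
    exact ⟨⟨a, ha, rfl⟩, by rintro ⟨b, hb, hba⟩; exact h (f.injective hba ▸ hb)⟩

/-- The image of the first `a` letters. -/
def firstBlock {k : ℕ} (a : ℕ) (σ : Equiv.Perm (Fin k)) : Finset (Fin k) :=
  Finset.univ.filter (fun i => ((σ.symm i : Fin k) : ℕ) < a)

variable {a b k : ℕ} (hk : a + b = k) (σ : Equiv.Perm (Fin k))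

theorem blocks_inl (s : Fin a) :
    blocks hk σ (Sum.inl s) = σ ⟨s, lt_of_lt_of_le s.2 (hk ▸ Nat.le_add_right a b)⟩ := by
  subst hk; rfl

theorem blocks_inr (t : Fin b) :
    blocks hk σ (Sum.inr t) = σ ⟨a + t, hk ▸ Nat.add_lt_add_left t.2 a⟩ := by
  subst hk; rfl

theorem blocks_inl_mem (s : Fin a) : blocks hk σ (Sum.inl s) ∈ firstBlock a σ := by
  simp [blocks_inl, firstBlock]

theorem blocks_inr_mem (t : Fin b) : blocks hk σ (Sum.inr t) ∈ (firstBlock a σ)ᶜ := by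
  simp [blocks_inr, firstBlock]

theorem mem_firstBlock_iff (i : Fin k) :
    i ∈ firstBlock a σ ↔ ∃ s, blocks hk σ (Sum.inl s) = i := by
  constructor
  · intro h
    refine ⟨⟨σ.symm i, by simpa [firstBlock] using h⟩, ?_⟩
    simp [blocks_inl]
  · rintro ⟨s, rfl⟩
    exact blocks_inl_mem hk σ s

theorem mem_compl_firstBlock_iff (i : Fin k) :
    i ∈ (firstBlock a σ)ᶜ ↔ ∃ t, blocks hk σ (Sum.inr t) = i := by
  constructor
  · intro h
    have h1 : a ≤ (σ.symm i : ℕ) := by simpa [firstBlock] using h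
    refine ⟨⟨(σ.symm i : ℕ) - a, by have := (σ.symm i).2; omega⟩, ?_⟩
    rw [blocks_inr]
    simp only [Nat.add_sub_of_le h1, Fin.eta, Equiv.apply_symm_apply]
  · rintro ⟨s, rfl⟩
    exact blocks_inr_mem hk σ s

theorem blocks_inl_strictMono {σ : Equiv.Perm (Fin k)} (hσ : IsUnshuffle a σ) :
    StrictMono (fun s => blocks hk σ (Sum.inl s)) := by
  intro s t hst
  simp only [blocks_inl]
  exact hσ _ _ hst (Or.inl t.2)

theorem blocks_inr_strictMono {σ : Equiv.Perm (Fin k)} (hσ : IsUnshuffle a σ) :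
    StrictMono (fun t => blocks hk σ (Sum.inr t)) := by
  intro s t hst
  simp only [blocks_inr]
  exact hσ _ _ (by simpa using hst) (Or.inr (by simp))

theorem card_firstBlock (hk : a + b = k) : (firstBlock a σ).card = a := by
  have h : firstBlock a σ = Finset.univ.image (fun s => blocks hk σ (Sum.inl s)) := by
    ext i; rw [mem_firstBlock_iff hk]; simp
  rw [h, Finset.card_image_of_injective _ (fun s t h => by simpa using h), Finset.card_univ,
    Fintype.card_fin]

theorem card_compl_firstBlock (hk : a + b = k) : (firstBlock a σ)ᶜ.card = b := by
  rw [Finset.card_compl, card_firstBlock σ hk, Fintype.card_fin]; omega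

/-- The increasing enumeration of a finite subset of `Fin k` is unique, so an unshuffle is
determined by the set of its first a values. -/
theorem blocks_eq_of_unshuffle {σ : Equiv.Perm (Fin k)} (hσ : IsUnshuffle a σ) :
    blocks hk σ = finSumEquivOfFinset (card_firstBlock σ hk) (card_compl_firstBlock σ hk) := by
  ext x : 1
  rcases x with s | t
  · rw [finSumEquivOfFinset_inl]
    exact congrFun (Finset.orderEmbOfFin_unique (card_firstBlock σ hk)
      (fun s => blocks_inl_mem hk σ s) (blocks_inl_strictMono hk hσ)) s
  · rw [finSumEquivOfFinset_inr]
    exact congrFun (Finset.orderEmbOfFin_unique (card_compl_firstBlock σ hk)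
      (fun s => blocks_inr_mem hk σ s) (blocks_inr_strictMono hk hσ)) t

theorem blocks_injective {σ τ : Equiv.Perm (Fin k)} (h : blocks hk σ = blocks hk τ) : σ = τ := by
  ext x : 1
  have := Equiv.congr_fun h ((finSumFinEquiv.trans (finCongr hk)).symm x)
  simpa [blocks] using this

/-- Conversely every a-element subset occurs as a first block: list it increasingly, then list its
complement increasingly. -/
theorem sum_unshuffles {E : Type*} [AddCommMonoid E] (ha : a ≤ k) (G : Finset (Fin k) → E) :
    ∑ σ ∈ unshuffles k a, G (firstBlock a σ) = ∑ J ∈ Finset.powersetCard a Finset.univ, G J := by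
  have hk : a + (k - a) = k := Nat.add_sub_of_le ha
  refine Finset.sum_nbij (firstBlock a) ?_ ?_ ?_ (fun _ _ => rfl)
  · intro σ _
    rw [Finset.mem_powersetCard]
    exact ⟨Finset.subset_univ _, card_firstBlock σ hk⟩
  · intro σ hσ τ hτ h
    have hσ' : IsUnshuffle a σ := by simpa [unshuffles] using hσ
    have hτ' : IsUnshuffle a τ := by simpa [unshuffles] using hτ
    apply blocks_injective hk
    rw [blocks_eq_of_unshuffle hk hσ', blocks_eq_of_unshuffle hk hτ']
    ext x : 1
    rcases x with s | t
    · simp only [finSumEquivOfFinset_inl, h]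
    · simp only [finSumEquivOfFinset_inr, h]
  · intro J hJ
    have hJ : J.card = a := by simpa using hJ
    have hJc : Jᶜ.card = k - a := by rw [Finset.card_compl, hJ, Fintype.card_fin]
    let σ : Equiv.Perm (Fin k) :=
      (finSumFinEquiv.trans (finCongr hk)).symm.trans (finSumEquivOfFinset hJ hJc)
    have hb : blocks hk σ = finSumEquivOfFinset hJ hJc := by
      ext x : 1
      simp [blocks, σ]
    refine ⟨σ, ?_, ?_⟩
    · simp only [unshuffles, Finset.coe_filter, Finset.mem_univ, true_and, Set.mem_ofPred_eq]
      intro s t hst h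
      rcases h with h | h
      · have h1 := blocks_inl hk σ ⟨s, lt_trans (Fin.lt_def.1 hst) h⟩
        have h2 := blocks_inl hk σ ⟨t, h⟩
        rw [hb, finSumEquivOfFinset_inl] at h1 h2
        simp only [Fin.eta] at h1 h2
        rw [← h1, ← h2]
        exact (J.orderEmbOfFin hJ).strictMono hst
      · have hs := s.2
        have ht := t.2
        have hst' := Fin.lt_def.1 hst
        have h1 := blocks_inr hk σ ⟨(s : ℕ) - a, by omega⟩
        have h2 := blocks_inr hk σ ⟨(t : ℕ) - a, by omega⟩
        rw [hb, finSumEquivOfFinset_inr] at h1 h2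
        simp only [Nat.add_sub_of_le h, Nat.add_sub_of_le (h.trans hst'.le), Fin.eta] at h1 h2
        rw [← h1, ← h2]
        refine (Jᶜ.orderEmbOfFin hJc).strictMono ?_
        rw [Fin.lt_def]
        simp only
        omega
    · ext i
      rw [mem_firstBlock_iff hk, hb]
      simp only [finSumEquivOfFinset_inl]
      have := Finset.range_orderEmbOfFin J hJ
      rw [← Set.mem_range, this]
      simp

/-- The sign of the permutation that moves the letters in `I` in front of the letters in `J`. -/
def crossSign {n : ℕ} (d : Fin n → ℤ) (I J : Finset (Fin n)) : ℤˣ :=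
  ∏ i ∈ I, ∏ j ∈ J, if j < i then -(d i * d j).negOnePow else 1

/-- An unshuffle is increasing on each block, so its inversions are exactly the pairs with one
letter in each block that appear in the wrong order. -/
theorem chi_of_unshuffle {σ : Equiv.Perm (Fin k)} (hσ : IsUnshuffle a σ) (hk : a + b = k)
    (d : Fin k → ℤ) : chi σ d = crossSign d (firstBlock a σ) (firstBlock a σ)ᶜ := by
  have h1 : firstBlock a σ = Finset.univ.map
      ⟨fun s => blocks hk σ (Sum.inl s), fun s t h => by simpa using h⟩ := by
    ext i; rw [mem_firstBlock_iff hk]; simp only [Finset.mem_map, Finset.mem_univ, true_and]; rfl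
  have h2 : (firstBlock a σ)ᶜ = Finset.univ.map
      ⟨fun s => blocks hk σ (Sum.inr s), fun s t h => by simpa using h⟩ := by
    ext i; rw [mem_compl_firstBlock_iff hk]; simp only [Finset.mem_map, Finset.mem_univ, true_and]; rfl
  rw [crossSign, h2, h1]
  simp only [Finset.prod_map, Function.Embedding.coeFn_mk]
  let e : Fin a ⊕ Fin b ≃ Fin k := finSumFinEquiv.trans (finCongr hk)
  have he : ∀ x, σ (e x) = blocks hk σ x := fun x => rfl
  have hll : ∀ s t : Fin a, ¬ (e (Sum.inl s) < e (Sum.inl t) ∧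
      blocks hk σ (Sum.inl t) < blocks hk σ (Sum.inl s)) := by
    rintro s t ⟨h3, h4⟩
    have h5 := (blocks_inl_strictMono hk hσ).lt_iff_lt.1 h4
    have : s < t := by
      simp only [e, Equiv.trans_apply, finSumFinEquiv_apply_left, finSumFinEquiv_apply_right,
        Fin.lt_def, finCongr_apply, Fin.val_cast, Fin.val_castAdd, Fin.val_natAdd] at h3
      exact Fin.lt_def.2 (by omega)
    exact absurd h5 this.not_gt
  have hrr : ∀ s t : Fin b, ¬ (e (Sum.inr s) < e (Sum.inr t) ∧
      blocks hk σ (Sum.inr t) < blocks hk σ (Sum.inr s)) := by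
    rintro s t ⟨h3, h4⟩
    have h5 := (blocks_inr_strictMono hk hσ).lt_iff_lt.1 h4
    have : s < t := by
      simp only [e, Equiv.trans_apply, finSumFinEquiv_apply_left, finSumFinEquiv_apply_right,
        Fin.lt_def, finCongr_apply, Fin.val_cast, Fin.val_castAdd, Fin.val_natAdd] at h3
      exact Fin.lt_def.2 (by omega)
    exact absurd h5 this.not_gt
  have hlr : ∀ (s : Fin a) (t : Fin b), e (Sum.inl s) < e (Sum.inr t) := by
    intro s t
    have := s.2
    simp only [e, Equiv.trans_apply, finSumFinEquiv_apply_left, finSumFinEquiv_apply_right,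
      Fin.lt_def, finCongr_apply, Fin.val_cast, Fin.val_castAdd, Fin.val_natAdd]
    omega
  have hrl : ∀ (s : Fin b) (t : Fin a), ¬ (e (Sum.inr s) < e (Sum.inl t) ∧
      blocks hk σ (Sum.inl t) < blocks hk σ (Sum.inr s)) :=
    fun s t h => absurd h.1 (hlr t s).not_gt
  rw [chi, ← e.prod_comp]
  simp only [← e.prod_comp (fun b => if _ ∧ _ then _ else _), he, Fintype.prod_sum_type, hll, hrr, hrl, hlr, true_and,
    if_false, Finset.prod_const_one, mul_one, one_mul]
  rfl

/-- Turns the double sums in `phi` and in the L∞-relations into one sum over all subsets.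
Cardinalities outside the prescribed range are harmless provided that the corresponding terms
vanish. -/
theorem sum_unshuffles_attach {E : Type*} [AddCommMonoid E] {k : ℕ} (S : Finset ℕ)
    (hS : S ⊆ Finset.range (k + 1)) (F : S → Equiv.Perm (Fin k) → E)
    (G : Finset (Fin k) → E)
    (hF : ∀ l (σ : Equiv.Perm (Fin k)), IsUnshuffle l.1 σ → F l σ = G (firstBlock l.1 σ))
    (hG : ∀ J, J.card ∉ S → G J = 0) :
    ∑ l ∈ S.attach, ∑ σ ∈ unshuffles k l.1, F l σ = ∑ J, G J := by
  have h1 : ∀ l ∈ S.attach, ∑ σ ∈ unshuffles k l.1, F l σ =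
      ∑ J ∈ Finset.powersetCard l.1 Finset.univ, G J := by
    intro l _
    rw [← sum_unshuffles (Nat.lt_succ_iff.1 (Finset.mem_range.1 (hS l.2)))]
    refine Finset.sum_congr rfl fun σ hσ => hF l σ ?_
    simpa [unshuffles] using hσ
  rw [Finset.sum_congr rfl h1, Finset.sum_attach S
    (fun l => ∑ J ∈ Finset.powersetCard l Finset.univ, G J), ← Finset.powerset_univ,
    Finset.sum_powerset, Finset.card_univ, Fintype.card_fin]
  refine Finset.sum_subset hS fun l _ hl => Finset.sum_eq_zero fun J hJ => hG J ?_
  rwa [(Finset.mem_powersetCard.1 hJ).2]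

end Unshuffles

/-! ### The transfer formulas on subsets of the arguments -/

section TransferOnSubsets

variable {𝕜 V W : Type*} [Field 𝕜] [AddCommGroup V] [Module 𝕜 V] [AddCommGroup W] [Module 𝕜 W]
  (br : V →ₗ[𝕜] V →ₗ[𝕜] V) (j : W →ₗ[𝕜] V) (h : V →ₗ[𝕜] V) {n : ℕ} (d : Fin n → ℤ) (x : Fin n → W)

/-- `ψ` evaluated on the arguments indexed by `I`. -/
def psiOn (I : Finset (Fin n)) : V :=
  psi br j h I.card (fun s => d (I.orderEmbOfFin rfl s)) (fun s => x (I.orderEmbOfFin rfl s))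

/-- `φ` evaluated on the arguments indexed by `I`. -/
def phiOn (I : Finset (Fin n)) : V :=
  phi br j h I.card (fun s => d (I.orderEmbOfFin rfl s)) (fun s => x (I.orderEmbOfFin rfl s))

/-- The family of arguments, as a function on subsets supported on singletons. -/
def argOn (I : Finset (Fin n)) : W := ∑ i, if I = {i} then x i else 0

variable {br j h d x}

/-- By uniqueness of increasing enumerations, the value on increasingly listed arguments depends
only on the set of their indices. This lets nested recursive calls be read as values at subsets of
one fixed family. -/
theorem psi_strictMono {m : ℕ} {f : Fin m → Fin n} (hf : StrictMono f) {I : Finset (Fin n)}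
    (hI : ∀ i, i ∈ I ↔ ∃ s, f s = i) :
    psi br j h m (fun s => d (f s)) (fun s => x (f s)) = psiOn br j h d x I := by
  have hc : I.card = m := by
    have : I = Finset.univ.map ⟨f, hf.injective⟩ := by
      ext i; rw [hI]; simp only [Finset.mem_map, Finset.mem_univ, true_and]; rfl
    rw [this, Finset.card_map, Finset.card_univ, Fintype.card_fin]
  subst hc
  rw [Finset.orderEmbOfFin_unique rfl (fun s => (hI _).2 ⟨s, rfl⟩) hf, psiOn]

theorem phi_strictMono {m : ℕ} {f : Fin m → Fin n} (hf : StrictMono f) {I : Finset (Fin n)}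
    (hI : ∀ i, i ∈ I ↔ ∃ s, f s = i) :
    phi br j h m (fun s => d (f s)) (fun s => x (f s)) = phiOn br j h d x I := by
  have hc : I.card = m := by
    have : I = Finset.univ.map ⟨f, hf.injective⟩ := by
      ext i; rw [hI]; simp only [Finset.mem_map, Finset.mem_univ, true_and]; rfl
    rw [this, Finset.card_map, Finset.card_univ, Fintype.card_fin]
  subst hc
  rw [Finset.orderEmbOfFin_unique rfl (fun s => (hI _).2 ⟨s, rfl⟩) hf, phiOn]

theorem phi_eq_phiOn_univ : phi br j h n d x = phiOn br j h d x Finset.univ :=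
  phi_strictMono (f := id) strictMono_id (by simp)

theorem psiOn_map {m : ℕ} (f : Fin m ↪o Fin n) (I : Finset (Fin m)) :
    psiOn br j h (fun s => d (f s)) (fun s => x (f s)) I =
      psiOn br j h d x (I.map f.toEmbedding) := by
  refine psi_strictMono (f := fun s => f (I.orderEmbOfFin rfl s))
    (f.strictMono.comp (I.orderEmbOfFin rfl).strictMono) fun i => ?_
  have h1 : ∀ a, a ∈ I ↔ ∃ s, I.orderEmbOfFin rfl s = a := fun a => by
    rw [← Set.mem_range, Finset.range_orderEmbOfFin, Finset.mem_coe]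
  simp [h1]

theorem psiOn_empty : psiOn br j h d x ∅ = 0 := by
  rw [← psi_strictMono (f := (Fin.elim0 : Fin 0 → Fin n)) (fun s => s.elim0)
    (fun i => by simp), psi]
  rfl

/-- The sign in front of `[ψ(x_I), ψ(x_J)]` in `φ`. -/
def splitSign (d : Fin n → ℤ) (I J : Finset (Fin n)) : ℤˣ :=
  ((I.card : ℤ) - 1 + ((J.card : ℤ) - 1) * ∑ i ∈ I, d i).negOnePow * crossSign d I J

theorem splitSign_map {m : ℕ} (f : Fin m ↪o Fin n) (I J : Finset (Fin m)) :
    splitSign (fun s => d (f s)) I J =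
      splitSign d (I.map f.toEmbedding) (J.map f.toEmbedding) := by
  simp [splitSign, crossSign]

/-- The two blocks of an unshuffle run increasingly through a subset and its complement, so both
recursive values are values of `psiOn`. -/
theorem phi_eq_sum2 : phi br j h n d x = sum2 Finset.univ (fun I J =>
    splitSign d I J • br (psiOn br j h d x I) (psiOn br j h d x J)) := by
  rw [phi, sum_apply, sum2, Finset.powerset_univ]
  simp only [sum_apply]
  refine sum_unshuffles_attach _ ?_ _ (fun J => splitSign d J (Finset.univ \ J) •
    br (psiOn br j h d x J) (psiOn br j h d x (Finset.univ \ J))) ?_ ?_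
  · intro l hl
    simp only [Finset.mem_Ioo, Finset.mem_range] at hl ⊢
    omega
  · intro l σ hσ
    have hl := Finset.mem_Ioo.1 l.2
    have hk := Nat.add_sub_of_le hl.2.le
    have h1 := psi_strictMono (br := br) (j := j) (h := h) (d := d) (x := x)
      (blocks_inl_strictMono hk hσ) (mem_firstBlock_iff hk σ)
    have h2 := psi_strictMono (br := br) (j := j) (h := h) (d := d) (x := x)
      (blocks_inr_strictMono hk hσ) (mem_compl_firstBlock_iff hk σ)
    have h3 : ∑ s, d (blocks hk σ (Sum.inl s)) = ∑ i ∈ firstBlock l.1 σ, d i := by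
      have : firstBlock l.1 σ = Finset.univ.map
          ⟨fun s => blocks hk σ (Sum.inl s), fun s t h => by simpa using h⟩ := by
        ext i
        rw [mem_firstBlock_iff hk]
        simp only [Finset.mem_map, Finset.mem_univ, true_and]
        rfl
      rw [this, Finset.sum_map]
      rfl
    rw [smul_apply, smul_apply, blockProduct_apply, h1, h2, h3,
      ← Finset.compl_eq_univ_sdiff, chi_of_unshuffle hσ hk, splitSign, mul_smul,
      card_firstBlock σ hk, card_compl_firstBlock σ hk]
  -- The definition requires both blocks to be nonempty; since ψ_0 = 0, the two trivial
  -- decompositions may be included.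
  · intro J hJ
    have : J = ∅ ∨ J = Finset.univ := by
      by_contra! h
      refine hJ (Finset.mem_Ioo.2 ⟨Finset.card_pos.2 h.1, ?_⟩)
      refine lt_of_le_of_ne ((Finset.card_le_univ J).trans (by simp)) fun h' => h.2 ?_
      rw [← Finset.card_eq_iff_eq_univ, h', Fintype.card_fin]
    rcases this with rfl | rfl
    · rw [psiOn_empty, map_zero, LinearMap.zero_apply, smul_zero]
    · rw [Finset.sdiff_self, psiOn_empty, map_zero, smul_zero]

theorem phiOn_eq (I : Finset (Fin n)) : phiOn br j h d x I = sum2 I (fun J K =>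
    splitSign d J K • br (psiOn br j h d x J) (psiOn br j h d x K)) := by
  have h1 : I = Finset.univ.map (I.orderEmbOfFin rfl).toEmbedding := by simp
  conv_rhs => rw [h1, sum2_map]
  rw [phiOn, phi_eq_sum2]
  refine sum2_congr fun J K _ _ => ?_
  rw [splitSign_map, psiOn_map, psiOn_map]

theorem phiOn_of_card_le_one {I : Finset (Fin n)} (hI : I.card ≤ 1) :
    phiOn br j h d x I = 0 := by
  rw [phiOn_eq]
  refine Finset.sum_eq_zero fun J hJ => ?_
  beta_reduce
  by_cases h1 : J = ∅
  · rw [h1, psiOn_empty, map_zero, LinearMap.zero_apply, smul_zero]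
  · rw [Finset.eq_of_subset_of_card_le (Finset.mem_powerset.1 hJ)
      (hI.trans (Finset.card_pos.2 (Finset.nonempty_iff_ne_empty.2 h1))), Finset.sdiff_self,
      psiOn_empty, map_zero, smul_zero]

theorem argOn_singleton (i : Fin n) : argOn x {i} = x i := by
  rw [argOn, Finset.sum_eq_single i]
  · simp
  · intro b _ hb
    rw [if_neg]
    simpa using hb.symm
  · simp

theorem argOn_of_card_ne_one {I : Finset (Fin n)} (hI : I.card ≠ 1) : argOn x I = 0 :=
  Finset.sum_eq_zero fun i _ => if_neg fun h => hI (by rw [h, Finset.card_singleton])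

/-- The two clauses defining ψ merge into one formula: `argOn` vanishes away from singletons, and φ
vanishes on subsets with at most one element. -/
theorem psiOn_eq (I : Finset (Fin n)) :
    psiOn br j h d x I = -j (argOn x I) + h (phiOn br j h d x I) := by
  by_cases h1 : I.card = 1
  · obtain ⟨i, rfl⟩ := Finset.card_eq_one.1 h1
    rw [phiOn_of_card_le_one h1.le, map_zero, add_zero, argOn_singleton,
      ← psi_strictMono (f := fun _ : Fin 1 => i) (Subsingleton.strictMono _) (by simp [eq_comm]),
      psi_one_apply]
  · rw [argOn_of_card_ne_one h1, map_zero, neg_zero, zero_add]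
    obtain h2 | ⟨k, hk⟩ : I.card = 0 ∨ ∃ k, I.card = k + 2 := by
      rcases hc : I.card with _ | _ | k
      · exact Or.inl rfl
      · exact absurd hc h1
      · exact Or.inr ⟨k, rfl⟩
    · rw [phiOn_of_card_le_one (by omega), map_zero, Finset.card_eq_zero.1 h2, psiOn_empty]
    · have hI : ∀ i, i ∈ I ↔ ∃ s, I.orderEmbOfFin hk s = i := fun a => by
        rw [← Set.mem_range, Finset.range_orderEmbOfFin, Finset.mem_coe]
      rw [← psi_strictMono (I.orderEmbOfFin hk).strictMono hI,
        ← phi_strictMono (I.orderEmbOfFin hk).strictMono hI, psi_add_two]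
      rfl

/-- The sign of the rearrangement by `σ` of the letters in `I`. -/
def invSign (σ : Equiv.Perm (Fin n)) (d : Fin n → ℤ) (I : Finset (Fin n)) : ℤˣ :=
  ∏ a ∈ I, ∏ b ∈ I, if a < b ∧ σ b < σ a then -(d (σ a) * d (σ b)).negOnePow else 1

theorem invSign_of_card_le_one (σ : Equiv.Perm (Fin n)) (d : Fin n → ℤ) {I : Finset (Fin n)}
    (hI : I.card ≤ 1) : invSign σ d I = 1 :=
  Finset.prod_eq_one fun a ha => Finset.prod_eq_one fun b hb => by
    rw [Finset.card_le_one.1 hI a ha b hb, if_neg (fun h => lt_irrefl _ h.1)]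

/-- Pairs inside I and inside J give the two internal signs. For a mixed pair, whether it is
inverted by σ is exactly the difference between its contributions to the two cross signs, before and
after relabelling. -/
theorem invSign_union (σ : Equiv.Perm (Fin n)) (d : Fin n → ℤ) {I J : Finset (Fin n)}
    (hIJ : Disjoint I J) :
    crossSign (fun s => d (σ s)) I J * (invSign σ d I * invSign σ d J) =
      invSign σ d (I ∪ J) * crossSign d (I.map σ.toEmbedding) (J.map σ.toEmbedding) := by
  have h1 : (∏ a ∈ I, ∏ b ∈ J, if a < b ∧ σ b < σ a then -(d (σ a) * d (σ b)).negOnePow else 1) *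
      (∏ a ∈ J, ∏ b ∈ I, if a < b ∧ σ b < σ a then -(d (σ a) * d (σ b)).negOnePow else 1) *
      crossSign d (I.map σ.toEmbedding) (J.map σ.toEmbedding) =
      crossSign (fun s => d (σ s)) I J := by
    rw [Finset.prod_comm (s := J)]
    simp only [crossSign, Finset.prod_map, Equiv.coe_toEmbedding, ← Finset.prod_mul_distrib]
    refine Finset.prod_congr rfl fun a ha => Finset.prod_congr rfl fun b hb => ?_
    have hab : a ≠ b := fun h => Finset.disjoint_left.1 hIJ ha (h ▸ hb)
    have hab' : σ a ≠ σ b := fun h => hab (σ.injective h)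
    rw [mul_comm (d (σ b)) (d (σ a))]
    rcases lt_or_gt_of_ne hab with h | h <;> rcases lt_or_gt_of_ne hab' with h' | h' <;>
      simp [h, h', h.not_gt, h'.not_gt]
  rw [← h1]
  simp only [invSign, Finset.prod_union hIJ, Finset.prod_mul_distrib]
  ac_rfl

theorem argOn_perm (σ : Equiv.Perm (Fin n)) (x : Fin n → W) (I : Finset (Fin n)) :
    argOn (fun s => x (σ s)) I = argOn x (I.map σ.toEmbedding) := by
  rw [argOn, argOn, ← Equiv.sum_comp σ (fun i => if I.map σ.toEmbedding = {i} then x i else 0)]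
  refine Finset.sum_congr rfl fun i _ => ?_
  congr 1
  rw [← Equiv.coe_toEmbedding, ← Finset.map_singleton, Finset.map_inj]

/-- The sum over all decompositions is stable under relabelling by σ, so only the signs must be
compared, and these obey the cocycle identity `invSign_union`. The induction runs over ψ and φ
together, as each is defined through the other. -/
theorem psiOn_phiOn_perm (σ : Equiv.Perm (Fin n)) (I : Finset (Fin n)) :
    psiOn br j h (fun s => d (σ s)) (fun s => x (σ s)) I =
        invSign σ d I • psiOn br j h d x (I.map σ.toEmbedding) ∧
      phiOn br j h (fun s => d (σ s)) (fun s => x (σ s)) I =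
        invSign σ d I • phiOn br j h d x (I.map σ.toEmbedding) := by
  induction I using Finset.strongInduction with
  | H I ih =>
    have key : phiOn br j h (fun s => d (σ s)) (fun s => x (σ s)) I =
        invSign σ d I • phiOn br j h d x (I.map σ.toEmbedding) := by
      rcases Nat.lt_or_ge 1 I.card with hc | hc
      · rw [phiOn_eq, phiOn_eq, sum2_map, smul_sum2]
        refine sum2_congr fun J K hJK hI => ?_
        -- Terms with an empty block vanish; otherwise both blocks are proper subsets and the
        -- induction hypothesis applies.
        by_cases hJ : J = ∅
        · simp [hJ, psiOn_empty]
        by_cases hK : K = ∅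
        · simp [hK, psiOn_empty]
        have h1 : J ⊂ I := by
          rw [← hI]
          refine Finset.subset_union_left.ssubset_of_ne fun h => hK ?_
          exact Finset.disjoint_self_iff_empty _ |>.1 (hJK.mono_left (h ▸ Finset.subset_union_right))
        have h2 : K ⊂ I := by
          rw [← hI]
          refine Finset.subset_union_right.ssubset_of_ne fun h => hJ ?_
          exact Finset.disjoint_self_iff_empty _ |>.1 (hJK.mono_right (h ▸ Finset.subset_union_left))
        rw [(ih J h1).1, (ih K h2).1]
        simp only [map_sign_smul, LinearMap.smul_apply, LinearMap.map_smul_of_tower, smul_smul]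
        congr 1
        have := invSign_union σ d hJK
        rw [hI] at this
        simp only [splitSign, Finset.card_map, Finset.sum_map, Equiv.coe_toEmbedding] at this ⊢
        rw [mul_left_comm (invSign σ d I), ← this, mul_assoc]
      · rw [phiOn_of_card_le_one hc, phiOn_of_card_le_one (by simpa using hc), smul_zero]
    refine ⟨?_, key⟩
    rw [psiOn_eq, psiOn_eq, key, argOn_perm, map_sign_smul, smul_add]
    congr 1
    by_cases hc : I.card = 1
    · rw [invSign_of_card_le_one σ d hc.le, one_smul]
    · rw [argOn_of_card_ne_one (by simpa using hc)]
      simp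

/-- `φ` is graded skew-symmetric. -/
theorem phi_perm (σ : Equiv.Perm (Fin n)) :
    phi br j h n (fun s => d (σ s)) (fun s => x (σ s)) = chi σ d • phi br j h n d x := by
  rw [phi_eq_phiOn_univ, phi_eq_phiOn_univ, (psiOn_phiOn_perm σ _).2, Finset.map_univ_equiv]
  rfl

end TransferOnSubsets

end

end StrongHomotopy

namespace StrongHomotopy

noncomputable section

/-! ### Décalage signs -/

section Decalage

variable {n : ℕ} (d : Fin n → ℤ)

/-- The exponent of the décalage sign of the arguments indexed by `I`. -/
def theta (I : Finset (Fin n)) : ℤ := ∑ i ∈ I, ∑ j ∈ I, if i < j then d i else 0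

/-- The exponent of `crossSign`. -/
def cross (I J : Finset (Fin n)) : ℤ := ∑ i ∈ I, ∑ j ∈ J, if j < i then d i * d j + 1 else 0

theorem crossSign_eq (I J : Finset (Fin n)) : crossSign d I J = (cross d I J).negOnePow := by
  have hsum : ∀ (S : Finset (Fin n)) (g : Fin n → ℤ),
      (∑ i ∈ S, g i).negOnePow = ∏ i ∈ S, (g i).negOnePow := by
    intro S g
    induction S using Finset.induction_on with
    | empty => simp
    | insert a S ha ih => rw [Finset.sum_insert ha, Finset.prod_insert ha, Int.negOnePow_add, ih]
  rw [crossSign, cross, hsum]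
  refine Finset.prod_congr rfl fun i _ => ?_
  rw [hsum]
  refine Finset.prod_congr rfl fun j _ => ?_
  split_ifs
  · rw [Int.negOnePow_succ]
  · rfl

theorem eps_eq (I : Finset (Fin n)) : eps d I = I.card - ∑ i ∈ I, d i := by
  simp [eps]

theorem theta_of_card_le_one {I : Finset (Fin n)} (hI : I.card ≤ 1) : theta d I = 0 :=
  Finset.sum_eq_zero fun a ha => Finset.sum_eq_zero fun b hb => by
    rw [Finset.card_le_one.1 hI a ha b hb, if_neg (lt_irrefl _)]

/-- Modulo 2, the exponent of the unshuffle sign differs from the reordering exponent `gam` by the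
coboundary of `theta` and a term linear in the degrees. Thus rescaling by `theta` trades the signs
of the exterior algebra for those of the parameter algebra. -/
theorem cross_cast {I J : Finset (Fin n)} (hIJ : Disjoint I J) :
    (cross d I J : ZMod 2) = gam d J I + J.card * ∑ i ∈ I, (d i : ZMod 2) + theta d (I ∪ J) +
      theta d I + theta d J := by
  have h1 : theta d (I ∪ J) = theta d I + theta d J + ∑ i ∈ I, ∑ j ∈ J,
      ((if i < j then d i else 0) + if j < i then d j else 0) := by
    simp only [theta, Finset.sum_union hIJ, Finset.sum_add_distrib]
    rw [Finset.sum_comm (s := J) (t := I)]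
    ring
  have h2 : (J.card : ZMod 2) * ∑ i ∈ I, (d i : ZMod 2) = ∑ i ∈ I, ∑ j ∈ J, (d i : ZMod 2) := by
    rw [Finset.mul_sum]
    refine Finset.sum_congr rfl fun i _ => ?_
    rw [Finset.sum_const, nsmul_eq_mul]
  have h3 : (cross d I J : ZMod 2) = gam d J I + (J.card * ∑ i ∈ I, (d i : ZMod 2)) +
      ((∑ i ∈ I, ∑ j ∈ J, ((if i < j then d i else 0) + if j < i then d j else 0) : ℤ) : ZMod 2) := by
    rw [h2, cross, gam, Finset.sum_comm (s := J)]
    push_cast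
    rw [← Finset.sum_add_distrib, ← Finset.sum_add_distrib]
    refine Finset.sum_congr rfl fun i hi => ?_
    rw [← Finset.sum_add_distrib, ← Finset.sum_add_distrib]
    refine Finset.sum_congr rfl fun j hj => ?_
    have hij : i ≠ j := fun h => Finset.disjoint_left.1 hIJ hi (h ▸ hj)
    rcases lt_or_gt_of_ne hij with h | h
    · simp only [h, h.not_gt, if_true, if_false]
      push_cast
      grind
    · simp only [h, h.not_gt, if_true, if_false]
      push_cast
      grind
  rw [h3, h1]
  push_cast
  grind

variable {d}

theorem sum2_insert {ι E : Type*} [DecidableEq ι] [AddCommMonoid E] {a : ι} {L : Finset ι}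
    (ha : a ∉ L) (F : Finset ι → Finset ι → E) :
    sum2 (insert a L) F =
      sum2 L (fun I J => F I (insert a J)) + sum2 L (fun I J => F (insert a I) J) := by
  rw [sum2, Finset.sum_powerset_insert ha]
  congr 1
  · refine Finset.sum_congr rfl fun I hI => ?_
    rw [Finset.insert_sdiff_of_notMem _ (fun h => ha (Finset.mem_powerset.1 hI h))]
  · refine Finset.sum_congr rfl fun I hI => ?_
    rw [Finset.insert_sdiff_insert, Finset.sdiff_insert_of_notMem ha]

/-- The subset `{0} ∪ (I + 1)`. -/
def consSet (I : Finset (Fin n)) : Finset (Fin (n + 1)) := insert 0 (I.map (Fin.succEmb n))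

theorem zero_notMem_map_succ (I : Finset (Fin n)) : (0 : Fin (n + 1)) ∉ I.map (Fin.succEmb n) := by
  simp [Fin.succ_ne_zero]

variable (m : ℤ)

theorem eps_cons (I : Finset (Fin n)) :
    eps (Fin.cons m d : Fin (n + 1) → ℤ) (consSet I) = 1 - m + eps d I := by
  rw [consSet, eps, Finset.sum_insert (zero_notMem_map_succ I)]
  simp [eps]

theorem eps_map_succ (I : Finset (Fin n)) :
    eps (Fin.cons m d : Fin (n + 1) → ℤ) (I.map (Fin.succEmb n)) = eps d I := by
  simp [eps]

/-- The added index 0 precedes all others, so it contributes to the reordering sign only when it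
lies in the left block. -/
theorem gam_cons_left (I J : Finset (Fin n)) :
    gam (Fin.cons m d : Fin (n + 1) → ℤ) (consSet I) (J.map (Fin.succEmb n)) =
      (1 - m) * eps d J + gam d I J := by
  rw [consSet, gam, Finset.sum_insert (zero_notMem_map_succ I)]
  simp [gam, eps, Finset.mul_sum, -Finset.sum_sub_distrib]

theorem gam_cons_right (I J : Finset (Fin n)) :
    gam (Fin.cons m d : Fin (n + 1) → ℤ) (I.map (Fin.succEmb n)) (consSet J) = gam d I J := by
  rw [consSet, gam]
  simp [Finset.sum_insert (zero_notMem_map_succ J), gam]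

theorem theta_map_succ (I : Finset (Fin n)) :
    theta (Fin.cons m d : Fin (n + 1) → ℤ) (I.map (Fin.succEmb n)) = theta d I := by
  simp [theta]

theorem theta_cons (I : Finset (Fin n)) :
    theta (Fin.cons m d : Fin (n + 1) → ℤ) (consSet I) = I.card * m + theta d I := by
  rw [consSet, theta]
  simp [Finset.sum_insert (zero_notMem_map_succ I), theta]

end Decalage

/-! ### Transferred structures -/

section TransferStructure

variable {𝕜 V W : Type*} [Field 𝕜] [AddCommGroup V] [Module 𝕜 V] [AddCommGroup W] [Module 𝕜 W]

/-- `(V, δ, [·,·])` is a DG Lie algebra, as far as the bracket is concerned. -/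
structure IsDGLie (𝒱 : ℤ → Submodule 𝕜 V) (δ : V →ₗ[𝕜] V) (br : V →ₗ[𝕜] V →ₗ[𝕜] V) : Prop where
  mem : IsBigraded 𝒱 𝒱 𝒱 br
  skew : ∀ i j v w, v ∈ 𝒱 i → w ∈ 𝒱 j → br v w = -((i * j).negOnePow • br w v)
  jacobi : ∀ i j v w u, v ∈ 𝒱 i → w ∈ 𝒱 j →
    br v (br w u) = br (br v w) u + (i * j).negOnePow • br w (br v u)
  deriv : ∀ i v w, v ∈ 𝒱 i → δ (br v w) = br (δ v) w + i.negOnePow • br v (δ w)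

variable {𝒱 : ℤ → Submodule 𝕜 V} [DirectSum.Decomposition 𝒱]
  {𝒲 : ℤ → Submodule 𝕜 W} [DirectSum.Decomposition 𝒲]
  {δ : V →ₗ[𝕜] V} {d' : W →ₗ[𝕜] W} {br : V →ₗ[𝕜] V →ₗ[𝕜] V}
  {p : V →ₗ[𝕜] W} {j : W →ₗ[𝕜] V} {h : V →ₗ[𝕜] V} {n : ℕ} {d : Fin n → ℤ} {x : Fin n → W}

/-- `ψ` with the décalage sign. -/
def bigPsi (br : V →ₗ[𝕜] V →ₗ[𝕜] V) (j : W →ₗ[𝕜] V) (h : V →ₗ[𝕜] V) (d : Fin n → ℤ)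
    (x : Fin n → W) (I : Finset (Fin n)) : V := (theta d I).negOnePow • psiOn br j h d x I

/-- `φ` with the décalage sign. -/
def bigPhi (br : V →ₗ[𝕜] V →ₗ[𝕜] V) (j : W →ₗ[𝕜] V) (h : V →ₗ[𝕜] V) (d : Fin n → ℤ)
    (x : Fin n → W) (I : Finset (Fin n)) : V := (theta d I).negOnePow • phiOn br j h d x I

theorem isTotal_argOn (hx : ∀ s, x s ∈ 𝒲 (d s)) : IsTotal d 𝒲 1 (argOn x) := by
  intro I
  by_cases h1 : I.card = 1
  · obtain ⟨i, rfl⟩ := Finset.card_eq_one.1 h1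
    rw [argOn_singleton]
    simpa [eps] using hx i
  · rw [argOn_of_card_ne_one h1]
    exact zero_mem _

theorem theta_smul_argOn (I : Finset (Fin n)) :
    (theta d I).negOnePow • argOn x I = argOn x I := by
  by_cases h1 : I.card = 1
  · rw [theta_of_card_le_one d h1.le, Int.negOnePow_zero, one_smul]
  · rw [argOn_of_card_ne_one h1, smul_zero]

theorem bigPsi_eq :
    bigPsi br j h d x = -comp j (argOn x) + comp h (bigPhi br j h d x) := by
  ext I
  rw [bigPsi, psiOn_eq, smul_add, smul_neg, ← map_sign_smul, ← map_sign_smul, theta_smul_argOn]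
  rfl

/-- In terms of total degrees, ψ has degree 1 and φ has degree 2, whatever the number of arguments:
the argument part has total degree 1, the bracket adds degrees and h lowers them by 1. -/
theorem psiOn_mem (hbr : IsBigraded 𝒱 𝒱 𝒱 br) (hj : ∀ i w, w ∈ 𝒲 i → j w ∈ 𝒱 i)
    (hh : ∀ i v, v ∈ 𝒱 i → h v ∈ 𝒱 (i - 1)) (hx : ∀ s, x s ∈ 𝒲 (d s)) (I : Finset (Fin n)) :
    psiOn br j h d x I ∈ 𝒱 (1 - eps d I) ∧ phiOn br j h d x I ∈ 𝒱 (2 - eps d I) := by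
  induction I using Finset.strongInduction with
  | H I ih =>
    have key : phiOn br j h d x I ∈ 𝒱 (2 - eps d I) := by
      rw [phiOn_eq]
      refine sum2_mem _ fun J K hJK hI => ?_
      by_cases hJ : J = ∅
      · simp [hJ, psiOn_empty]
      by_cases hK : K = ∅
      · simp [hK, psiOn_empty]
      have h1 : J ⊂ I := by
        rw [← hI]
        refine Finset.subset_union_left.ssubset_of_ne fun h => hK ?_
        exact Finset.disjoint_self_iff_empty _ |>.1 (hJK.mono_left (h ▸ Finset.subset_union_right))
      have h2 : K ⊂ I := by
        rw [← hI]
        refine Finset.subset_union_right.ssubset_of_ne fun h => hJ ?_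
        exact Finset.disjoint_self_iff_empty _ |>.1 (hJK.mono_right (h ▸ Finset.subset_union_left))
      have := hbr _ _ _ _ (ih J h1).1 (ih K h2).1
      rw [show 1 - eps d J + (1 - eps d K) = 2 - eps d I by rw [← hI, eps_union d hJK]; ring] at this
      exact sign_smul_mem _ _ this
    refine ⟨?_, key⟩
    rw [psiOn_eq]
    refine add_mem (neg_mem (hj _ _ (isTotal_argOn hx I))) ?_
    have := hh _ _ key
    rwa [show 2 - eps d I - 1 = 1 - eps d I by ring] at this

theorem isTotal_bigPsi (hbr : IsBigraded 𝒱 𝒱 𝒱 br) (hj : ∀ i w, w ∈ 𝒲 i → j w ∈ 𝒱 i)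
    (hh : ∀ i v, v ∈ 𝒱 i → h v ∈ 𝒱 (i - 1)) (hx : ∀ s, x s ∈ 𝒲 (d s)) :
    IsTotal d 𝒱 1 (bigPsi br j h d x) :=
  fun I => sign_smul_mem _ _ (psiOn_mem hbr hj hh hx I).1

/-- The décalage sign absorbs both (-1)^b and χ, leaving the quadratic equation Φ = -[Ψ,Ψ] with
plain Koszul signs. The sign comparison is `cross_cast` together with the graded commutativity of
the parameters. -/
theorem bigPhi_eq (hbr : IsBigraded 𝒱 𝒱 𝒱 br) (hj : ∀ i w, w ∈ 𝒲 i → j w ∈ 𝒱 i)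
    (hh : ∀ i v, v ∈ 𝒱 i → h v ∈ 𝒱 (i - 1)) (hx : ∀ s, x s ∈ 𝒲 (d s)) :
    bigPhi br j h d x = -conv d 𝒱 br (bigPsi br j h d x) (bigPsi br j h d x) := by
  ext L
  have hneg : ∀ v : V, -v = (-1 : ℤˣ) • v := fun v => by simp
  rw [bigPhi, phiOn_eq, Pi.neg_apply, conv_apply, smul_sum2, hneg, smul_sum2]
  refine sum2_congr fun I J hIJ hL => ?_
  rw [signTwist_of_mem _ _ (isTotal_bigPsi hbr hj hh hx J), bigPsi, bigPsi, splitSign, crossSign_eq]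
  simp only [map_sign_smul, LinearMap.smul_apply, smul_smul, ← Int.negOnePow_add, neg_mul, one_mul,
    ← Int.negOnePow_succ]
  congr 1
  apply negOnePow_congr
  have h1 := cross_cast d hIJ
  have h2 := gam_comm_cast d hIJ
  rw [hL] at h1
  rw [eps_eq d I] at h2 ⊢
  push_cast at h2 ⊢
  grind

@[simp] theorem bigPsi_empty : bigPsi br j h d x ∅ = 0 := by
  rw [bigPsi, psiOn_empty, smul_zero]

/-- Uniqueness of the solution of the linearised equation for `ψ`. -/
theorem linear_unique {Ψ : Finset (Fin n) → V} (hΨ : Ψ ∅ = 0) {C X X' : Finset (Fin n) → V}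
    (hX : X = C - (2 : ℤ) • comp h (conv d 𝒱 br Ψ X))
    (hX' : X' = C - (2 : ℤ) • comp h (conv d 𝒱 br Ψ X')) : X = X' := by
  ext L
  induction L using Finset.strongInduction with
  | H L ih =>
    -- As Ψ vanishes at the empty set, the bracket at L involves X only on proper subsets of L.
    have : conv d 𝒱 br Ψ X L = conv d 𝒱 br Ψ X' L := by
      rw [conv_apply, conv_apply]
      refine sum2_congr fun I J hIJ hL => ?_
      by_cases hI : I = ∅
      · simp [hI, hΨ]
      · rw [ih J]
        rw [← hL]
        refine Finset.subset_union_right.ssubset_of_ne fun h => hI ?_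
        exact Finset.disjoint_self_iff_empty _ |>.1 (hIJ.mono_right (h ▸ Finset.subset_union_left))
    rw [hX, hX']
    simp only [Pi.sub_apply, Pi.smul_apply, comp_apply, this]

/-- The linearisation of `ψ` in the direction of an additional argument `y` of degree `m`. -/
def linPsi (br : V →ₗ[𝕜] V →ₗ[𝕜] V) (j : W →ₗ[𝕜] V) (h : V →ₗ[𝕜] V) (d : Fin n → ℤ)
    (x : Fin n → W) (m : ℤ) (y : W) (I : Finset (Fin n)) : V :=
  bigPsi br j h (Fin.cons m d : Fin (n + 1) → ℤ) (Fin.cons y x : Fin (n + 1) → W) (consSet I)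

/-- The linearisation of `φ` in the direction of an additional argument `y` of degree `m`. -/
def linPhi (br : V →ₗ[𝕜] V →ₗ[𝕜] V) (j : W →ₗ[𝕜] V) (h : V →ₗ[𝕜] V) (d : Fin n → ℤ)
    (x : Fin n → W) (m : ℤ) (y : W) (I : Finset (Fin n)) : V :=
  bigPhi br j h (Fin.cons m d : Fin (n + 1) → ℤ) (Fin.cons y x : Fin (n + 1) → W) (consSet I)

theorem argOn_cons (y : W) (I : Finset (Fin n)) :
    argOn (Fin.cons y x : Fin (n + 1) → W) (consSet I) = const (𝕜 := 𝕜) y I := by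
  rw [const_apply]
  split_ifs with hI
  · rw [hI, show consSet (∅ : Finset (Fin n)) = {0} from rfl, argOn_singleton, Fin.cons_zero]
  · apply argOn_of_card_ne_one
    rw [consSet, Finset.card_insert_of_notMem (zero_notMem_map_succ I), Finset.card_map]
    simpa using hI

theorem bigPsi_map_succ (m : ℤ) (y : W) (I : Finset (Fin n)) :
    bigPsi br j h (Fin.cons m d : Fin (n + 1) → ℤ) (Fin.cons y x : Fin (n + 1) → W)
      (I.map (Fin.succEmb n)) = bigPsi br j h d x I := by
  rw [bigPsi, bigPsi, theta_map_succ]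
  congr 1
  have := psiOn_map (br := br) (j := j) (h := h) (d := (Fin.cons m d : Fin (n + 1) → ℤ))
    (x := (Fin.cons y x : Fin (n + 1) → W)) (Fin.succOrderEmb n) I
  exact this.symm

theorem linPsi_eq (m : ℤ) (y : W) :
    linPsi br j h d x m y = -const (𝕜 := 𝕜) (j y) + comp h (linPhi br j h d x m y) := by
  ext I
  have := congrFun (bigPsi_eq (br := br) (j := j) (h := h) (d := (Fin.cons m d : Fin (n + 1) → ℤ))
    (x := (Fin.cons y x : Fin (n + 1) → W))) (consSet I)
  rw [linPsi, this, ← comp_const]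
  simp only [Pi.add_apply, Pi.neg_apply, comp_apply, argOn_cons (𝕜 := 𝕜)]
  rfl

theorem isTotal_linPsi (hbr : IsBigraded 𝒱 𝒱 𝒱 br) (hj : ∀ i w, w ∈ 𝒲 i → j w ∈ 𝒱 i)
    (hh : ∀ i v, v ∈ 𝒱 i → h v ∈ 𝒱 (i - 1)) (hx : ∀ s, x s ∈ 𝒲 (d s)) {m : ℤ} {y : W}
    (hy : y ∈ 𝒲 m) : IsTotal d 𝒱 m (linPsi br j h d x m y) := fun I => by
  have := isTotal_bigPsi (d := (Fin.cons m d : Fin (n + 1) → ℤ))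
    (x := (Fin.cons y x : Fin (n + 1) → W)) hbr hj hh (Fin.cases hy hx) (consSet I)
  rwa [eps_cons, show 1 - (1 - m + eps d I) = m - eps d I by ring] at this

/-- In a decomposition of the enlarged index set, the new index lies in one block or the other. The
two resulting halves are brackets with Ψ on either side, and they coincide because Ψ is odd; this
produces the factor 2. -/
theorem linPhi_eq (hbr : IsBigraded 𝒱 𝒱 𝒱 br)
    (hskew : ∀ i j v w, v ∈ 𝒱 i → w ∈ 𝒱 j → br v w = -((i * j).negOnePow • br w v))
    (hj : ∀ i w, w ∈ 𝒲 i → j w ∈ 𝒱 i)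
    (hh : ∀ i v, v ∈ 𝒱 i → h v ∈ 𝒱 (i - 1)) (hx : ∀ s, x s ∈ 𝒲 (d s)) {m : ℤ} {y : W}
    (hy : y ∈ 𝒲 m) : linPhi br j h d x m y =
      -((2 : ℤ) • conv d 𝒱 br (bigPsi br j h d x) (linPsi br j h d x m y)) := by
  have hΨ := isTotal_bigPsi hbr hj hh hx
  have hL := isTotal_linPsi hbr hj hh hx hy
  have hcx : ∀ s, (Fin.cons y x : Fin (n + 1) → W) s ∈ 𝒲 ((Fin.cons m d : Fin (n + 1) → ℤ) s) :=
    Fin.cases hy hx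
  have h1 : linPhi br j h d x m y =
      -(conv d 𝒱 br (bigPsi br j h d x) (linPsi br j h d x m y) +
        (1 - m).negOnePow • conv d 𝒱 br (linPsi br j h d x m y) (bigPsi br j h d x)) := by
    ext I
    rw [linPhi, bigPhi_eq hbr hj hh hcx, Pi.neg_apply, conv_apply, consSet,
      sum2_insert (zero_notMem_map_succ I), sum2_map, sum2_map, Pi.neg_apply, Pi.add_apply,
      Pi.smul_apply, conv_apply, conv_apply, smul_sum2]
    congr 2
    · refine sum2_congr fun J K _ _ => ?_
      rw [bigPsi_map_succ, eps_map_succ]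
      change (gam _ _ (consSet K)).negOnePow • br _ (signTwist _ _ (bigPsi _ _ _ _ _ (consSet K))) = _
      rw [gam_cons_right]
      rfl
    · refine sum2_congr fun J K _ _ => ?_
      rw [bigPsi_map_succ]
      change (gam _ (consSet J) _).negOnePow • br (bigPsi _ _ _ _ _ (consSet J))
        (signTwist _ (eps _ (consSet J)) _) = _
      rw [gam_cons_left, eps_cons, signTwist_of_mem _ _ (hΨ K), signTwist_of_mem _ _ (hΨ K),
        map_sign_smul, map_sign_smul, smul_smul, smul_smul, smul_smul, ← Int.negOnePow_add,
        ← Int.negOnePow_add, ← Int.negOnePow_add]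
      congr 1
      apply negOnePow_congr
      push_cast
      grind
  -- The exponent (1 - m) + m is odd, so it cancels the minus sign of skew-symmetry and the two
  -- halves add up.
  rw [h1, conv_skew hskew hL hΨ, smul_neg, smul_smul, ← Int.negOnePow_add, two_smul,
    show 1 - m + m * 1 = 1 by ring, Int.negOnePow_one, Units.neg_smul, one_smul, neg_neg]

end TransferStructure

end

end StrongHomotopy

namespace StrongHomotopy

noncomputable section

/-! ### The transferred operations form an `L_∞`-algebra -/

section TransferLInfinity

variable {𝕜 V W : Type*} [Field 𝕜] [AddCommGroup V] [Module 𝕜 V] [AddCommGroup W] [Module 𝕜 W]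
  {𝒱 : ℤ → Submodule 𝕜 V} [DirectSum.Decomposition 𝒱]
  {𝒲 : ℤ → Submodule 𝕜 W} [DirectSum.Decomposition 𝒲]
  {δ : V →ₗ[𝕜] V} {d' : W →ₗ[𝕜] W} {br : V →ₗ[𝕜] V →ₗ[𝕜] V}
  {p : V →ₗ[𝕜] W} {j : W →ₗ[𝕜] V} {h : V →ₗ[𝕜] V} {n : ℕ} {d : Fin n → ℤ} {x : Fin n → W}

/-- The transferred operations evaluated on subsets of the arguments, with the décalage sign. -/
def bigLam (br : V →ₗ[𝕜] V →ₗ[𝕜] V) (d' : W →ₗ[𝕜] W) (p : V →ₗ[𝕜] W) (j : W →ₗ[𝕜] V)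
    (h : V →ₗ[𝕜] V) (d : Fin n → ℤ) (x : Fin n → W) : Finset (Fin n) → W :=
  comp d' (argOn x) + comp p (bigPhi br j h d x)

/-- The linearisation of the transferred operations in the direction of an additional argument `y`
of degree `m`. -/
def linLam (br : V →ₗ[𝕜] V →ₗ[𝕜] V) (d' : W →ₗ[𝕜] W) (p : V →ₗ[𝕜] W) (j : W →ₗ[𝕜] V)
    (h : V →ₗ[𝕜] V) (d : Fin n → ℤ) (x : Fin n → W) (m : ℤ) (y : W) : Finset (Fin n) → W :=
  const (𝕜 := 𝕜) (d' y) + comp p (linPhi br j h d x m y)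

/-- On homogeneous arguments one formula covers all arities: the differential part survives only in
arity 1, the bracket part only in arity at least 2. -/
theorem transfer_apply (hx : ∀ s, x s ∈ 𝒲 (d s)) : transfer 𝒲 br d' p j h n x =
    d' (argOn x Finset.univ) + p (phiOn br j h d x Finset.univ) := by
  match n, d, x, hx with
  | 0, d, x, hx =>
    rw [argOn_of_card_ne_one (by simp), phiOn_of_card_le_one (by simp), map_zero, map_zero,
      add_zero]
    rfl
  | 1, d, x, hx =>
    rw [phiOn_of_card_le_one (by simp), map_zero, add_zero,
      show (Finset.univ : Finset (Fin 1)) = {0} from rfl, argOn_singleton]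
    rfl
  | k + 2, d, x, hx =>
    rw [argOn_of_card_ne_one (by simp), map_zero, zero_add, transfer, assemble_of_mem _ _ d x hx,
      ← phi_eq_phiOn_univ]
    rfl

theorem transfer_strictMono (hx : ∀ s, x s ∈ 𝒲 (d s)) {m : ℕ} {f : Fin m → Fin n}
    (hf : StrictMono f) {I : Finset (Fin n)} (hI : ∀ i, i ∈ I ↔ ∃ s, f s = i) :
    transfer 𝒲 br d' p j h m (fun s => x (f s)) =
      (theta d I).negOnePow • bigLam br d' p j h d x I := by
  have h1 : I = Finset.univ.map ⟨f, hf.injective⟩ := by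
    ext i; rw [hI]; simp only [Finset.mem_map, Finset.mem_univ, true_and]; rfl
  have h2 : argOn (fun s => x (f s)) Finset.univ = argOn x I := by
    by_cases hm : I.card = 1
    · obtain rfl : m = 1 := by
        rwa [h1, Finset.card_map, Finset.card_univ, Fintype.card_fin] at hm
      rw [show (Finset.univ : Finset (Fin 1)) = {0} from rfl, argOn_singleton,
        show I = {f 0} by rw [h1]; rfl, argOn_singleton]
    · rw [argOn_of_card_ne_one hm, argOn_of_card_ne_one]
      rwa [h1, Finset.card_map] at hm
  rw [transfer_apply (fun s => hx (f s)), ← phi_eq_phiOn_univ, phi_strictMono hf hI, h2, bigLam,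
    Pi.add_apply, comp_apply, comp_apply, bigPhi, smul_add, map_sign_smul, smul_smul,
    Int.units_mul_self, one_smul, ← map_sign_smul, theta_smul_argOn]

/-- The added argument stands in front of those indexed by I, which accounts for the extra exponent
|I| m in the décalage sign. -/
theorem transfer_cons (hx : ∀ s, x s ∈ 𝒲 (d s)) {m : ℤ} {y : W} (hy : y ∈ 𝒲 m) {k : ℕ}
    {f : Fin k → Fin n} (hf : StrictMono f) {I : Finset (Fin n)}
    (hI : ∀ i, i ∈ I ↔ ∃ s, f s = i) :
    transfer 𝒲 br d' p j h (k + 1) (Fin.cons y (fun s => x (f s))) =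
      (I.card * m + theta d I).negOnePow • linLam br d' p j h d x m y I := by
  have h1 : (Fin.cons y (fun s => x (f s)) : Fin (k + 1) → W) = fun s =>
      (Fin.cons y x : Fin (n + 1) → W) ((Fin.cons 0 (fun s => (f s).succ) :
        Fin (k + 1) → Fin (n + 1)) s) := by
    ext s
    induction s using Fin.cases <;> simp
  have hf' : StrictMono (Fin.cons 0 (fun s => (f s).succ) : Fin (k + 1) → Fin (n + 1)) := by
    intro s t hst
    induction s using Fin.cases <;> induction t using Fin.cases
    · exact absurd hst (lt_irrefl _)
    · simp
    · exact absurd hst (Fin.not_lt_zero _)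
    · simpa using hf (Fin.succ_lt_succ_iff.1 hst)
  have hI' : ∀ i, i ∈ consSet I ↔ ∃ s, (Fin.cons 0 (fun s => (f s).succ) :
      Fin (k + 1) → Fin (n + 1)) s = i := by
    intro i
    rw [Fin.exists_fin_succ]
    simp [consSet, hI, eq_comm]
  have hcx : ∀ s, (Fin.cons y x : Fin (n + 1) → W) s ∈ 𝒲 ((Fin.cons m d : Fin (n + 1) → ℤ) s) :=
    Fin.cases hy hx
  rw [h1, transfer_strictMono hcx hf' hI', theta_cons, bigLam, linLam, Pi.add_apply, Pi.add_apply,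
    comp_apply, argOn_cons (𝕜 := 𝕜), ← comp_const]
  rfl

theorem isTotal_bigLam (hL : IsDGLie 𝒱 δ br) (hc : IsContraction 𝒱 δ 𝒲 d' p j h)
    (hx : ∀ s, x s ∈ 𝒲 (d s)) : IsTotal d 𝒲 2 (bigLam br d' p j h d x) := by
  intro I
  refine add_mem ?_ ?_
  · have := hc.diff_target.mem (isTotal_argOn hx I)
    rwa [show 1 - eps d I + 1 = 2 - eps d I by ring] at this
  · exact hc.p_mem (sign_smul_mem _ _
      (psiOn_mem hL.mem (fun _ _ => hc.j_mem) (fun _ _ => hc.h_mem) hx I).2)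

/-- B is the Maurer–Cartan curvature δΨ + [Ψ,Ψ]. Its Bianchi identity expresses δΦ through [Ψ,B];
substituting this in δhΦ = Φ - jpΦ - hδΦ gives the first equation, and applying p to it gives the
second. -/
theorem curvature_equations [CharZero 𝕜] (hL : IsDGLie 𝒱 δ br)
    (hc : IsContraction 𝒱 δ 𝒲 d' p j h) (hx : ∀ s, x s ∈ 𝒲 (d s)) :
    let B := comp δ (bigPsi br j h d x) - bigPhi br j h d x
    B = -comp j (bigLam br d' p j h d x) -
        (2 : ℤ) • comp h (conv d 𝒱 br (bigPsi br j h d x) B) ∧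
      comp d' (bigLam br d' p j h d x) =
        (2 : ℤ) • comp p (conv d 𝒱 br (bigPsi br j h d x) B) := by
  intro B
  have hΦ := bigPhi_eq hL.mem (fun _ _ => hc.j_mem) (fun _ _ => hc.h_mem) hx
  have hΨ := bigPsi_eq (br := br) (j := j) (h := h) (d := d) (x := x)
  have hT := isTotal_bigPsi hL.mem (fun _ _ => hc.j_mem) (fun _ _ => hc.h_mem) hx
  have hδT : IsTotal d 𝒱 (1 + 1) (comp δ (bigPsi br j h d x)) :=
    hT.comp fun i v hv => hc.diff_source.mem hv
  simp only [B, bigLam]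
  clear B
  generalize bigPsi br j h d x = Ψ at *
  generalize bigPhi br j h d x = Φ at *
  have h11 : ((1 + 1 : ℤ) * 1).negOnePow = 1 := by
    rw [show ((1 + 1 : ℤ) * 1) = 2 * 1 by norm_num, Int.negOnePow_two_mul]
  have hTT := hT.conv hL.mem hT
  -- For an odd element the Jacobi identity reads T = -2T with T = [Ψ,[Ψ,Ψ]], and 3 is invertible.
  have hjac : conv d 𝒱 br Ψ (conv d 𝒱 br Ψ Ψ) = 0 := by
    have h1 := conv_jacobi hL.mem hL.jacobi Ψ hT hT
    rw [conv_skew hL.skew hTT hT, h11, one_smul] at h1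
    simp only [mul_one, Int.negOnePow_one, Units.neg_smul, one_smul] at h1
    have h2 : (3 : 𝕜) • conv d 𝒱 br Ψ (conv d 𝒱 br Ψ Ψ) = 0 := by
      rw [show (3 : 𝕜) = 1 + 1 + 1 by norm_num, add_smul, add_smul, one_smul]
      nth_rewrite 1 [h1]
      abel
    exact (smul_eq_zero.1 h2).resolve_left (by norm_num)
  -- Differentiating Φ = -[Ψ,Ψ] gives 2[Ψ,δΨ]; subtracting Φ from δΨ costs nothing because [Ψ,Φ] =
  -- 0.
  have hδΦ : comp δ Φ = (2 : ℤ) • conv d 𝒱 br Ψ (comp δ Ψ - Φ) := by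
    have h1 := comp_conv_derivation (𝒳 := 𝒱) (𝒴 := 𝒱) (𝒵 := 𝒱) (b := br) (DX := δ) (DY := δ)
      (DZ := δ) (e := 1)
      (fun i v hv => hc.diff_source.mem hv) (fun i v w hv => by
        rw [one_mul]; exact hL.deriv i v w hv) hT Ψ
    rw [conv_skew hL.skew hδT hT, h11, one_smul] at h1
    simp only [mul_one, Int.negOnePow_one, Units.neg_smul, one_smul] at h1
    have h2 : conv d 𝒱 br Ψ Φ = 0 := by rw [hΦ, map_neg, hjac, neg_zero]
    rw [map_sub, h2, sub_zero, two_smul]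
    conv_lhs => rw [hΦ]
    rw [map_neg, h1]
    abel
  have hhom : comp δ (comp h Φ) = Φ - comp j (comp p Φ) - comp h (comp δ Φ) := by
    ext I
    simp only [comp_apply, Pi.sub_apply]
    rw [← hc.homotopy]
    abel
  constructor
  · have h1 : comp δ Ψ = -comp j (comp d' (argOn x)) + comp δ (comp h Φ) := by
      conv_lhs => rw [hΨ]
      rw [map_add, map_neg]
      congr 2
      ext I
      exact (hc.j_d _).symm
    rw [← map_zsmul, ← hδΦ, h1, hhom, map_add]
    abel
  · rw [← map_zsmul, ← hδΦ, map_add]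
    ext I
    simp only [Pi.add_apply, comp_apply, hc.diff_target.sq, zero_add]
    exact (hc.p_d _).symm

/-- The quadratic relation of the transferred operations. -/
theorem sum_rho_linLam [CharZero 𝕜] (hL : IsDGLie 𝒱 δ br)
    (hc : IsContraction 𝒱 δ 𝒲 d' p j h) (hx : ∀ s, x s ∈ 𝒲 (d s)) :
    ∑ J, rho (𝕜 := 𝕜) d J
    (linLam br d' p j h d x (2 - eps d J) (bigLam br d' p j h d x J)) = 0 := by
  obtain ⟨hB, hB'⟩ := curvature_equations hL hc hx
  have hΛ := isTotal_bigLam hL hc hx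
  have hlin := fun J => linPhi_eq hL.mem hL.skew (fun _ _ => hc.j_mem) (fun _ _ => hc.h_mem) hx (hΛ J)
  have hpsi : ∀ J, linPsi br j h d x (2 - eps d J) (bigLam br d' p j h d x J) =
      -comp j (const (𝕜 := 𝕜) (bigLam br d' p j h d x J)) - (2 : ℤ) • comp h
        (conv d 𝒱 br (bigPsi br j h d x)
          (linPsi br j h d x (2 - eps d J) (bigLam br d' p j h d x J))) := fun J => by
    conv_lhs => rw [linPsi_eq (𝕜 := 𝕜), hlin J]
    rw [comp_const, map_neg, map_zsmul]
    exact (sub_eq_add_neg _ _).symm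
  -- The sum represents the derivative of Ψ in the direction λ(x). By right linearity over the
  -- parameters it solves the fixed-point equation of the curvature, hence equals the curvature.
  have hX := linear_unique (h := h) (bigPsi_empty (br := br) (j := j) (h := h) (d := d) (x := x))
    (X := ∑ J, rho (𝕜 := 𝕜) d J (linPsi br j h d x (2 - eps d J) (bigLam br d' p j h d x J)))
    (by
      have h1 : comp j (bigLam br d' p j h d x) =
          ∑ J, rho (𝕜 := 𝕜) d J (comp j (const (𝕜 := 𝕜) (bigLam br d' p j h d x J))) := by
        conv_lhs => rw [← sum_rho_const (𝕜 := 𝕜) (d := d) (bigLam br d' p j h d x)]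
        rw [map_sum]
        exact Finset.sum_congr rfl fun J _ => comp_rho _ _ _
      rw [h1, map_sum, map_sum, Finset.smul_sum, ← Finset.sum_neg_distrib, ← Finset.sum_sub_distrib]
      refine Finset.sum_congr rfl fun J _ => ?_
      conv_lhs => rw [hpsi J]
      rw [conv_rho, comp_rho, map_sub, map_neg, map_zsmul]) hB
  have h2 : ∀ J, rho (𝕜 := 𝕜) d J
      (linLam br d' p j h d x (2 - eps d J) (bigLam br d' p j h d x J)) =
      comp d' (rho (𝕜 := 𝕜) d J (const (𝕜 := 𝕜) (bigLam br d' p j h d x J))) -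
      (2 : ℤ) • comp p (conv d 𝒱 br (bigPsi br j h d x) (rho (𝕜 := 𝕜) d J
        (linPsi br j h d x (2 - eps d J) (bigLam br d' p j h d x J)))) := fun J => by
    rw [linLam, hlin J, conv_rho, comp_rho, comp_rho, comp_const, map_add, map_neg, map_neg,
      map_zsmul, map_zsmul]
    exact (sub_eq_add_neg _ _).symm
  -- With that derivative replaced by the curvature B, the sum becomes d'λ - 2p[Ψ,B], which is zero
  -- by the second curvature equation.
  simp only [h2]
  rw [Finset.sum_sub_distrib, ← Finset.smul_sum, ← map_sum, ← map_sum, ← map_sum, hX,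
    sum_rho_const, hB', sub_self]

theorem cons_sign_smul {k : ℕ} (f : MultilinearMap 𝕜 (fun _ : Fin (k + 1) => W) W) (u : ℤˣ) (y : W)
    (z : Fin k → W) : f (Fin.cons (u • y) z) = u • f (Fin.cons y z) := by
  rcases Int.units_eq_one_or u with rfl | rfl
  · rw [one_smul, one_smul]
  · have := f.cons_smul z (-1) y
    simpa using this

/-- Homotopy transfer: the operations transferred from a DG Lie algebra form an `L_∞`-algebra. -/
theorem isLInfinity_transfer [CharZero 𝕜] (hL : IsDGLie 𝒱 δ br)
    (hc : IsContraction 𝒱 δ 𝒲 d' p j h) : IsLInfinity 𝒲 (transfer 𝒲 br d' p j h) where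
  degree k _ d x hx := by
    have := transfer_strictMono (br := br) (d' := d') (p := p) (j := j) (h := h) hx strictMono_id
      (I := Finset.univ) (by simp)
    simp only [id] at this
    rw [this]
    have h1 := isTotal_bigLam hL hc hx Finset.univ
    rw [eps_eq, Finset.card_univ, Fintype.card_fin] at h1
    rw [show ∑ s, d s + (2 - (k : ℤ)) = 2 - (k - ∑ s, d s) by ring]
    exact sign_smul_mem _ _ h1
  skew k _ d x hx σ := by
    rw [transfer_apply hx, transfer_apply (d := fun s => d (σ s)) (fun s => hx (σ s)),
      ← phi_eq_phiOn_univ, ← phi_eq_phiOn_univ, phi_perm, argOn_perm, Finset.map_univ_equiv,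
      map_sign_smul, smul_add]
    congr 1
    by_cases hk : (Finset.univ : Finset (Fin k)).card = 1
    · have := invSign_of_card_le_one σ d hk.le
      rw [show chi σ d = 1 from this, one_smul]
    · rw [argOn_of_card_ne_one hk, map_zero, smul_zero]
  relation k _ d v hv := by
    -- The L∞-relation in arity k is the coefficient of the product of all ε_i in the quadratic
    -- relation, up to the global sign given by `theta`.
    have h0 := congrFun (sum_rho_linLam hL hc hv) Finset.univ
    rw [Finset.sum_apply, Pi.zero_apply] at h0
    rw [sum_unshuffles_attach (Finset.Icc 1 k) (fun l hl => by
      simp only [Finset.mem_Icc, Finset.mem_range] at hl ⊢; omega) _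
      (fun J => (theta d Finset.univ).negOnePow • rho (𝕜 := 𝕜) d J
        (linLam br d' p j h d v (2 - eps d J) (bigLam br d' p j h d v J)) Finset.univ) ?_ ?_,
      ← Finset.smul_sum, h0, smul_zero]
    · intro l σ hσ
      have hl := Finset.mem_Icc.1 l.2
      have hk := Nat.add_sub_of_le hl.2
      have hJ := isTotal_bigLam hL hc hv (firstBlock l.1 σ)
      rw [transfer_strictMono hv (blocks_inl_strictMono hk hσ) (mem_firstBlock_iff hk σ),
        cons_sign_smul, transfer_cons hv hJ (blocks_inr_strictMono hk hσ)
          (mem_compl_firstBlock_iff hk σ), chi_of_unshuffle hσ hk, crossSign_eq, rho_apply,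
        if_pos (Finset.subset_univ _), ← Finset.compl_eq_univ_sdiff]
      simp only [smul_smul, ← Int.negOnePow_add]
      congr 1
      apply negOnePow_congr
      have hd : Disjoint (firstBlock l.1 σ) (firstBlock l.1 σ)ᶜ := disjoint_compl_right
      have h1 := cross_cast d hd
      rw [Finset.union_compl] at h1
      rw [eps_eq, card_firstBlock σ hk, card_compl_firstBlock σ hk]
      rw [card_compl_firstBlock σ hk] at h1
      push_cast at h1 ⊢
      grind
    -- Only J = ∅ lies outside the range of i. Its term vanishes because there is no operation of
    -- arity 0.
    · intro J hJ
      have : J = ∅ := by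
        rw [← Finset.card_eq_zero]
        have := (Finset.card_le_univ J).trans_eq (Fintype.card_fin k)
        by_contra h
        exact hJ (Finset.mem_Icc.2 ⟨by omega, this⟩)
      have h1 : bigLam br d' p j h d v ∅ = 0 := by
        rw [bigLam, Pi.add_apply, comp_apply, comp_apply, bigPhi, argOn_of_card_ne_one (by simp),
          phiOn_of_card_le_one (by simp), smul_zero, map_zero, map_zero, add_zero]
      -- That the linearisation in the direction 0 vanishes is read off from the multilinearity of
      -- the transferred operation.
      have h2 := transfer_cons (br := br) (d' := d') (p := p) (j := j) (h := h) hv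
        (zero_mem (𝒲 (2 - eps d ∅))) strictMono_id (I := Finset.univ) (by simp)
      rw [(transfer 𝒲 br d' p j h (k + 1)).map_coord_zero 0 (Fin.cons_zero _ _)] at h2
      rw [this, h1, rho_apply, if_pos (Finset.subset_univ _), Finset.sdiff_empty,
        ((smul_eq_zero_iff_eq _).1 h2.symm), smul_zero, smul_zero]

end TransferLInfinity

end

end StrongHomotopy

namespace StrongHomotopy

noncomputable section

/-! ### The Poisson bracket of `S_A M` is a DG Lie bracket -/

section PoissonLie

open GradedSym

variable {𝕜 A M : Type*} [Field 𝕜] [Ring A] [Algebra 𝕜 A]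
  [AddCommGroup M] [Module 𝕜 M] [Module A M] [IsScalarTower 𝕜 A M]
  {𝒜 : ℤ → Submodule 𝕜 A} [GradedAlgebra 𝒜] {D : DGCommStructure 𝒜}
  {ℳ : ℤ → Submodule 𝕜 M} [DirectSum.Decomposition ℳ] [SetLike.GradedSMul 𝒜 ℳ]

/-- The mixed products of S on one factor and T on the other cancel. This reduces the Jacobi
identity, the derivation property of the differential and the vanishing of squares to generators. -/
theorem GradedSym.IsDerivation.commutator {s t : ℤ} {S T : GradedSym 𝒜 ℳ →ₗ[𝕜] GradedSym 𝒜 ℳ}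
    (hS : IsDerivation s S) (hT : IsDerivation t T)
    (hSm : ∀ i x, x ∈ deg 𝒜 ℳ i → S x ∈ deg 𝒜 ℳ (i + s))
    (hTm : ∀ i x, x ∈ deg 𝒜 ℳ i → T x ∈ deg 𝒜 ℳ (i + t)) :
    IsDerivation (s + t) (S ∘ₗ T - (s * t).negOnePow • (T ∘ₗ S)) := by
  refine bilinear_ext (deg 𝒜 ℳ) (deg 𝒜 ℳ) _ _ ?_ ?_ ?_ ?_ ?_
  · intro x x' y; simp only [add_mul, map_add]
  · intro x y y'; simp only [mul_add, map_add]
  · intro x x' y; simp only [add_mul, map_add]; abel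
  · intro x y y'; simp only [mul_add, map_add]; abel
  · intro i j x y hx hy
    simp only [LinearMap.sub_apply, LinearMap.smul_apply, LinearMap.comp_apply, hS x y, hT x y,
      map_add, hS _ y, hT _ y, hS x _, hT x _, signTwist_of_mem _ _ hx,
      map_sign_smul, smul_mul_assoc, mul_smul_comm, sub_mul, mul_sub, smul_sub, smul_add,
      hS (T x) y, hT (S x) y, signTwist_of_mem _ _ (hTm _ _ hx), signTwist_of_mem _ _ (hSm _ _ hx),
      smul_smul, ← Int.negOnePow_add]
    have h1 : (s * (i + t)).negOnePow = (s * t + s * i).negOnePow := by congr 1; ring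
    have h2 : (s * t + t * (i + s)).negOnePow = (t * i).negOnePow := by
      apply negOnePow_congr; push_cast; grind
    have h3 : (t * i + s * i).negOnePow = ((s + t) * i).negOnePow := by congr 1; ring
    have h4 : (s * t + (s * i + t * i)).negOnePow = ((s + t) * i + s * t).negOnePow := by
      congr 1; ring
    have h5 : (s * i + t * i).negOnePow = ((s + t) * i).negOnePow := by congr 1; ring
    simp only [h1, h2, h3, h4, h5]
    have h6 : ((s + t) * i + s * t).negOnePow = (s * t + (s + t) * i).negOnePow := by
      congr 1; ring
    rw [h6]
    abel

namespace DGLieRinehartStructure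

variable (X : DGLieRinehartStructure D ℳ)

theorem poisson_mem : IsBigraded (deg 𝒜 ℳ) (deg 𝒜 ℳ) (deg 𝒜 ℳ) X.poisson := by
  intro i j x y hx hy
  rw [X.poisson_of_mem hx, add_comm]
  exact derivExt_mem _ _ _ hy

theorem poisson_isDerivation {n : ℤ} {y : GradedSym 𝒜 ℳ} (hy : y ∈ deg 𝒜 ℳ n) :
    IsDerivation n (X.poisson y) := by
  rw [X.poisson_of_mem hy]; exact derivExt_isDerivation _ _ _

theorem poisson_gen {i : ℤ} {x : A × M} (hx : x ∈ prodGrading 𝒜 ℳ i) :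
    X.poisson (gen 𝒜 ℳ x) = X.ad x :=
  (X.poisson_isDerivation (gen_mem hx)).ext (X.ad_isDerivation hx)
    (fun _ y _ => by rw [poisson_gen_gen, ad_gen])

theorem poisson_gen_right {n i : ℤ} {y : GradedSym 𝒜 ℳ} (hy : y ∈ deg 𝒜 ℳ n) {x : A × M}
    (hx : x ∈ prodGrading 𝒜 ℳ i) :
    X.poisson y (gen 𝒜 ℳ x) = -((n * i).negOnePow • X.poisson (gen 𝒜 ℳ x) y) := by
  rw [X.poisson_of_mem hy, derivExt_gen, X.poisson_gen hx, LinearMap.neg_apply,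
    LinearMap.comp_apply, signTwist_of_mem _ n hx, map_sign_smul]
  rfl

/-- Both sides are derivations in the remaining argument, so it suffices to insert a generator.
There the bracket can be reversed by construction, and the Leibniz rule in the second entry applies.
-/
theorem mul_poisson {n m : ℤ} {y z : GradedSym 𝒜 ℳ} (hy : y ∈ deg 𝒜 ℳ n) (hz : z ∈ deg 𝒜 ℳ m) :
    X.poisson (y * z) = LinearMap.mulLeft 𝕜 y ∘ₗ X.poisson z +
      (n * m).negOnePow • (LinearMap.mulLeft 𝕜 z ∘ₗ X.poisson y) := by
  have hyz : y * z ∈ deg 𝒜 ℳ (n + m) := SetLike.GradedMul.mul_mem hy hz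
  refine (X.poisson_isDerivation hyz).ext (((X.poisson_isDerivation hz).mulLeft hy).add
    (IsDerivation.sign_smul (by
      rw [add_comm]; exact (X.poisson_isDerivation hy).mulLeft hz) _)) (fun i x hx => ?_)
  have h1 := gradedComm _ _ _ _ (X.poisson_mem _ _ _ _ (gen_mem hx) hy) hz
  rw [LinearMap.add_apply, LinearMap.smul_apply, LinearMap.comp_apply, LinearMap.comp_apply,
    LinearMap.mulLeft_apply, LinearMap.mulLeft_apply, X.poisson_gen_right hyz hx,
    X.poisson_gen_right hy hx, X.poisson_gen_right hz hx, X.poisson_mul (gen_mem hx) hy, h1]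
  simp only [mul_neg, mul_smul_comm, smul_neg, smul_add, smul_smul, neg_add,
    ← Int.negOnePow_add]
  rw [add_comm]
  congr 3 <;> apply negOnePow_congr <;> push_cast <;> grind

/-- Skew-symmetry against a generator is built into the definition; it propagates to products by the
Leibniz rules in both entries. -/
theorem poisson_skew (i j : ℤ) (y z : GradedSym 𝒜 ℳ) (hy : y ∈ deg 𝒜 ℳ i) (hz : z ∈ deg 𝒜 ℳ j) :
    X.poisson y z = -((i * j).negOnePow • X.poisson z y) := by
  refine deg_induction (motive := fun j z => X.poisson y z = -((i * j).negOnePow • X.poisson z y))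
    (fun j x hx => X.poisson_gen_right hy hx) (by simp) (fun n a b ha hb => ?_)
    (fun k l a b ha hb h1 h2 => ?_) hz
  · rw [map_add, map_add, LinearMap.add_apply, ha, hb, smul_add, neg_add]
  · have h3 := gradedComm _ _ _ _ (X.poisson_mem _ _ _ _ ha hy) hb
    rw [X.poisson_mul hy ha, h1, h2, X.mul_poisson ha hb, LinearMap.add_apply,
      LinearMap.smul_apply, LinearMap.comp_apply, LinearMap.comp_apply,
      LinearMap.mulLeft_apply, LinearMap.mulLeft_apply, neg_mul, smul_mul_assoc, h3]
    simp only [mul_neg, mul_smul_comm, smul_neg, smul_add, smul_smul, neg_add,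
      ← Int.negOnePow_add]
    rw [add_comm]
    congr 3 <;> apply negOnePow_congr <;> push_cast <;> grind

theorem semidirect_jacobi {i j l : ℤ} {x y z : A × M} (hx : x ∈ prodGrading 𝒜 ℳ i)
    (hy : y ∈ prodGrading 𝒜 ℳ j) (hz : z ∈ prodGrading 𝒜 ℳ l) :
    X.semidirect x (X.semidirect y z) = X.semidirect (X.semidirect x y) z +
      (i * j).negOnePow • X.semidirect y (X.semidirect x z) := by
  have hyz := X.semidirect_mem hy hz
  have hxz := X.semidirect_mem hx hz
  have hxy := X.semidirect_mem hx hy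
  have e1 := X.act_mem _ _ _ _ hx.2 hy.1
  have e2 := X.act_mem _ _ _ _ hy.2 hx.1
  simp only [semidirect_apply]
  refine Prod.ext ?_ ?_
  · simp only [Prod.fst_add, Prod.smul_fst, X.flipAct_apply hx.1 hyz.2,
      X.flipAct_apply hy.1 hz.2, X.flipAct_apply hx.1 hy.2,
      X.flipAct_apply hx.1 hz.2, X.flipAct_apply hy.1 hxz.2, map_sub, LinearMap.sub_apply,
      X.bracket_act i j _ _ _ hx.2 hy.2]
    rw [X.flipAct_apply hx.1 (X.bracket_mem _ _ _ _ hy.2 hz.2),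
      X.flipAct_apply hy.1 (X.bracket_mem _ _ _ _ hx.2 hz.2), X.flipAct_apply e1 hz.2,
      map_sign_smul X.flipAct, LinearMap.smul_apply, X.flipAct_apply e2 hz.2,
      X.bracket_act j l _ _ _ hy.2 hz.2, X.bracket_act i l _ _ _ hx.2 hz.2]
    simp only [map_sign_smul, smul_sub, smul_smul, ← Int.negOnePow_add]
    have h1 : (i * (j + l) + j * l).negOnePow = (i * j + (i + j) * l).negOnePow := by
      congr 1; ring
    have h2 : (i * j + (j + i) * l).negOnePow = (i * j + (i + j) * l).negOnePow := by
      congr 1; ring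
    have h3 : (i * (j + l)).negOnePow = (i * j + i * l).negOnePow := by congr 1; ring
    have h4 : (i * j + j * (i + l)).negOnePow = (j * l).negOnePow := by
      apply negOnePow_congr; push_cast; grind
    have h5 : (i * j + (j * (i + l) + i * l)).negOnePow = ((i + j) * l).negOnePow := by
      apply negOnePow_congr; push_cast; grind
    rw [h1, h2, h3, h4, h5]
    abel
  · simp only [Prod.snd_add, Prod.smul_snd]
    exact X.jacobi i j _ _ _ hx.2 hy.2

/-- For fixed f and g, the commutator of {f,·} and {g,·} and the operator {{f,g},·} are derivations
of the same degree, hence are equal once they agree on generators. -/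
theorem poisson_jacobi_aux {i j : ℤ} {f g : GradedSym 𝒜 ℳ} (hf : f ∈ deg 𝒜 ℳ i)
    (hg : g ∈ deg 𝒜 ℳ j)
    (h : ∀ l z, z ∈ prodGrading 𝒜 ℳ l → X.poisson f (X.poisson g (gen 𝒜 ℳ z)) =
      X.poisson (X.poisson f g) (gen 𝒜 ℳ z) +
        (i * j).negOnePow • X.poisson g (X.poisson f (gen 𝒜 ℳ z))) (u : GradedSym 𝒜 ℳ) :
    X.poisson f (X.poisson g u) = X.poisson (X.poisson f g) u +
      (i * j).negOnePow • X.poisson g (X.poisson f u) := by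
  have h1 := (X.poisson_isDerivation hf).commutator (X.poisson_isDerivation hg)
    (fun k x hx => by rw [add_comm]; exact X.poisson_mem _ _ _ _ hf hx)
    (fun k x hx => by rw [add_comm]; exact X.poisson_mem _ _ _ _ hg hx)
  have h2 := h1.ext (X.poisson_isDerivation (X.poisson_mem _ _ _ _ hf hg)) (fun l z hz => by
    simp only [LinearMap.sub_apply, LinearMap.smul_apply, LinearMap.comp_apply]
    rw [h l z hz, add_sub_cancel_right])
  rw [← LinearMap.congr_fun h2 u]
  simp

theorem poisson_jacobi (i j : ℤ) (f g u : GradedSym 𝒜 ℳ) (hf : f ∈ deg 𝒜 ℳ i)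
    (hg : g ∈ deg 𝒜 ℳ j) : X.poisson f (X.poisson g u) = X.poisson (X.poisson f g) u +
      (i * j).negOnePow • X.poisson g (X.poisson f u) := by
  have h1 : ∀ i j x y, x ∈ prodGrading 𝒜 ℳ i → y ∈ prodGrading 𝒜 ℳ j → ∀ u,
      X.poisson (gen 𝒜 ℳ x) (X.poisson (gen 𝒜 ℳ y) u) =
        X.poisson (X.poisson (gen 𝒜 ℳ x) (gen 𝒜 ℳ y)) u +
        (i * j).negOnePow • X.poisson (gen 𝒜 ℳ y) (X.poisson (gen 𝒜 ℳ x) u) := by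
    intro i j x y hx hy
    refine X.poisson_jacobi_aux (gen_mem hx) (gen_mem hy) fun l z hz => ?_
    simp only [poisson_gen_gen]
    rw [X.semidirect_jacobi hx hy hz, map_add, map_sign_smul]
  -- The generators in the Jacobi identity are replaced by arbitrary elements one entry at a time:
  -- skew-symmetry moves the test generator forward, to a position where the identity is already
  -- available.
  have h2 : ∀ i j x g, x ∈ prodGrading 𝒜 ℳ i → g ∈ deg 𝒜 ℳ j → ∀ u,
      X.poisson (gen 𝒜 ℳ x) (X.poisson g u) = X.poisson (X.poisson (gen 𝒜 ℳ x) g) u +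
        (i * j).negOnePow • X.poisson g (X.poisson (gen 𝒜 ℳ x) u) := by
    intro i j x g hx hg
    refine X.poisson_jacobi_aux (gen_mem hx) hg fun l z hz => ?_
    have hxg := X.poisson_mem _ _ _ _ (gen_mem hx) hg
    have hxz := X.poisson_mem _ _ _ _ (gen_mem hx) (gen_mem hz)
    rw [X.poisson_skew _ _ _ _ hg (gen_mem hz), map_neg, map_sign_smul, h1 i l x z hx hz g,
      X.poisson_skew _ _ _ _ hxz hg, X.poisson_skew _ _ _ _ hxg (gen_mem hz)]
    simp only [smul_add, smul_neg, smul_smul, ← Int.negOnePow_add, neg_add, neg_neg]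
    have e1 : (j * l + (i + l) * j).negOnePow = (i * j).negOnePow := by
      apply negOnePow_congr; push_cast; grind
    have e2 : (j * l + i * l).negOnePow = ((i + j) * l).negOnePow := by congr 1; ring
    rw [add_comm, e1, e2]
  refine X.poisson_jacobi_aux hf hg (fun l z hz => ?_) u
  have hfg := X.poisson_mem _ _ _ _ hf hg
  have hzf := X.poisson_mem _ _ _ _ (gen_mem hz) hf
  have h3 := h2 l i z f hz hf g
  rw [X.poisson_skew _ _ _ _ hg (gen_mem hz), X.poisson_skew _ _ _ _ hfg (gen_mem hz), h3,
    X.poisson_skew _ _ _ _ hf (gen_mem hz), X.poisson_skew _ _ _ _ hzf hg]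
  simp only [map_neg, map_sign_smul, smul_add, smul_neg, smul_smul, ← Int.negOnePow_add, neg_add, neg_neg]
  have e1 : ((i + j) * l + l * i).negOnePow = (j * l).negOnePow := by
    apply negOnePow_congr; push_cast; grind
  have e2 : ((i + j) * l + (l + i) * j).negOnePow = (i * j + i * l).negOnePow := by
    apply negOnePow_congr; push_cast; grind
  rw [e1, e2]
  abel

theorem semidirect_deriv {i j : ℤ} {x y : A × M} (hx : x ∈ prodGrading 𝒜 ℳ i)
    (hy : y ∈ prodGrading 𝒜 ℳ j) :
    D.d.prodMap X.d (X.semidirect x y) = X.semidirect (D.d.prodMap X.d x) y +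
      i.negOnePow • X.semidirect x (D.d.prodMap X.d y) := by
  simp only [semidirect_apply, LinearMap.prodMap_apply]
  refine Prod.ext ?_ ?_
  · simp only [Prod.fst_add, Prod.smul_fst, map_sub, X.flipAct_apply hx.1 hy.2,
      X.flipAct_apply (D.isDifferential.mem hx.1) hy.2,
      X.flipAct_apply hx.1 (X.isDifferential.mem hy.2), map_sign_smul, X.d_act _ _ _ hx.2,
      X.d_act _ _ _ hy.2, smul_add, smul_sub, smul_smul, ← Int.negOnePow_add]
    have h1 : (i * j + j).negOnePow = ((i + 1) * j).negOnePow := by congr 1; ring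
    have h2 : (i + i * (j + 1)).negOnePow = (i * j).negOnePow := by
      apply negOnePow_congr; push_cast; grind
    rw [h1, h2]
    abel
  · simp only [Prod.snd_add, Prod.smul_snd]
    exact X.d_bracket i _ _ hx.2

theorem symDiff_isDerivation (X : DGModuleStructure D ℳ) : IsDerivation 1 X.symDiff :=
  derivExt_isDerivation _ _ _

theorem symDiff_mem (X : DGModuleStructure D ℳ) (i : ℤ) (x : GradedSym 𝒜 ℳ)
    (hx : x ∈ deg 𝒜 ℳ i) : X.symDiff x ∈ deg 𝒜 ℳ (i + 1) := derivExt_mem _ _ _ hx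

theorem symDiff_gen (X : DGModuleStructure D ℳ) (x : A × M) :
    X.symDiff (gen 𝒜 ℳ x) = gen 𝒜 ℳ (D.d.prodMap X.d x) := derivExt_gen _ _ _ _

theorem symDiff_poisson_aux {i : ℤ} {f : GradedSym 𝒜 ℳ} (hf : f ∈ deg 𝒜 ℳ i)
    (h : ∀ l z, z ∈ prodGrading 𝒜 ℳ l → X.symDiff (X.poisson f (gen 𝒜 ℳ z)) =
      X.poisson (X.symDiff f) (gen 𝒜 ℳ z) +
        i.negOnePow • X.poisson f (X.symDiff (gen 𝒜 ℳ z))) (u : GradedSym 𝒜 ℳ) :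
    X.symDiff (X.poisson f u) =
      X.poisson (X.symDiff f) u + i.negOnePow • X.poisson f (X.symDiff u) := by
  have h1 := (symDiff_isDerivation X.toDGModuleStructure).commutator (X.poisson_isDerivation hf)
    (symDiff_mem X.toDGModuleStructure)
    (fun k x hx => by rw [add_comm]; exact X.poisson_mem _ _ _ _ hf hx)
  rw [add_comm, one_mul] at h1
  have h2 := h1.ext (X.poisson_isDerivation (symDiff_mem X.toDGModuleStructure _ _ hf))
    (fun l z hz => by
      simp only [LinearMap.sub_apply, LinearMap.smul_apply, LinearMap.comp_apply]
      rw [h l z hz, add_sub_cancel_right])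
  rw [← LinearMap.congr_fun h2 u]
  simp

theorem symDiff_poisson (i : ℤ) (f u : GradedSym 𝒜 ℳ) (hf : f ∈ deg 𝒜 ℳ i) :
    X.symDiff (X.poisson f u) =
      X.poisson (X.symDiff f) u + i.negOnePow • X.poisson f (X.symDiff u) := by
  have h1 : ∀ i x, x ∈ prodGrading 𝒜 ℳ i → ∀ u, X.symDiff (X.poisson (gen 𝒜 ℳ x) u) =
      X.poisson (X.symDiff (gen 𝒜 ℳ x)) u +
        i.negOnePow • X.poisson (gen 𝒜 ℳ x) (X.symDiff u) := by
    intro i x hx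
    refine X.symDiff_poisson_aux (gen_mem hx) fun l z hz => ?_
    simp only [poisson_gen_gen, symDiff_gen]
    rw [X.semidirect_deriv hx hz, map_add, map_sign_smul]
  refine X.symDiff_poisson_aux hf (fun l z hz => ?_) u
  have hdf := symDiff_mem X.toDGModuleStructure _ _ hf
  have hdz := symDiff_mem X.toDGModuleStructure _ _ (gen_mem hz)
  rw [X.poisson_skew _ _ _ _ hf (gen_mem hz), map_neg, map_sign_smul, h1 l z hz,
    X.poisson_skew _ _ _ _ hdf (gen_mem hz), X.poisson_skew _ _ _ _ hf hdz]
  simp only [smul_add, smul_neg, smul_smul, ← Int.negOnePow_add, neg_add]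
  rw [add_comm]
  congr 3 <;> apply negOnePow_congr <;> push_cast <;> grind

theorem isDGLie_poisson : IsDGLie (deg 𝒜 ℳ) X.symDiff X.poisson where
  mem := X.poisson_mem
  skew := X.poisson_skew
  jacobi := X.poisson_jacobi
  deriv := X.symDiff_poisson

end DGLieRinehartStructure

end PoissonLie

end

end StrongHomotopy

namespace StrongHomotopy

noncomputable section

/-! ### The contraction of `S_A M` onto `S_A N` -/

section SymContractionProof

open GradedSym

variable {𝕜 A M N : Type*} [Field 𝕜] [Ring A] [Algebra 𝕜 A]
  [AddCommGroup M] [Module 𝕜 M] [Module A M] [IsScalarTower 𝕜 A M]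
  [AddCommGroup N] [Module 𝕜 N] [Module A N] [IsScalarTower 𝕜 A N]
  {𝒜 : ℤ → Submodule 𝕜 A} [GradedAlgebra 𝒜]
  {ℳ : ℤ → Submodule 𝕜 M} [DirectSum.Decomposition ℳ] [SetLike.GradedSMul 𝒜 ℳ]
  {𝒩 : ℤ → Submodule 𝕜 N} [DirectSum.Decomposition 𝒩] [SetLike.GradedSMul 𝒜 𝒩]
  {D : DGCommStructure 𝒜} {X : DGModuleStructure D ℳ} {Y : DGModuleStructure D 𝒩}

theorem signTwist_zero {V : Type*} [AddCommGroup V] [Module 𝕜 V] (𝒱 : ℤ → Submodule 𝕜 V)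
    [DirectSum.Decomposition 𝒱] (v : V) : signTwist 𝒱 0 v = v := by
  induction v using DirectSum.Decomposition.inductionOn 𝒱 with
  | zero => simp
  | add x y hx hy => rw [map_add, hx, hy]
  | homogeneous x => rw [signTwist_of_mem _ _ x.2, zero_mul, Int.negOnePow_zero, one_smul]

theorem GradedSym.map_mem (f : M →ₗ[𝕜] N) (hs : ∀ (a : A) (m : M), f (a • m) = a • f m)
    (hd : ∀ (i : ℤ) (m : M), m ∈ ℳ i → f m ∈ 𝒩 i) {n : ℤ} {x : GradedSym 𝒜 ℳ}
    (hx : x ∈ deg 𝒜 ℳ n) : GradedSym.map f hs hd x ∈ deg 𝒜 𝒩 n := by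
  refine deg_induction (motive := fun n x => GradedSym.map f hs hd x ∈ deg 𝒜 𝒩 n)
    (fun i x hx => ?_) (by simp) (fun n x y hx hy => ?_) (fun i j x y _ _ h1 h2 => ?_) hx
  · rw [GradedSym.map, lift_gen]
    exact gen_mem ⟨hx.1, hd _ _ hx.2⟩
  · rw [map_add]; exact add_mem hx hy
  · rw [map_mul]; exact SetLike.GradedMul.mul_mem h1 h2

theorem GradedSym.IsDerivation.map_ext {e : ℤ} {T : GradedSym 𝒜 ℳ →ₗ[𝕜] GradedSym 𝒜 ℳ}
    {T' : GradedSym 𝒜 𝒩 →ₗ[𝕜] GradedSym 𝒜 𝒩} (hT : IsDerivation e T) (hT' : IsDerivation e T')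
    {φ : GradedSym 𝒜 ℳ →ₐ[𝕜] GradedSym 𝒜 𝒩}
    (hφ : ∀ i x, x ∈ deg 𝒜 ℳ i → φ x ∈ deg 𝒜 𝒩 i)
    (h : ∀ x, φ (T (gen 𝒜 ℳ x)) = T' (φ (gen 𝒜 ℳ x))) (x : GradedSym 𝒜 ℳ) :
    φ (T x) = T' (φ x) := by
  induction x using GradedSym.induction with
  | hgen x => exact h x
  | hadd x y hx hy => simp only [map_add, hx, hy]
  | hmul x y hx hy =>
    have h1 := map_signTwist (D := φ.toLinearMap) (𝒳 := deg 𝒜 ℳ) (𝒴 := deg 𝒜 𝒩) (e := 0)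
      (by simpa using hφ) e x
    rw [mul_zero, Int.negOnePow_zero, one_smul] at h1
    simp only [AlgHom.toLinearMap_apply] at h1
    rw [hT, map_add, map_mul, map_mul, hx, hy, map_mul, hT', h1]

/-- For a derivation of odd degree, twice the square is the graded commutator with itself, hence a
derivation; vanishing on generators then suffices, as 2 is invertible. -/
theorem GradedSym.IsDerivation.sq_eq_zero [CharZero 𝕜] {e : ℤ} (he : (e * e).negOnePow = -1)
    {T : GradedSym 𝒜 ℳ →ₗ[𝕜] GradedSym 𝒜 ℳ} (hT : IsDerivation e T)
    (hTm : ∀ i x, x ∈ deg 𝒜 ℳ i → T x ∈ deg 𝒜 ℳ (i + e))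
    (h : ∀ x, T (T (gen 𝒜 ℳ x)) = 0) (x : GradedSym 𝒜 ℳ) : T (T x) = 0 := by
  have h1 := (hT.commutator hT hTm hTm).ext
    (T' := 0) (fun x y => by simp) (fun i x _ => by simp [h])
  have h2 := LinearMap.congr_fun h1 x
  rw [he, LinearMap.sub_apply, Units.neg_smul, one_smul, LinearMap.neg_apply, sub_neg_eq_add,
    ← two_smul 𝕜] at h2
  exact (smul_eq_zero.1 h2).resolve_left two_ne_zero

theorem DGModuleStructure.symDiff_symDiff [CharZero 𝕜] (X : DGModuleStructure D ℳ)
    (x : GradedSym 𝒜 ℳ) : X.symDiff (X.symDiff x) = 0 := by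
  refine (DGLieRinehartStructure.symDiff_isDerivation X).sq_eq_zero (by simp)
    (DGLieRinehartStructure.symDiff_mem X) (fun x => ?_) x
  rw [DGLieRinehartStructure.symDiff_gen, DGLieRinehartStructure.symDiff_gen]
  simp only [LinearMap.prodMap_apply, D.isDifferential.sq, X.isDifferential.sq]
  exact map_zero _

namespace LinearContraction

variable (c : LinearContraction X Y)

theorem symP_mem (i : ℤ) (x : GradedSym 𝒜 ℳ) (hx : x ∈ deg 𝒜 ℳ i) : c.symP x ∈ deg 𝒜 𝒩 i :=
  GradedSym.map_mem _ _ _ hx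

theorem symJ_mem (i : ℤ) (x : GradedSym 𝒜 𝒩) (hx : x ∈ deg 𝒜 𝒩 i) : c.symJ x ∈ deg 𝒜 ℳ i :=
  GradedSym.map_mem _ _ _ hx

theorem symP_gen (x : A × M) : c.symP (gen 𝒜 ℳ x) = gen 𝒜 𝒩 (x.1, c.p x.2) := by
  simp [symP, GradedSym.map]

theorem symJ_gen (x : A × N) : c.symJ (gen 𝒜 𝒩 x) = gen 𝒜 ℳ (x.1, c.j x.2) := by
  simp [symJ, GradedSym.map]

theorem symH'_gen (x : A × M) : c.symH' (gen 𝒜 ℳ x) = gen 𝒜 ℳ (0, c.h x.2) := by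
  simp [symH']

theorem symH'_isDerivation : IsDerivation (-1) c.symH' := derivExt_isDerivation _ _ _

theorem symH'_mem (i : ℤ) (x : GradedSym 𝒜 ℳ) (hx : x ∈ deg 𝒜 ℳ i) :
    c.symH' x ∈ deg 𝒜 ℳ (i + -1) := derivExt_mem _ _ _ hx

theorem symP_symJ (u : GradedSym 𝒜 𝒩) : c.symP (c.symJ u) = u := by
  have : c.symP.comp c.symJ = AlgHom.id 𝕜 _ := hom_ext fun x => by
    simp [symP_gen, symJ_gen, c.isContraction.p_j]
  exact DFunLike.congr_fun this u

theorem symP_symDiff (u : GradedSym 𝒜 ℳ) : c.symP (X.symDiff u) = Y.symDiff (c.symP u) :=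
  (DGLieRinehartStructure.symDiff_isDerivation X).map_ext
    (DGLieRinehartStructure.symDiff_isDerivation Y) c.symP_mem (fun x => by
      simp [DGLieRinehartStructure.symDiff_gen, symP_gen, c.isContraction.p_d]) u

theorem symJ_symDiff (u : GradedSym 𝒜 𝒩) : c.symJ (Y.symDiff u) = X.symDiff (c.symJ u) :=
  (DGLieRinehartStructure.symDiff_isDerivation Y).map_ext
    (DGLieRinehartStructure.symDiff_isDerivation X) c.symJ_mem (fun x => by
      simp [DGLieRinehartStructure.symDiff_gen, symJ_gen, c.isContraction.j_d]) u

theorem symP_symH' (u : GradedSym 𝒜 ℳ) : c.symP (c.symH' u) = 0 :=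
  c.symH'_isDerivation.map_ext (T' := (0 : GradedSym 𝒜 𝒩 →ₗ[𝕜] GradedSym 𝒜 𝒩))
    (fun x y => by simp) c.symP_mem (fun x => by
      rw [symH'_gen, symP_gen, c.isContraction.p_h]; exact map_zero _) u

theorem symH'_symH' [CharZero 𝕜] (u : GradedSym 𝒜 ℳ) : c.symH' (c.symH' u) = 0 :=
  c.symH'_isDerivation.sq_eq_zero (by simp) c.symH'_mem (fun x => by
    rw [symH'_gen, symH'_gen, c.isContraction.h_h]; exact map_zero _) u

/-- The Euler derivation `h' δ + δ h'`; it counts the factors in `ker p`. -/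
def euler : GradedSym 𝒜 ℳ →ₗ[𝕜] GradedSym 𝒜 ℳ := c.symH' ∘ₗ X.symDiff + X.symDiff ∘ₗ c.symH'

theorem euler_apply (u : GradedSym 𝒜 ℳ) :
    c.euler u = c.symH' (X.symDiff u) + X.symDiff (c.symH' u) := rfl

theorem euler_gen (x : A × M) : c.euler (gen 𝒜 ℳ x) = gen 𝒜 ℳ (0, x.2 - c.j (c.p x.2)) := by
  rw [euler_apply, DGLieRinehartStructure.symDiff_gen, symH'_gen, symH'_gen,
    DGLieRinehartStructure.symDiff_gen, ← map_add, ← c.isContraction.homotopy]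
  simp

theorem euler_mul (u v : GradedSym 𝒜 ℳ) : c.euler (u * v) = c.euler u * v + u * c.euler v := by
  have h1 := c.symH'_isDerivation.commutator (DGLieRinehartStructure.symDiff_isDerivation X)
    c.symH'_mem (DGLieRinehartStructure.symDiff_mem X) u v
  simpa [signTwist_zero, euler_apply] using h1

theorem euler_symDiff [CharZero 𝕜] (u : GradedSym 𝒜 ℳ) :
    c.euler (X.symDiff u) = X.symDiff (c.euler u) := by
  simp [euler_apply, DGModuleStructure.symDiff_symDiff]

theorem euler_symH' [CharZero 𝕜] (u : GradedSym 𝒜 ℳ) :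
    c.euler (c.symH' u) = c.symH' (c.euler u) := by
  simp [euler_apply, symH'_symH']

theorem euler_symJ (w : GradedSym 𝒜 𝒩) : c.euler (c.symJ w) = 0 := by
  induction w using GradedSym.induction with
  | hgen x =>
    rw [symJ_gen, euler_gen, c.isContraction.p_j, sub_self]
    exact map_zero _
  | hadd x y hx hy => simp only [map_add, hx, hy, add_zero]
  | hmul x y hx hy => rw [map_mul, euler_mul, hx, hy, zero_mul, mul_zero, add_zero]

theorem symH'_symJ (w : GradedSym 𝒜 𝒩) : c.symH' (c.symJ w) = 0 := by
  induction w using GradedSym.induction with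
  | hgen x =>
    rw [symJ_gen, symH'_gen, c.isContraction.h_j]
    exact map_zero _
  | hadd x y hx hy => simp only [map_add, hx, hy, add_zero]
  | hmul x y hx hy =>
    rw [map_mul, c.symH'_isDerivation, hx, hy, zero_mul, mul_zero, add_zero]

/-- The component `S_A N ⊗_A S_A^i (ker p)` of `S_A M`. -/
def weight (i : ℕ) : Submodule 𝕜 (GradedSym 𝒜 ℳ) where
  -- These are the properties of the weight component that are used later: the grading by t, the
  -- Euler eigenvalue, membership in the image of j in weight 0, and annihilation by p in positive
  -- weight. They are stable under linear combinations and compatible with products, so they can be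
  -- propagated from generators.
  carrier := {u | c.weightMap u = Polynomial.monomial i u ∧ c.euler u = (i : 𝕜) • u ∧
    (i = 0 → ∃ w, c.symJ w = u) ∧ (i ≠ 0 → c.symP u = 0)}
  zero_mem' := by simpa using fun _ => ⟨0, map_zero _⟩
  add_mem' := by
    rintro u v ⟨h1, h2, h3, h4⟩ ⟨k1, k2, k3, k4⟩
    refine ⟨by rw [map_add, h1, k1, map_add], by rw [map_add, h2, k2, smul_add], fun hi => ?_,
      fun hi => by rw [map_add, h4 hi, k4 hi, add_zero]⟩
    obtain ⟨w, rfl⟩ := h3 hi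
    obtain ⟨w', rfl⟩ := k3 hi
    exact ⟨w + w', map_add _ _ _⟩
  smul_mem' := by
    rintro r u ⟨h1, h2, h3, h4⟩
    refine ⟨by rw [map_smul, h1, Polynomial.smul_monomial], by rw [map_smul, h2, smul_comm],
      fun hi => ?_, fun hi => by rw [map_smul, h4 hi, smul_zero]⟩
    obtain ⟨w, rfl⟩ := h3 hi
    exact ⟨r • w, map_smul _ _ _⟩

theorem mul_mem_weight {i k : ℕ} {u v : GradedSym 𝒜 ℳ} (hu : u ∈ c.weight i)
    (hv : v ∈ c.weight k) : u * v ∈ c.weight (i + k) := by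
  obtain ⟨h1, h2, h3, h4⟩ := hu
  obtain ⟨k1, k2, k3, k4⟩ := hv
  refine ⟨by rw [map_mul, h1, k1, Polynomial.monomial_mul_monomial], ?_, fun hi => ?_, fun hi => ?_⟩
  · rw [euler_mul, h2, k2, smul_mul_assoc, mul_smul_comm, Nat.cast_add, add_smul]
  · obtain ⟨w, rfl⟩ := h3 (by omega)
    obtain ⟨w', rfl⟩ := k3 (by omega)
    exact ⟨w * w', map_mul _ _ _⟩
  · rw [map_mul]
    by_cases hi' : i = 0
    · rw [k4 (by omega), mul_zero]
    · rw [h4 hi', zero_mul]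

theorem symJ_mem_weight (w : GradedSym 𝒜 𝒩) : c.symJ w ∈ c.weight 0 :=
  ⟨by rw [weightMap_symJ]; rfl, by rw [euler_symJ, Nat.cast_zero, zero_smul], fun _ => ⟨w, rfl⟩,
    fun h => absurd rfl h⟩

/-- A generator splits into its jp-part of weight 0 and its (1 - jp)-part of weight 1, and weights
add under multiplication. -/
theorem mem_iSup_weight (u : GradedSym 𝒜 ℳ) : u ∈ ⨆ i, c.weight i := by
  refine GradedSym.induction (fun x => ?_) (fun x y hx hy => add_mem hx hy)
    (fun x y hx hy => ?_) u
  · have h1 : gen 𝒜 ℳ x = c.symJ (gen 𝒜 𝒩 (x.1, c.p x.2)) +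
        gen 𝒜 ℳ (0, x.2 - c.j (c.p x.2)) := by
      rw [symJ_gen, ← map_add]
      simp
    rw [h1]
    refine add_mem (Submodule.mem_iSup_of_mem 0 (c.symJ_mem_weight _))
      (Submodule.mem_iSup_of_mem 1 ⟨?_, ?_, fun h => absurd h one_ne_zero, fun _ => ?_⟩)
    · have := c.weightMap_prod [x.2 - c.j (c.p x.2)] (by simp [c.isContraction.p_j])
      simp only [List.map_cons, List.map_nil, List.prod_cons, List.prod_nil, mul_one,
        List.length_singleton] at this
      rw [this, Polynomial.C_mul_X_pow_eq_monomial]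
    · rw [euler_gen]
      simp [c.isContraction.p_j]
    · rw [symP_gen, map_sub, c.isContraction.p_j, sub_self]
      exact map_zero _
  · refine Submodule.iSup_induction _ (motive := fun x => x * y ∈ ⨆ n, c.weight n) hx
      (fun i x hx => ?_) (by simp) (fun a b ha hb => by rw [add_mul]; exact add_mem ha hb)
    refine Submodule.iSup_induction _ (motive := fun y => x * y ∈ ⨆ n, c.weight n) hy
      (fun j y hy => ?_) (by simp) (fun a b ha hb => by rw [mul_add]; exact add_mem ha hb)
    exact Submodule.mem_iSup_of_mem (i + j) (c.mul_mem_weight hx hy)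

theorem weight_induction {motive : GradedSym 𝒜 ℳ → Prop}
    (hw : ∀ i u, u ∈ c.weight i → motive u)
    (hadd : ∀ u v, motive u → motive v → motive (u + v)) (u : GradedSym 𝒜 ℳ) : motive u :=
  Submodule.iSup_induction _ (motive := motive) (c.mem_iSup_weight u) hw
    (hw 0 0 (zero_mem _)) hadd

/-- Linear maps that agree on all weight components are equal. -/
theorem weight_ext {E : Type*} [AddCommGroup E] [Module 𝕜 E] {S T : GradedSym 𝒜 ℳ →ₗ[𝕜] E}
    (h : ∀ i u, u ∈ c.weight i → S u = T u) : S = T :=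
  LinearMap.ext fun u => c.weight_induction h (fun u v hu hv => by rw [map_add, map_add, hu, hv]) u

/-- In characteristic 0 the Euler eigenvalues of different weights are distinct, so an eigenvector
has a single weight component. It applies to δu and h'u, because E commutes with δ and h'. -/
theorem weightMap_of_euler [CharZero 𝕜] {i : ℕ} {u : GradedSym 𝒜 ℳ}
    (hu : c.euler u = (i : 𝕜) • u) : c.weightMap u = Polynomial.monomial i u := by
  have h1 : ∀ k v, (c.weightMap (c.euler v)).coeff k = (k : 𝕜) • (c.weightMap v).coeff k := by
    intro k v
    induction v using c.weight_induction with
    | hw i v hv =>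
      rw [hv.2.1, map_smul, hv.1, Polynomial.smul_monomial, Polynomial.coeff_monomial,
        Polynomial.coeff_monomial]
      split_ifs with h
      · rw [h]
      · rw [smul_zero]
    | hadd v w hv hw => simp only [map_add, Polynomial.coeff_add, hv, hw, smul_add]
  have h2 : ∀ v, Polynomial.lsum
      (fun _ : ℕ => (LinearMap.id : GradedSym 𝒜 ℳ →ₗ[𝕜] GradedSym 𝒜 ℳ)) (c.weightMap v) = v := by
    intro v
    induction v using c.weight_induction with
    | hw i v hv =>
      rw [hv.1, Polynomial.lsum_apply, Polynomial.sum_monomial_index _ _ (by simp)]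
      rfl
    | hadd v w hv hw => simp only [map_add, hv, hw]
  have h3 : c.weightMap u = Polynomial.monomial i ((c.weightMap u).coeff i) := by
    ext k : 1
    rw [Polynomial.coeff_monomial]
    split_ifs with h
    · rw [h]
    · have h4 := h1 k u
      rw [hu, map_smul, Polynomial.coeff_smul, ← sub_eq_zero, ← sub_smul] at h4
      refine (smul_eq_zero.1 h4).resolve_left ?_
      rw [← ne_eq, sub_ne_zero]
      exact_mod_cast h
  have h4 := h2 u
  rw [h3, Polynomial.lsum_apply, Polynomial.sum_monomial_index _ _ (by simp)] at h4
  rw [h3, show (c.weightMap u).coeff i = u from h4]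

theorem symH_of_weightMap {i : ℕ} {u : GradedSym 𝒜 ℳ}
    (hu : c.weightMap u = Polynomial.monomial i u) : c.symH u = (i : 𝕜)⁻¹ • c.symH' u := by
  rw [symH, LinearMap.comp_apply, AlgHom.toLinearMap_apply, hu, Polynomial.lsum_apply,
    Polynomial.sum_monomial_index _ _ (by simp)]
  rfl

theorem symH_of_mem {i : ℕ} {u : GradedSym 𝒜 ℳ} (hu : u ∈ c.weight i) :
    c.symH u = (i : 𝕜)⁻¹ • c.symH' u := c.symH_of_weightMap hu.1

theorem symH_symJ (w : GradedSym 𝒜 𝒩) : c.symH (c.symJ w) = 0 := by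
  rw [c.symH_of_mem (c.symJ_mem_weight w), Nat.cast_zero, inv_zero, zero_smul]

/-- The derivation h' preserves the weight because it commutes with E, so on each weight component
h² is a scalar multiple of h'², which is zero. -/
theorem symH_symH [CharZero 𝕜] (u : GradedSym 𝒜 ℳ) : c.symH (c.symH u) = 0 := by
  have : c.symH ∘ₗ c.symH = 0 := c.weight_ext fun i u hu => by
    have h1 : c.weightMap (c.symH' u) = Polynomial.monomial i (c.symH' u) :=
      c.weightMap_of_euler (by rw [euler_symH', hu.2.1, map_smul])
    rw [LinearMap.comp_apply, c.symH_of_mem hu, map_smul, c.symH_of_weightMap h1, symH'_symH',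
      smul_zero, smul_zero]
    rfl
  exact LinearMap.congr_fun this u

theorem symP_symH (u : GradedSym 𝒜 ℳ) : c.symP (c.symH u) = 0 := by
  have : c.symP.toLinearMap ∘ₗ c.symH = 0 := c.weight_ext fun i u hu => by
    rw [LinearMap.comp_apply, c.symH_of_mem hu, map_smul, AlgHom.toLinearMap_apply, symP_symH',
      smul_zero]
    rfl
  exact LinearMap.congr_fun this u

/-- `h E = h'` for the Euler derivation `E`. -/
theorem symH_euler [CharZero 𝕜] (u : GradedSym 𝒜 ℳ) : c.symH (c.euler u) = c.symH' u := by
  have : c.symH ∘ₗ c.euler = c.symH' := c.weight_ext fun i u hu => by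
    rw [LinearMap.comp_apply, hu.2.1, map_smul, c.symH_of_mem hu, smul_smul]
    by_cases hi : i = 0
    · obtain ⟨w, rfl⟩ := hu.2.2.1 hi
      rw [symH'_symJ, smul_zero]
    · rw [mul_inv_cancel₀ (by exact_mod_cast hi), one_smul]
  exact LinearMap.congr_fun this u

theorem symP_euler (u : GradedSym 𝒜 ℳ) : c.symP (c.euler u) = 0 := by
  rw [euler_apply, map_add, symP_symH', symP_symDiff, symP_symH', map_zero, add_zero]

/-- In weight i > 0 the differential preserves the weight, so the left side is E/i, the identity,
while p vanishes. In weight 0 the element is in the image of j, where h vanishes. -/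
theorem symH_homotopy [CharZero 𝕜] (u : GradedSym 𝒜 ℳ) :
    c.symH (X.symDiff u) + X.symDiff (c.symH u) = u - c.symJ (c.symP u) := by
  induction u using c.weight_induction with
  | hw i u hu =>
    by_cases hi : i = 0
    · obtain ⟨w, rfl⟩ := hu.2.2.1 hi
      rw [symP_symJ, ← symJ_symDiff, symH_symJ, symH_symJ, map_zero, add_zero, sub_self]
    · have h1 : c.weightMap (X.symDiff u) = Polynomial.monomial i (X.symDiff u) :=
        c.weightMap_of_euler (by rw [euler_symDiff, hu.2.1, map_smul])
      rw [c.symH_of_weightMap h1, c.symH_of_mem hu, map_smul, ← smul_add, ← euler_apply, hu.2.1,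
        smul_smul, inv_mul_cancel₀ (by exact_mod_cast hi), one_smul, hu.2.2.2 hi, map_zero,
        sub_zero]
  | hadd u v hu hv =>
    simp only [map_add]
    rw [add_add_add_comm, hu, hv]
    abel

theorem weightMap_coeff_mem {n : ℤ} {u : GradedSym 𝒜 ℳ} (hu : u ∈ deg 𝒜 ℳ n) (k : ℕ) :
    (c.weightMap u).coeff k ∈ deg 𝒜 ℳ n := by
  refine deg_induction (motive := fun n u => ∀ k, (c.weightMap u).coeff k ∈ deg 𝒜 ℳ n)
    (fun i x hx k => ?_) (by simp) (fun n x y hx hy k => ?_)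
    (fun i j x y _ _ hx hy k => ?_) hu k
  · have hjp : c.j (c.p x.2) ∈ ℳ i := c.isContraction.j_mem (c.isContraction.p_mem hx.2)
    rw [weightMap, lift_gen]
    simp only [weightGen, LinearMap.coe_mk, AddHom.coe_mk, Polynomial.coeff_add, Polynomial.coeff_C,
      Polynomial.coeff_C_mul, Polynomial.coeff_X]
    refine add_mem ?_ ?_
    · split_ifs
      · exact gen_mem ⟨hx.1, hjp⟩
      · exact zero_mem _
    · split_ifs
      · rw [mul_one]; exact gen_mem ⟨zero_mem _, sub_mem hx.2 hjp⟩
      · rw [mul_zero]; exact zero_mem _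
  · rw [map_add, Polynomial.coeff_add]; exact add_mem (hx k) (hy k)
  · rw [map_mul, Polynomial.coeff_mul]
    exact Submodule.sum_mem _ fun p _ => SetLike.GradedMul.mul_mem (hx _) (hy _)

theorem symH_mem {i : ℤ} {u : GradedSym 𝒜 ℳ} (hu : u ∈ deg 𝒜 ℳ i) :
    c.symH u ∈ deg 𝒜 ℳ (i - 1) := by
  rw [symH, LinearMap.comp_apply, AlgHom.toLinearMap_apply, Polynomial.lsum_apply]
  exact Submodule.sum_mem _ fun k _ => Submodule.smul_mem _ _
    (c.symH'_mem _ _ (c.weightMap_coeff_mem hu k))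

/-- The extended maps are contraction data. -/
theorem isContraction_sym [CharZero 𝕜] : IsContraction (deg 𝒜 ℳ) X.symDiff (deg 𝒜 𝒩) Y.symDiff
    c.symP.toLinearMap c.symJ.toLinearMap c.symH where
  diff_source := ⟨DGLieRinehartStructure.symDiff_mem X _ _, X.symDiff_symDiff⟩
  diff_target := ⟨DGLieRinehartStructure.symDiff_mem Y _ _, Y.symDiff_symDiff⟩
  p_mem := c.symP_mem _ _
  j_mem := c.symJ_mem _ _
  h_mem := c.symH_mem
  p_d := c.symP_symDiff
  j_d := c.symJ_symDiff
  p_j := c.symP_symJ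
  homotopy := c.symH_homotopy
  h_h := c.symH_symH
  h_j := c.symH_symJ
  p_h := c.symP_symH

/-- Generators have weights 0 and 1 only, where no proper division occurs; so h still extends the
given homotopy, as naturality along the generators requires. -/
theorem symH_gen [CharZero 𝕜] (x : A × M) : c.symH (gen 𝒜 ℳ x) = gen 𝒜 ℳ (0, c.h x.2) := by
  have h1 : gen 𝒜 ℳ x = c.symJ (gen 𝒜 𝒩 (x.1, c.p x.2)) + c.euler (gen 𝒜 ℳ x) := by
    rw [symJ_gen, euler_gen, ← map_add]
    simp
  rw [h1, map_add, symH_symJ, zero_add, symH_euler, symH'_gen]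

end LinearContraction

end SymContractionProof

end

end StrongHomotopy

namespace StrongHomotopy

noncomputable section

/-! ### The transferred operations on `S_A N` are multiderivations -/

section Support

variable {𝕜 X Y Z : Type*} [Field 𝕜] [AddCommGroup X] [Module 𝕜 X] [AddCommGroup Y] [Module 𝕜 Y]
  [AddCommGroup Z] [Module 𝕜 Z] {n : ℕ} {d : Fin n → ℤ}

/-- `f I` vanishes unless `I` has at least `r` elements. -/
def SupportedGE (r : ℕ) (f : Finset (Fin n) → X) : Prop := ∀ I, I.card < r → f I = 0

theorem SupportedGE.mono {r s : ℕ} (h : s ≤ r) {f : Finset (Fin n) → X} (hf : SupportedGE r f) :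
    SupportedGE s f := fun I hI => hf I (hI.trans_le h)

theorem SupportedGE.eq_zero {r : ℕ} {f : Finset (Fin n) → X} (hf : SupportedGE r f) (hr : n < r) :
    f = 0 := by
  ext I
  refine hf I (lt_of_le_of_lt ?_ hr)
  exact (Finset.card_le_univ I).trans_eq (Fintype.card_fin n)

theorem SupportedGE.comp {r : ℕ} {f : Finset (Fin n) → X} (hf : SupportedGE r f) (φ : X →ₗ[𝕜] Y) :
    SupportedGE r (comp φ f) := fun I hI => by rw [comp_apply, hf I hI, map_zero]

theorem SupportedGE.conv {𝒴 : ℤ → Submodule 𝕜 Y} [DirectSum.Decomposition 𝒴]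
    {b : X →ₗ[𝕜] Y →ₗ[𝕜] Z} {r s : ℕ} {f : Finset (Fin n) → X} {g : Finset (Fin n) → Y}
    (hf : SupportedGE r f) (hg : SupportedGE s g) :
    SupportedGE (r + s) (conv d 𝒴 b f g) := fun L hL => by
  rw [conv_apply, sum2]
  refine Finset.sum_eq_zero fun I hI => ?_
  have h1 := Finset.card_sdiff_add_card_eq_card (Finset.mem_powerset.1 hI)
  by_cases h2 : I.card < r
  · rw [hf I h2, map_zero, LinearMap.zero_apply, smul_zero]
  · rw [hg (L \ I) (by omega), map_zero, map_zero, smul_zero]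

theorem SupportedGE.totalTwist {𝒳 : ℤ → Submodule 𝕜 X} [DirectSum.Decomposition 𝒳] {r : ℕ}
    {f : Finset (Fin n) → X} (hf : SupportedGE r f) : SupportedGE r (totalTwist d 𝒳 f) :=
  fun I hI => by rw [totalTwist_apply, hf I hI, map_zero, smul_zero]

theorem supportedGE_single (I : Finset (Fin n)) (u : X) :
    SupportedGE I.card (Pi.single I u : Finset (Fin n) → X) := fun J hJ => by
  rw [Pi.single_eq_of_ne]
  rintro rfl
  exact lt_irrefl _ hJ

theorem supportedGE_sum_single {r : ℕ} {f : Finset (Fin n) → X} (hf : SupportedGE r f) :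
    f = ∑ I ∈ Finset.univ.filter (fun I => r ≤ I.card), Pi.single I (f I) := by
  conv_lhs => rw [← Finset.univ_sum_single f]
  refine (Finset.sum_subset (Finset.filter_subset _ _) fun I _ hI => ?_).symm
  rw [hf I (by simpa using hI), Pi.single_zero]

theorem comp_single (T : X →ₗ[𝕜] Y) (I : Finset (Fin n)) (u : X) :
    comp T (Pi.single I u) = Pi.single I (T u) := by
  ext J
  rw [comp_apply]
  by_cases h : J = I
  · subst h; simp
  · simp [h]

theorem comp_totalTwist_neg {𝒳 : ℤ → Submodule 𝕜 X} [DirectSum.Decomposition 𝒳] {D : X →ₗ[𝕜] X}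
    (hD : ∀ i x, x ∈ 𝒳 i → D x ∈ 𝒳 (i + -1)) (f : Finset (Fin n) → X) :
    totalTwist d 𝒳 (comp D f) = -comp D (totalTwist d 𝒳 f) := by
  ext I
  rw [Pi.neg_apply, comp_apply, totalTwist_apply, totalTwist_apply, map_sign_smul,
    map_signTwist hD, comp_apply, ← smul_neg]
  simp

theorem totalTwist_const {𝒳 : ℤ → Submodule 𝕜 X} [DirectSum.Decomposition 𝒳] {i : ℤ} {x : X}
    (hx : x ∈ 𝒳 i) :
    totalTwist d 𝒳 (const (𝕜 := 𝕜) x) = i.negOnePow • const (𝕜 := 𝕜) x := by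
  ext I
  rw [totalTwist_apply, Pi.smul_apply, const_apply]
  split_ifs with h
  · rw [h, eps_empty, Int.negOnePow_zero, one_smul, signTwist_of_mem _ _ hx, one_mul]
  · simp

/-- The product of functions `Finset (Fin n) → R`, by the Koszul rule. -/
abbrev convMul {R : Type*} [Ring R] [Algebra 𝕜 R] (d : Fin n → ℤ) (ℛ : ℤ → Submodule 𝕜 R)
    [GradedAlgebra ℛ] : (Finset (Fin n) → R) →ₗ[𝕜] (Finset (Fin n) → R) →ₗ[𝕜]
      (Finset (Fin n) → R) := conv d ℛ (LinearMap.mul 𝕜 R)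

theorem comp_convMul_derivation {R : Type*} [Ring R] [Algebra 𝕜 R] {ℛ : ℤ → Submodule 𝕜 R}
    [GradedAlgebra ℛ] {T : R →ₗ[𝕜] R} (hTm : ∀ i x, x ∈ ℛ i → T x ∈ ℛ (i + -1))
    (hT : ∀ x y, T (x * y) = T x * y + signTwist ℛ (-1) x * T y) (f g : Finset (Fin n) → R) :
    comp T (convMul d ℛ f g) = convMul d ℛ (comp T f) g +
      convMul d ℛ (totalTwist d ℛ f) (comp T g) := by
  have h1 : ∀ x, signTwist ℛ (-1) x = signTwist ℛ 1 x := by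
    intro x
    induction x using DirectSum.Decomposition.inductionOn ℛ with
    | zero => simp
    | add x y hx hy => rw [map_add, map_add, hx, hy]
    | homogeneous x => rw [signTwist_of_mem _ _ x.2, signTwist_of_mem _ _ x.2]; simp
  ext L
  rw [Pi.add_apply, comp_apply, conv_apply, conv_apply, conv_apply, sum2_add, map_sum2]
  refine sum2_congr fun I J _ _ => ?_
  rw [map_sign_smul]
  simp only [LinearMap.mul_apply', hT, h1, comp_apply, map_signTwist hTm, totalTwist_apply,
    smul_mul_assoc, mul_smul_comm, smul_add, smul_smul]
  simp

end Support

/-! ### The perturbed projection and its multiplicativity -/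

section Multiderivation

open GradedSym

variable {𝕜 A M N : Type*} [Field 𝕜] [Ring A] [Algebra 𝕜 A]
  [AddCommGroup M] [Module 𝕜 M] [Module A M] [IsScalarTower 𝕜 A M]
  [AddCommGroup N] [Module 𝕜 N] [Module A N] [IsScalarTower 𝕜 A N]
  {𝒜 : ℤ → Submodule 𝕜 A} [GradedAlgebra 𝒜]
  {ℳ : ℤ → Submodule 𝕜 M} [DirectSum.Decomposition ℳ] [SetLike.GradedSMul 𝒜 ℳ]
  {𝒩 : ℤ → Submodule 𝕜 N} [DirectSum.Decomposition 𝒩] [SetLike.GradedSMul 𝒜 𝒩]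
  {D : DGCommStructure 𝒜} {X : DGLieRinehartStructure D ℳ} {Y : DGModuleStructure D 𝒩}
  (c : LinearContraction X.toDGModuleStructure Y)
  {n : ℕ} (d : Fin n → ℤ) (Ψ : Finset (Fin n) → GradedSym 𝒜 ℳ)

/-- The perturbation `-2 {Ψ, ·}` of the differential. -/
def perturbation (X : DGLieRinehartStructure D ℳ) (d : Fin n → ℤ)
    (Ψ : Finset (Fin n) → GradedSym 𝒜 ℳ) :
    (Finset (Fin n) → GradedSym 𝒜 ℳ) →ₗ[𝕜] (Finset (Fin n) → GradedSym 𝒜 ℳ) :=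
  -((2 : ℤ) • conv d (deg 𝒜 ℳ) X.poisson Ψ)

/-- The perturbed projection `p ∑_k (t h)^k`, where `t = -2 {Ψ, ·}`. -/
def perturbedP : (Finset (Fin n) → GradedSym 𝒜 ℳ) →ₗ[𝕜] (Finset (Fin n) → GradedSym 𝒜 𝒩) :=
  comp c.symP.toLinearMap ∘ₗ
    ∑ k ∈ Finset.range (n + 1), (perturbation X d Ψ ∘ₗ comp c.symH) ^ k

variable {d Ψ}

/-- Since Ψ has no constant term, the perturbation raises the order in the parameters. With n
parameters, this makes the series of the perturbed projection terminate. -/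
theorem perturbation_supportedGE (h0 : Ψ ∅ = 0) {r : ℕ} {f : Finset (Fin n) → GradedSym 𝒜 ℳ}
    (hf : SupportedGE r f) : SupportedGE (r + 1) (perturbation X d Ψ f) := by
  have hΨ : SupportedGE 1 Ψ := fun I hI => by
    rw [Finset.card_eq_zero.1 (Nat.lt_one_iff.1 hI), h0]
  intro I hI
  have := SupportedGE.conv (d := d) (𝒴 := deg 𝒜 ℳ) (b := X.poisson) hΨ hf I (by omega)
  rw [perturbation, LinearMap.neg_apply, LinearMap.smul_apply, Pi.neg_apply, Pi.smul_apply, this,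
    smul_zero, neg_zero]

theorem pow_supportedGE (h0 : Ψ ∅ = 0) (k : ℕ) {r : ℕ} {f : Finset (Fin n) → GradedSym 𝒜 ℳ}
    (hf : SupportedGE r f) :
    SupportedGE (r + k) (((perturbation X d Ψ ∘ₗ comp c.symH) ^ k) f) := by
  induction k with
  | zero => exact hf
  | succ k ih =>
    rw [pow_succ', Module.End.mul_apply, LinearMap.comp_apply]
    exact perturbation_supportedGE h0 (ih.comp _)

/-- The recursion P = p + P t h of the perturbation lemma: the sums telescope, and the term of order
n + 1 is zero by nilpotency. -/
theorem perturbedP_eq (h0 : Ψ ∅ = 0) (f : Finset (Fin n) → GradedSym 𝒜 ℳ) :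
    perturbedP c d Ψ f = comp c.symP.toLinearMap f +
      perturbedP c d Ψ (perturbation X d Ψ (comp c.symH f)) := by
  have h1 := (pow_supportedGE c h0 (n + 1) (d := d) (r := 0) (f := f)
    (fun I hI => absurd hI (Nat.not_lt_zero _))).eq_zero (by omega)
  rw [perturbedP, LinearMap.comp_apply, LinearMap.comp_apply, ← map_add]
  congr 1
  have h2 : ∀ k, ((perturbation X d Ψ ∘ₗ comp c.symH) ^ k)
      (perturbation X d Ψ (comp c.symH f)) =
        ((perturbation X d Ψ ∘ₗ comp c.symH) ^ (k + 1)) f := fun k => by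
    rw [pow_succ, Module.End.mul_apply, LinearMap.comp_apply]
  rw [LinearMap.sum_apply, LinearMap.sum_apply]
  simp only [h2]
  rw [Finset.sum_range_succ', Finset.sum_range_succ _ n, h1, add_zero, pow_zero,
    Module.End.one_apply, add_comm]

theorem perturbedP_supportedGE (h0 : Ψ ∅ = 0) {r : ℕ} {f : Finset (Fin n) → GradedSym 𝒜 ℳ}
    (hf : SupportedGE r f) : SupportedGE r (perturbedP c d Ψ f) := by
  rw [perturbedP, LinearMap.comp_apply]
  refine SupportedGE.comp (fun I hI => ?_) _
  rw [LinearMap.sum_apply, Finset.sum_apply]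
  exact Finset.sum_eq_zero fun k _ => ((pow_supportedGE c h0 k hf).mono (by omega)) I hI

/-- Follows from ph' = 0 and hh' = hhE = 0. -/
theorem perturbedP_comp_symH' [CharZero 𝕜] (h0 : Ψ ∅ = 0)
    (f : Finset (Fin n) → GradedSym 𝒜 ℳ) : perturbedP c d Ψ (comp c.symH' f) = 0 := by
  rw [perturbedP_eq c h0]
  have h1 : comp c.symP.toLinearMap (comp c.symH' f) = 0 := by
    ext I; exact c.symP_symH' _
  have h2 : comp c.symH (comp c.symH' f) = 0 := by
    ext I
    rw [comp_apply, comp_apply, ← c.symH_euler, c.symH_symH]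
    rfl
  rw [h1, h2, map_zero, map_zero, add_zero]

theorem perturbedP_comp_symJ (h0 : Ψ ∅ = 0) (f : Finset (Fin n) → GradedSym 𝒜 𝒩) :
    perturbedP c d Ψ (comp c.symJ.toLinearMap f) = f := by
  rw [perturbedP_eq c h0]
  have h1 : comp c.symP.toLinearMap (comp c.symJ.toLinearMap f) = f := by
    ext I; exact c.symP_symJ _
  have h2 : comp c.symH (comp c.symJ.toLinearMap f) = 0 := by
    ext I; exact c.symH_symJ _
  rw [h1, h2, map_zero, map_zero, add_zero]

/-- Follows from pE = 0 and hE = h'. It trades the homotopy h, which is not a derivation, for the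
derivations E and h'. -/
theorem perturbedP_comp_euler [CharZero 𝕜] (h0 : Ψ ∅ = 0) (f : Finset (Fin n) → GradedSym 𝒜 ℳ) :
    perturbedP c d Ψ (comp c.euler f) =
      perturbedP c d Ψ (perturbation X d Ψ (comp c.symH' f)) := by
  rw [perturbedP_eq c h0]
  have h1 : comp c.symP.toLinearMap (comp c.euler f) = 0 := by
    ext I; exact c.symP_euler _
  have h2 : comp c.symH (comp c.euler f) = comp c.symH' f := by
    ext I; exact c.symH_euler _
  rw [h1, h2, zero_add]

theorem perturbation_convMul (hΨ : IsTotal d (deg 𝒜 ℳ) 1 Ψ)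
    (f g : Finset (Fin n) → GradedSym 𝒜 ℳ) :
    perturbation X d Ψ (convMul d (deg 𝒜 ℳ) f g) =
      convMul d (deg 𝒜 ℳ) (perturbation X d Ψ f) g +
        convMul d (deg 𝒜 ℳ) (totalTwist d (deg 𝒜 ℳ) f) (perturbation X d Ψ g) := by
  simp only [perturbation, LinearMap.neg_apply, LinearMap.smul_apply, convMul,
    conv_leibniz X.poisson_mem (fun i v hv x y => X.poisson_isDerivation hv x y) hΨ, map_neg,
    map_zsmul, smul_add, neg_add]

/-- The defect of multiplicativity of the perturbed projection. -/
def defect (d : Fin n → ℤ) (Ψ : Finset (Fin n) → GradedSym 𝒜 ℳ) :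
    (Finset (Fin n) → GradedSym 𝒜 ℳ) →ₗ[𝕜] (Finset (Fin n) → GradedSym 𝒜 ℳ) →ₗ[𝕜]
      (Finset (Fin n) → GradedSym 𝒜 𝒩) :=
  (convMul d (deg 𝒜 ℳ)).compr₂ (perturbedP c d Ψ) -
    (convMul d (deg 𝒜 𝒩)).compl₁₂ (perturbedP c d Ψ) (perturbedP c d Ψ)

theorem defect_apply (f g : Finset (Fin n) → GradedSym 𝒜 ℳ) :
    defect c d Ψ f g = perturbedP c d Ψ (convMul d (deg 𝒜 ℳ) f g) -
      convMul d (deg 𝒜 𝒩) (perturbedP c d Ψ f) (perturbedP c d Ψ g) := rfl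

theorem defect_symJ (h0 : Ψ ∅ = 0) (f g : Finset (Fin n) → GradedSym 𝒜 𝒩) :
    defect c d Ψ (comp c.symJ.toLinearMap f) (comp c.symJ.toLinearMap g) = 0 := by
  rw [defect_apply, perturbedP_comp_symJ c h0, perturbedP_comp_symJ c h0,
    ← comp_conv (ω := c.symJ.toLinearMap) (b := LinearMap.mul 𝕜 _) c.symJ_mem
      (fun x y => map_mul c.symJ x y), perturbedP_comp_symJ c h0, sub_self]

theorem comp_euler_convMul (f g : Finset (Fin n) → GradedSym 𝒜 ℳ) :
    comp c.euler (convMul d (deg 𝒜 ℳ) f g) =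
      convMul d (deg 𝒜 ℳ) (comp c.euler f) g + convMul d (deg 𝒜 ℳ) f (comp c.euler g) := by
  have hE : ∀ i x, x ∈ deg 𝒜 ℳ i → c.euler x ∈ deg 𝒜 ℳ (i + 0) := fun i x hx => by
    have h1 := c.symH'_mem _ _ (DGLieRinehartStructure.symDiff_mem X.toDGModuleStructure _ _ hx)
    have h2 := DGLieRinehartStructure.symDiff_mem X.toDGModuleStructure _ _ (c.symH'_mem _ _ hx)
    rw [show i + 1 + -1 = i + 0 by ring] at h1
    rw [show i + -1 + 1 = i + 0 by ring] at h2
    exact add_mem h1 h2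
  ext L
  rw [Pi.add_apply, comp_apply, conv_apply, conv_apply, conv_apply, sum2_add, map_sum2]
  refine sum2_congr fun I J _ _ => ?_
  rw [map_sign_smul, LinearMap.mul_apply', c.euler_mul, map_signTwist hE]
  simp [smul_add]

/-- If the defect vanishes on functions of larger support, then it is compatible with the Euler
derivation. -/
theorem defect_euler [CharZero 𝕜] (h0 : Ψ ∅ = 0) (hΨ : IsTotal d (deg 𝒜 ℳ) 1 Ψ) {r s : ℕ}
    (h1 : ∀ f g, SupportedGE (r + 1) f → SupportedGE s g → defect c d Ψ f g = 0)
    (h2 : ∀ f g, SupportedGE r f → SupportedGE (s + 1) g → defect c d Ψ f g = 0)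
    {f g : Finset (Fin n) → GradedSym 𝒜 ℳ} (hf : SupportedGE r f) (hg : SupportedGE s g) :
    defect c d Ψ (comp c.euler f) g + defect c d Ψ f (comp c.euler g) = 0 := by
  simp only [defect_apply, sub_eq_zero] at h1 h2
  -- Expand P E(fg) = P t h'(fg) by the Leibniz rules of E, h' and t. In the four terms on the right
  -- t has raised the order of one factor, so P may be distributed over the product; the two mixed
  -- terms vanish by P h' = 0, and in the others P t h' turns back into P E.
  have key := perturbedP_comp_euler c (d := d) h0 (convMul d (deg 𝒜 ℳ) f g)
  rw [comp_euler_convMul, comp_convMul_derivation c.symH'_mem c.symH'_isDerivation, map_add,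
    map_add, map_add, perturbation_convMul hΨ, perturbation_convMul hΨ, map_add, map_add,
    totalTwist_totalTwist,
    h1 _ _ (perturbation_supportedGE h0 (hf.comp _)) hg,
    h2 _ _ (hf.comp _).totalTwist (perturbation_supportedGE h0 hg),
    h1 _ _ (perturbation_supportedGE h0 hf.totalTwist) (hg.comp _),
    h2 _ _ hf (perturbation_supportedGE h0 (hg.comp _)), comp_totalTwist_neg c.symH'_mem, map_neg,
    perturbedP_comp_symH' c h0, perturbedP_comp_symH' c h0, neg_zero, map_zero, map_zero,
    LinearMap.zero_apply, add_zero, zero_add, ← perturbedP_comp_euler c h0,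
    ← perturbedP_comp_euler c h0] at key
  rw [defect_apply, defect_apply, sub_add_sub_comm, key, sub_self]

/-- Descending induction on the order in the parameters, starting where all products vanish. For
factors of weights a and b, `defect_euler` multiplies the defect by a + b, so it vanishes unless a =
b = 0; then both factors come from j, where P inverts j. -/
theorem defect_eq_zero_of_support [CharZero 𝕜] (h0 : Ψ ∅ = 0) (hΨ : IsTotal d (deg 𝒜 ℳ) 1 Ψ) (k : ℕ) :
    ∀ r s : ℕ, n < r + s + k → ∀ f g, SupportedGE r f → SupportedGE s g →
      defect c d Ψ f g = 0 := by
  induction k with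
  | zero =>
    intro r s hrs f g hf hg
    rw [defect_apply, (hf.conv hg).eq_zero hrs,
      ((perturbedP_supportedGE c h0 hf).conv (perturbedP_supportedGE c h0 hg)).eq_zero hrs,
      map_zero, sub_zero]
  | succ k ih =>
    intro r s hrs f g hf hg
    have key : ∀ I J : Finset (Fin n), n < I.card + J.card + (k + 1) → ∀ u v,
        defect c d Ψ (Pi.single I u) (Pi.single J v) = 0 := by
      intro I J hIJ u v
      induction u using c.weight_induction with
      | hadd u u' hu hu' => rw [Pi.single_add, map_add, LinearMap.add_apply, hu, hu', add_zero]
      | hw a u hu =>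
        induction v using c.weight_induction with
        | hadd v v' hv hv' => rw [Pi.single_add, map_add, hv, hv', add_zero]
        | hw b v hv =>
          by_cases hab : a + b = 0
          · obtain ⟨w, rfl⟩ := hu.2.2.1 (by omega)
            obtain ⟨w', rfl⟩ := hv.2.2.1 (by omega)
            have := defect_symJ c (d := d) h0 (Pi.single I w) (Pi.single J w')
            rwa [comp_single, comp_single] at this
          · have h1 := defect_euler c h0 hΨ (r := I.card) (s := J.card) (ih _ _ (by omega))
              (ih _ _ (by omega)) (supportedGE_single I u) (supportedGE_single J v)
            rw [comp_single, comp_single, hu.2.1, hv.2.1, Pi.single_smul, Pi.single_smul, map_smul,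
              map_smul, LinearMap.smul_apply, ← add_smul] at h1
            exact (smul_eq_zero.1 h1).resolve_left (by exact_mod_cast hab)
    rw [supportedGE_sum_single hf, supportedGE_sum_single hg, map_sum]
    refine Finset.sum_eq_zero fun J hJ => ?_
    rw [map_sum, LinearMap.sum_apply]
    refine Finset.sum_eq_zero fun I hI => key I J ?_ _ _
    simp only [Finset.mem_filter, Finset.mem_univ, true_and] at hI hJ
    omega

/-- The perturbed projection is multiplicative. -/
theorem perturbedP_convMul [CharZero 𝕜] (h0 : Ψ ∅ = 0) (hΨ : IsTotal d (deg 𝒜 ℳ) 1 Ψ)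
    (f g : Finset (Fin n) → GradedSym 𝒜 ℳ) :
    perturbedP c d Ψ (convMul d (deg 𝒜 ℳ) f g) =
      convMul d (deg 𝒜 𝒩) (perturbedP c d Ψ f) (perturbedP c d Ψ g) :=
  sub_eq_zero.1 (defect_eq_zero_of_support c h0 hΨ (n + 1) 0 0 (by omega) f g
    (fun _ h => absurd h (Nat.not_lt_zero _)) (fun _ h => absurd h (Nat.not_lt_zero _)))

/-- P t j is an odd derivation over constants: t is a derivation, P is multiplicative, and P j = id.
-/
theorem perturbedP_perturbation_mul [CharZero 𝕜] (h0 : Ψ ∅ = 0) (hΨ : IsTotal d (deg 𝒜 ℳ) 1 Ψ)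
    {i : ℤ} {u : GradedSym 𝒜 𝒩} (hu : u ∈ deg 𝒜 𝒩 i) (v : GradedSym 𝒜 𝒩) :
    perturbedP c d Ψ (perturbation X d Ψ (const (𝕜 := 𝕜) (c.symJ (u * v)))) =
      convMul d (deg 𝒜 𝒩) (perturbedP c d Ψ (perturbation X d Ψ (const (𝕜 := 𝕜) (c.symJ u))))
        (const (𝕜 := 𝕜) v) +
      i.negOnePow • convMul d (deg 𝒜 𝒩) (const (𝕜 := 𝕜) u)
        (perturbedP c d Ψ (perturbation X d Ψ (const (𝕜 := 𝕜) (c.symJ v)))) := by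
  have hj : ∀ w, perturbedP c d Ψ (const (𝕜 := 𝕜) (c.symJ w)) = const (𝕜 := 𝕜) w := fun w => by
    have := perturbedP_comp_symJ c (d := d) h0 (const (𝕜 := 𝕜) w)
    rwa [comp_const] at this
  rw [map_mul, ← LinearMap.mul_apply' (R := 𝕜), ← conv_const_const (d := d) (𝒴 := deg 𝒜 ℳ),
    perturbation_convMul hΨ, map_add, perturbedP_convMul c h0 hΨ, perturbedP_convMul c h0 hΨ,
    totalTwist_const (c.symJ_mem _ _ hu), map_sign_smul, map_sign_smul, hj, hj]
  rfl

variable (X Y)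

/-- The linearised equation is Φ' = t(-jy + hΦ'). Comparing P applied to it with the recursion PΦ' =
pΦ' + P t hΦ' leaves pΦ' = -P t j y. -/
theorem linLam_eq [CharZero 𝕜] {x : Fin n → GradedSym 𝒜 𝒩} (hx : ∀ s, x s ∈ deg 𝒜 𝒩 (d s))
    {m : ℤ} {y : GradedSym 𝒜 𝒩} (hy : y ∈ deg 𝒜 𝒩 m) :
    linLam X.poisson Y.symDiff c.symP.toLinearMap c.symJ.toLinearMap c.symH d x m y =
      const (𝕜 := 𝕜) (Y.symDiff y) - perturbedP c d
        (bigPsi X.poisson c.symJ.toLinearMap c.symH d x)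
        (perturbation X d (bigPsi X.poisson c.symJ.toLinearMap c.symH d x)
          (const (𝕜 := 𝕜) (c.symJ y))) := by
  have h1 := linPhi_eq (j := c.symJ.toLinearMap) (h := c.symH) X.poisson_mem X.poisson_skew
    (fun i w hw => c.symJ_mem i w hw) (fun _ _ hv => c.symH_mem hv) hx hy
  have h2 := linPsi_eq (𝕜 := 𝕜) (br := X.poisson) (j := c.symJ.toLinearMap) (h := c.symH) (d := d)
    (x := x) m y
  rw [linLam, sub_eq_add_neg]
  congr 1
  have h0 := bigPsi_empty (br := X.poisson) (j := c.symJ.toLinearMap) (h := c.symH) (d := d) (x := x)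
  have h3 := perturbedP_eq c h0 (linPhi X.poisson c.symJ.toLinearMap c.symH d x m y) (d := d)
  have h4 : linPhi X.poisson c.symJ.toLinearMap c.symH d x m y =
      perturbation X d (bigPsi X.poisson c.symJ.toLinearMap c.symH d x)
        (linPsi X.poisson c.symJ.toLinearMap c.symH d x m y) := h1
  rw [h2, map_add, map_neg] at h4
  nth_rewrite 1 [h4] at h3
  rw [map_add, map_neg] at h3
  exact (add_right_cancel h3).symm

/-- Both parts of `linLam_eq` are derivations in y. The sign in front of the first term comes from
moving v past the parameters. -/
theorem linLam_mul [CharZero 𝕜] {x : Fin n → GradedSym 𝒜 𝒩} (hx : ∀ s, x s ∈ deg 𝒜 𝒩 (d s))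
    {i j : ℤ} {u v : GradedSym 𝒜 𝒩} (hu : u ∈ deg 𝒜 𝒩 i) (hv : v ∈ deg 𝒜 𝒩 j)
    (L : Finset (Fin n)) :
    linLam X.poisson Y.symDiff c.symP.toLinearMap c.symJ.toLinearMap c.symH d x (i + j) (u * v) L =
      (eps d L * j).negOnePow • (linLam X.poisson Y.symDiff c.symP.toLinearMap c.symJ.toLinearMap
        c.symH d x i u L * v) +
      i.negOnePow • (u * linLam X.poisson Y.symDiff c.symP.toLinearMap c.symJ.toLinearMap
        c.symH d x j v L) := by
  have h0 := bigPsi_empty (br := X.poisson) (j := c.symJ.toLinearMap) (h := c.symH) (d := d) (x := x)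
  have hT := isTotal_bigPsi (d := d) (j := c.symJ.toLinearMap) (h := c.symH) X.poisson_mem
    (fun i w hw => c.symJ_mem i w hw) (fun _ _ hv => c.symH_mem hv) hx
  have h1 := conv_const_right (d := d) (𝒴 := deg 𝒜 𝒩) (LinearMap.mul 𝕜 (GradedSym 𝒜 𝒩))
    (linLam X.poisson Y.symDiff c.symP.toLinearMap c.symJ.toLinearMap c.symH d x i u) hv L
  have h2 := congrFun (conv_const_left (d := d) (𝒴 := deg 𝒜 𝒩) (LinearMap.mul 𝕜 (GradedSym 𝒜 𝒩)) u
    (linLam X.poisson Y.symDiff c.symP.toLinearMap c.symJ.toLinearMap c.symH d x j v)) L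
  rw [LinearMap.mul_apply'] at h1
  rw [comp_apply, LinearMap.mul_apply'] at h2
  rw [← h1, ← h2, linLam_eq X Y c hx (SetLike.GradedMul.mul_mem hu hv), linLam_eq X Y c hx hu,
    linLam_eq X Y c hx hv, perturbedP_perturbation_mul c h0 hT hu,
    DGLieRinehartStructure.symDiff_isDerivation Y, signTwist_of_mem _ _ hu, one_mul, map_sub,
    map_sub, LinearMap.sub_apply, conv_const_const, conv_const_const, map_add, smul_mul_assoc,
    map_sign_smul]
  simp only [Pi.sub_apply, Pi.add_apply, Pi.smul_apply, LinearMap.mul_apply', smul_sub]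
  abel

end Multiderivation

end

end StrongHomotopy

namespace StrongHomotopy

noncomputable section

/-! ### Multilinear maps and homogeneous arguments -/

section Homogeneous

variable {𝕜 V W : Type*} [Field 𝕜] [AddCommGroup V] [Module 𝕜 V] [AddCommGroup W] [Module 𝕜 W]

/-- Multilinear maps that agree on homogeneous arguments are equal. -/
theorem multilinear_ext_homogeneous (𝒲 : ℤ → Submodule 𝕜 W) [DirectSum.Decomposition 𝒲] {k : ℕ}
    {f g : MultilinearMap 𝕜 (fun _ : Fin k => W) V}
    (h : ∀ (d : Fin k → ℤ) (x : Fin k → W), (∀ s, x s ∈ 𝒲 (d s)) → f x = g x) : f = g := by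
  classical
  ext x
  have hx : x = fun s => ∑ i ∈ (DirectSum.decompose 𝒲 (x s)).support,
      (DirectSum.decompose 𝒲 (x s) i : W) :=
    funext fun s => (DirectSum.sum_support_decompose 𝒲 (x s)).symm
  rw [hx, MultilinearMap.map_sum_finset, MultilinearMap.map_sum_finset]
  exact Finset.sum_congr rfl fun r _ => h r _ fun s => SetLike.coe_mem _

/-- This permutation brings the letter s to the front and keeps the order of the others, so its
inversions pair s with each letter preceding it. -/
theorem chi_cycleRange_symm {n : ℕ} (s : Fin (n + 1)) (d : Fin (n + 1) → ℤ) :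
    chi s.cycleRange.symm d =
      (∑ r ∈ Finset.univ.filter (fun r => r < s), (1 + d s * d r)).negOnePow := by
  have hsum : ∀ (S : Finset (Fin (n + 1))) (g : Fin (n + 1) → ℤ),
      (∑ i ∈ S, g i).negOnePow = ∏ i ∈ S, (g i).negOnePow := by
    intro S g
    induction S using Finset.induction_on with
    | empty => simp
    | insert a S ha ih => rw [Finset.sum_insert ha, Finset.prod_insert ha, Int.negOnePow_add, ih]
  rw [chi, Fin.prod_univ_succ, Finset.prod_eq_one (s := Finset.univ) (f := fun a : Fin n => _),
    mul_one, Fin.prod_univ_succ, hsum, Finset.prod_filter, Fin.prod_univ_succAbove _ s]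
  · simp only [lt_self_iff_false, false_and, if_false, one_mul, Fin.succ_pos, true_and,
      Fin.cycleRange_symm_zero, Fin.cycleRange_symm_succ]
    refine Finset.prod_congr rfl fun r _ => ?_
    split_ifs with h
    · rw [Int.negOnePow_add, Int.negOnePow_one, neg_one_mul]
    · rfl
  · intro a _
    refine Finset.prod_eq_one fun b _ => if_neg ?_
    rintro ⟨h1, h2⟩
    induction b using Fin.cases with
    | zero => exact absurd h1 (Fin.not_lt_zero _)
    | succ b =>
      rw [Fin.cycleRange_symm_succ, Fin.cycleRange_symm_succ] at h2
      exact absurd (Fin.succ_lt_succ_iff.1 h1)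
        (not_lt_of_gt ((Fin.strictMono_succAbove s).lt_iff_lt.1 h2))

/-- A graded skew-symmetric operation is determined by its values with a given argument put first. -/
theorem IsGradedSkew.update_eq {𝒱 : ℤ → Submodule 𝕜 V} {n : ℕ}
    {f : MultilinearMap 𝕜 (fun _ : Fin (n + 1) => V) V} (hf : IsGradedSkew 𝒱 f)
    {d : Fin (n + 1) → ℤ} {x : Fin (n + 1) → V} (hx : ∀ s, x s ∈ 𝒱 (d s)) (s : Fin (n + 1)) {m : ℤ}
    {y : V} (hy : y ∈ 𝒱 m) :
    f (Function.update x s y) =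
      (∑ r ∈ Finset.univ.filter (fun r => r < s), (1 + m * d r)).negOnePow •
        f (Fin.cons y (fun r => x (s.succAbove r))) := by
  have h1 : ∀ r, Function.update x s y r ∈ 𝒱 (Function.update d s m r) := by
    intro r
    by_cases h : r = s
    · subst h; simpa using hy
    · simpa [h] using hx r
  have h2 := hf _ _ h1 s.cycleRange.symm
  have h3 : (fun r => Function.update x s y (s.cycleRange.symm r)) =
      Fin.cons y (fun r => x (s.succAbove r)) := by
    ext r
    induction r using Fin.cases with
    | zero => simp
    | succ r => simp [Fin.succAbove_ne]
  rw [h3, chi_cycleRange_symm] at h2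
  rw [h2, smul_smul, Finset.sum_congr rfl (g := fun r =>
    1 + Function.update d s m s * Function.update d s m r), Int.units_mul_self, one_smul]
  intro r hr
  simp only [Finset.mem_filter, Finset.mem_univ, true_and] at hr
  rw [Function.update_self, Function.update_of_ne hr.ne]

/-- It suffices to check the Leibniz rule in the first argument. -/
theorem isGradedMultiderivation_of_head {S : Type*} [Ring S] [Algebra 𝕜 S]
    {𝒮 : ℤ → Submodule 𝕜 S} [GradedAlgebra 𝒮] {n : ℕ}
    {f : MultilinearMap 𝕜 (fun _ : Fin (n + 1) => S) S} (hdeg : HasDegree 𝒮 (2 - ((n + 1 : ℕ) : ℤ)) f)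
    (hskew : IsGradedSkew 𝒮 f)
    (h : ∀ (d : Fin n → ℤ) (x : Fin n → S), (∀ s, x s ∈ 𝒮 (d s)) → ∀ (i j : ℤ) (u v : S),
      u ∈ 𝒮 i → v ∈ 𝒮 j → f (Fin.cons (u * v) x) =
        (i * (n + 1)).negOnePow • (u * f (Fin.cons v x)) +
          (j * ∑ t, d t).negOnePow • (f (Fin.cons u x) * v)) :
    IsGradedMultiderivation 𝒮 f where
  degree := hdeg
  skew := hskew
  leibniz d x hx s i j u v hu hv := by
    rw [hskew.update_eq hx s (SetLike.GradedMul.mul_mem hu hv), hskew.update_eq hx s hu,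
      hskew.update_eq hx s hv, h _ _ (fun r => hx (s.succAbove r)) i j u v hu hv]
    have h1 : ∑ r, d (s.succAbove r) = ∑ t ∈ Finset.univ.filter (fun t => t < s), d t +
        ∑ t ∈ Finset.univ.filter (fun t => s < t), d t := by
      have h2 := Fin.sum_univ_succAbove d s
      have h3 := Finset.sum_filter_add_sum_filter_not Finset.univ (fun t => t < s) d
      have h4 : Finset.univ.filter (fun t => ¬ t < s) =
          insert s (Finset.univ.filter (fun t => s < t)) := by
        ext t; simp [le_iff_eq_or_lt, eq_comm]
      rw [h4, Finset.sum_insert (by simp)] at h3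
      linarith
    simp only [smul_add, mul_smul_comm, smul_mul_assoc, smul_smul, ← Int.negOnePow_add, h1,
      Finset.sum_add_distrib, ← Finset.mul_sum]
    congr 2 <;>
    · apply negOnePow_congr
      push_cast
      grind

end Homogeneous

/-! ### The Poisson L∞-structure on S_A N -/

section SymMultiderivation

open GradedSym

variable {𝕜 A M N : Type*} [Field 𝕜] [Ring A] [Algebra 𝕜 A]
  [AddCommGroup M] [Module 𝕜 M] [Module A M] [IsScalarTower 𝕜 A M]
  [AddCommGroup N] [Module 𝕜 N] [Module A N] [IsScalarTower 𝕜 A N]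
  {𝒜 : ℤ → Submodule 𝕜 A} [GradedAlgebra 𝒜]
  {ℳ : ℤ → Submodule 𝕜 M} [DirectSum.Decomposition ℳ] [SetLike.GradedSMul 𝒜 ℳ]
  {𝒩 : ℤ → Submodule 𝕜 N} [DirectSum.Decomposition 𝒩] [SetLike.GradedSMul 𝒜 𝒩]
  {D : DGCommStructure 𝒜} (X : DGLieRinehartStructure D ℳ) (Y : DGModuleStructure D 𝒩)
  (c : LinearContraction X.toDGModuleStructure Y)

theorem isLInfinity_symTransfer [CharZero 𝕜] : IsLInfinity (deg 𝒜 𝒩) (symTransfer X Y c) :=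
  isLInfinity_transfer X.isDGLie_poisson c.isContraction_sym

/-- By skew-symmetry only the first entry matters. An operation with y in that entry is, up to a
décalage sign, the top coefficient of the linearisation in the direction y, so the Leibniz rule is
`linLam_mul`. -/
theorem isGradedMultiderivation_symTransfer [CharZero 𝕜] (k : ℕ) (hk : 1 ≤ k) :
    IsGradedMultiderivation (deg 𝒜 𝒩) (symTransfer X Y c k) := by
  obtain ⟨n, rfl⟩ : ∃ n, k = n + 1 := ⟨k - 1, by omega⟩
  refine isGradedMultiderivation_of_head ((isLInfinity_symTransfer X Y c).degree _ hk)
    ((isLInfinity_symTransfer X Y c).skew _ hk) fun d x hx i j u v hu hv => ?_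
  have key : ∀ {m : ℤ} {y : GradedSym 𝒜 𝒩}, y ∈ deg 𝒜 𝒩 m → symTransfer X Y c (n + 1) (Fin.cons y x) =
      (n * m + theta d Finset.univ).negOnePow • linLam X.poisson Y.symDiff c.symP.toLinearMap
        c.symJ.toLinearMap c.symH d x m y Finset.univ := fun {m y} hy => by
    have := transfer_cons (br := X.poisson) (d' := Y.symDiff) (p := c.symP.toLinearMap)
      (j := c.symJ.toLinearMap) (h := c.symH) hx hy strictMono_id (I := Finset.univ) (by simp)
    rwa [Finset.card_univ, Fintype.card_fin] at this
  rw [key hu, key hv, key (SetLike.GradedMul.mul_mem hu hv), linLam_mul X Y c hx hu hv,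
    add_comm ((i * (n + 1)).negOnePow • _), eps_eq, Finset.card_univ, Fintype.card_fin]
  simp only [smul_add, mul_smul_comm, smul_mul_assoc, smul_smul, ← Int.negOnePow_add]
  congr 2 <;>
  · apply negOnePow_congr
    push_cast
    grind

end SymMultiderivation

end

end StrongHomotopy

namespace StrongHomotopy

noncomputable section

/-! ### Naturality of the transferred operations -/

section Naturality

variable {𝕜 V W V' W' : Type*} [Field 𝕜] [AddCommGroup V] [Module 𝕜 V] [AddCommGroup W]
  [Module 𝕜 W] [AddCommGroup V'] [Module 𝕜 V'] [AddCommGroup W'] [Module 𝕜 W']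
  {br : V →ₗ[𝕜] V →ₗ[𝕜] V} {br' : V' →ₗ[𝕜] V' →ₗ[𝕜] V'}
  {p : V →ₗ[𝕜] W} {p' : V' →ₗ[𝕜] W'} {j : W →ₗ[𝕜] V} {j' : W' →ₗ[𝕜] V'}
  {h : V →ₗ[𝕜] V} {h' : V' →ₗ[𝕜] V'} {dW : W →ₗ[𝕜] W} {dW' : W' →ₗ[𝕜] W'}
  {G : V →ₗ[𝕜] V'} {g : W →ₗ[𝕜] W'}

theorem map_argOn {n : ℕ} (x : Fin n → W) (I : Finset (Fin n)) :
    g (argOn x I) = argOn (fun s => g (x s)) I := by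
  rw [argOn, argOn, map_sum]
  exact Finset.sum_congr rfl fun i _ => by split_ifs <;> simp

/-- ψ and φ are built from the bracket, j and h alone, so maps intertwining these data intertwine ψ
and φ. -/
theorem map_psiOn (hbr : ∀ v w, G (br v w) = br' (G v) (G w)) (hj : ∀ w, G (j w) = j' (g w))
    (hh : ∀ v, G (h v) = h' (G v)) {n : ℕ} (d : Fin n → ℤ) (x : Fin n → W) (I : Finset (Fin n)) :
    G (psiOn br j h d x I) = psiOn br' j' h' d (fun s => g (x s)) I ∧
      G (phiOn br j h d x I) = phiOn br' j' h' d (fun s => g (x s)) I := by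
  induction I using Finset.strongInduction with
  | H I ih =>
    have key : G (phiOn br j h d x I) = phiOn br' j' h' d (fun s => g (x s)) I := by
      rw [phiOn_eq, phiOn_eq, map_sum2]
      refine sum2_congr fun J K hJK hI => ?_
      rw [map_sign_smul, hbr]
      by_cases hJ : J = ∅
      · rw [hJ, psiOn_empty, psiOn_empty, map_zero, map_zero, LinearMap.zero_apply,
          LinearMap.zero_apply]
      by_cases hK : K = ∅
      · rw [hK, psiOn_empty, psiOn_empty, map_zero, map_zero, map_zero]
      subst hI
      rw [(ih J _).1, (ih K _).1]
      · refine (Finset.ssubset_iff_of_subset Finset.subset_union_right).2 ?_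
        obtain ⟨a, ha⟩ := Finset.nonempty_iff_ne_empty.2 hJ
        exact ⟨a, Finset.mem_union_left _ ha, Finset.disjoint_left.1 hJK ha⟩
      · refine (Finset.ssubset_iff_of_subset Finset.subset_union_left).2 ?_
        obtain ⟨a, ha⟩ := Finset.nonempty_iff_ne_empty.2 hK
        exact ⟨a, Finset.mem_union_right _ ha, Finset.disjoint_right.1 hJK ha⟩
    refine ⟨?_, key⟩
    rw [psiOn_eq, psiOn_eq, map_add, map_neg, hj, hh, key, map_argOn]

variable {𝒲 : ℤ → Submodule 𝕜 W} [DirectSum.Decomposition 𝒲]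
  {𝒲' : ℤ → Submodule 𝕜 W'} [DirectSum.Decomposition 𝒲']

/-- The transferred operations are natural in the bracket and the contraction data. -/
theorem map_transfer (hbr : ∀ v w, G (br v w) = br' (G v) (G w)) (hj : ∀ w, G (j w) = j' (g w))
    (hh : ∀ v, G (h v) = h' (G v)) (hp : ∀ v, g (p v) = p' (G v)) (hd : ∀ w, g (dW w) = dW' (g w))
    (hg : ∀ i w, w ∈ 𝒲 i → g w ∈ 𝒲' i) (k : ℕ) (x : Fin k → W) :
    g (transfer 𝒲 br dW p j h k x) = transfer 𝒲' br' dW' p' j' h' k (fun s => g (x s)) := by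
  have key : g.compMultilinearMap (transfer 𝒲 br dW p j h k) =
      (transfer 𝒲' br' dW' p' j' h' k).compLinearMap (fun _ => g) := by
    refine multilinear_ext_homogeneous 𝒲 fun d x hx => ?_
    rw [LinearMap.compMultilinearMap_apply, MultilinearMap.compLinearMap_apply, transfer_apply hx,
      transfer_apply (fun s => hg _ _ (hx s)), map_add, hd, hp, (map_psiOn hbr hj hh d x _).2,
      map_argOn]
  exact DFunLike.congr_fun key x

end Naturality

/-! ### The values on generators -/

section Generators

open GradedSym

variable {𝕜 A M N : Type*} [Field 𝕜] [Ring A] [Algebra 𝕜 A]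
  [AddCommGroup M] [Module 𝕜 M] [Module A M] [IsScalarTower 𝕜 A M]
  [AddCommGroup N] [Module 𝕜 N] [Module A N] [IsScalarTower 𝕜 A N]
  {𝒜 : ℤ → Submodule 𝕜 A} [GradedAlgebra 𝒜]
  {ℳ : ℤ → Submodule 𝕜 M} [DirectSum.Decomposition ℳ] [SetLike.GradedSMul 𝒜 ℳ]
  {𝒩 : ℤ → Submodule 𝕜 N} [DirectSum.Decomposition 𝒩] [SetLike.GradedSMul 𝒜 𝒩]
  {D : DGCommStructure 𝒜} (X : DGLieRinehartStructure D ℳ) (Y : DGModuleStructure D 𝒩)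
  (c : LinearContraction X.toDGModuleStructure Y)

/-- On the generators A ⊕ M, the Poisson bracket, the differential and the extended contraction
restrict to those of the semidirect product; naturality of the transfer along `gen` gives the claim.
-/
theorem symTransfer_gen [CharZero 𝕜] (k : ℕ) (x : Fin k → A × N) :
    symTransfer X Y c k (fun s => gen 𝒜 𝒩 (x s)) = gen 𝒜 𝒩 (semidirectTransfer X Y c k x) :=
  (map_transfer (G := gen 𝒜 ℳ) (g := gen 𝒜 𝒩) (𝒲 := prodGrading 𝒜 𝒩) (𝒲' := deg 𝒜 𝒩)
    (fun v w => (X.poisson_gen_gen v w).symm) (fun w => (c.symJ_gen w).symm)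
    (fun v => (c.symH_gen v).symm) (fun v => (c.symP_gen v).symm)
    (fun w => (DGLieRinehartStructure.symDiff_gen Y w).symm) (fun _ _ hw => gen_mem hw) k x).symm

theorem semidirectTransfer_inr (k : ℕ) (q : Fin k → N) :
    semidirectTransfer X Y c k (fun s => (0, q s)) = (0, lrBracket X Y c k q) :=
  (map_transfer (G := LinearMap.inr 𝕜 A M) (g := LinearMap.inr 𝕜 A N) (𝒲 := 𝒩)
    (𝒲' := prodGrading 𝒜 𝒩)
    (br' := X.semidirect) (j' := LinearMap.id.prodMap c.j) (p' := LinearMap.id.prodMap c.p)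
    (h' := (0 : A →ₗ[𝕜] A).prodMap c.h) (dW' := D.d.prodMap Y.d)
    (fun v w => by simp [X.semidirect_apply]) (fun w => by simp)
    (fun v => by simp) (fun v => by simp) (fun w => by simp) (fun _ _ hw => inr_mem hw) k q).symm

theorem snd_semidirectTransfer (k : ℕ) (x : Fin k → A × N) :
    (semidirectTransfer X Y c k x).2 = lrBracket X Y c k (fun s => (x s).2) :=
  map_transfer (G := LinearMap.snd 𝕜 A M) (g := LinearMap.snd 𝕜 A N) (𝒲 := prodGrading 𝒜 𝒩)
    (𝒲' := 𝒩) (fun _ _ => rfl) (fun _ => rfl) (fun _ => rfl) (fun _ => rfl) (fun _ => rfl)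
    (fun _ _ hw => hw.2) k x

theorem snd_semidirectTransfer_eq_zero (k : ℕ) (x : Fin k → A × N) (s : Fin k) (hs : (x s).2 = 0) :
    (semidirectTransfer X Y c k x).2 = 0 := by
  rw [snd_semidirectTransfer]
  exact (lrBracket X Y c k).map_coord_zero s hs

theorem psiOn_eq_zero {V W : Type*} [AddCommGroup V] [Module 𝕜 V] [AddCommGroup W] [Module 𝕜 W]
    {br : V →ₗ[𝕜] V →ₗ[𝕜] V} {j : W →ₗ[𝕜] V} {h : V →ₗ[𝕜] V} {n : ℕ} {d : Fin n → ℤ}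
    {x : Fin n → W} {I : Finset (Fin n)} {s : Fin n} (hs : s ∈ I) (hx : x s = 0) :
    psiOn br j h d x I = 0 := by
  obtain ⟨r, hr⟩ : s ∈ Set.range (I.orderEmbOfFin rfl) := by
    rw [Finset.range_orderEmbOfFin]; exact hs
  exact (psi br j h I.card _).map_coord_zero r (by rw [hr, hx])

/-- The homotopy is zero on A, so ψ of a block has an A-component only for singletons; its
M-component vanishes if the block contains an argument from A. If both A-arguments lie in one block,
ψ of that block is zero. If they are separated, both M-components vanish, and [A, A] = 0. -/
theorem semidirectTransfer_vanish_of_mem (k : ℕ) {d : Fin k → ℤ} {z : Fin k → A × N}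
    (hz : ∀ r, z r ∈ prodGrading 𝒜 𝒩 (d r)) {s t : Fin k} (hst : s ≠ t)
    (hzs : (z s).2 = 0) (hzt : (z t).2 = 0) : semidirectTransfer X Y c k z = 0 := by
  refine Prod.ext ?_ ?_
  · have hfst : ∀ I : Finset (Fin k), I.card ≠ 1 → (psiOn X.semidirect
        (LinearMap.id.prodMap c.j) ((0 : A →ₗ[𝕜] A).prodMap c.h) d z I).1 = 0 := fun I hI => by
      rw [psiOn_eq, argOn_of_card_ne_one hI]
      simp
    have hsnd : ∀ (I : Finset (Fin k)) (r : Fin k), r ∈ I → (z r).2 = 0 → (psiOn X.semidirect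
        (LinearMap.id.prodMap c.j) ((0 : A →ₗ[𝕜] A).prodMap c.h) d z I).2 = 0 :=
      fun I r hr hzr => by
        refine Eq.trans (map_psiOn (G := LinearMap.snd 𝕜 A M) (g := LinearMap.snd 𝕜 A N)
          (br' := X.bracket) (j' := c.j) (h' := c.h) (fun _ _ => rfl) (fun _ => rfl)
          (fun _ => rfl) d z I).1 (psiOn_eq_zero hr hzr)
    have hcard : (Finset.univ : Finset (Fin k)).card ≠ 1 := fun h1 =>
      hst (Finset.card_le_one.1 h1.le s (Finset.mem_univ _) t (Finset.mem_univ _))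
    have hcard2 : ∀ I : Finset (Fin k), s ∈ I → t ∈ I → I.card ≠ 1 := fun I hsI htI h1 =>
      hst (Finset.card_le_one.1 h1.le s hsI t htI)
    rw [semidirectTransfer, transfer_apply hz, argOn_of_card_ne_one hcard, map_zero, zero_add,
      phiOn_eq]
    change (LinearMap.fst 𝕜 A M) _ = 0
    rw [map_sum2]
    refine Finset.sum_eq_zero fun I _ => ?_
    beta_reduce
    rw [map_sign_smul, LinearMap.fst_apply, X.semidirect_apply]
    beta_reduce
    by_cases h1 : s ∈ I <;> by_cases h2 : t ∈ I
    · rw [hsnd I s h1 hzs, hfst I (hcard2 I h1 h2)]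
      simp
    · rw [hsnd I s h1 hzs, hsnd (Finset.univ \ I) t (by simp [h2]) hzt]
      simp
    · rw [hsnd I t h2 hzt, hsnd (Finset.univ \ I) s (by simp [h1]) hzs]
      simp
    · rw [hsnd (Finset.univ \ I) s (by simp [h1]) hzs,
        hfst (Finset.univ \ I) (hcard2 _ (by simp [h1]) (by simp [h2]))]
      simp
  · exact snd_semidirectTransfer_eq_zero X Y c k z s hzs

theorem semidirectTransfer_vanish (k : ℕ) (x : Fin k → A × N) (s t : Fin k) (hst : s ≠ t)
    (hs : (x s).2 = 0) (ht : (x t).2 = 0) : semidirectTransfer X Y c k x = 0 := by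
  -- Forcing the entries s and t into A by projections keeps the hypothesis valid for the
  -- homogeneous components, so the homogeneous case suffices.
  let P : Fin k → A × N →ₗ[𝕜] A × N := fun r =>
    if r = s ∨ r = t then LinearMap.inl 𝕜 A N ∘ₗ LinearMap.fst 𝕜 A N else LinearMap.id
  have hPmem : ∀ r i y, y ∈ prodGrading 𝒜 𝒩 i → P r y ∈ prodGrading 𝒜 𝒩 i := by
    intro r i y hy
    simp only [P]
    split_ifs
    · exact inl_mem hy.1
    · exact hy
  have hP : ∀ r, r = s ∨ r = t → ∀ y, (P r y).2 = 0 := fun r hr y => by simp [P, hr]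
  have key : (semidirectTransfer X Y c k).compLinearMap P = 0 :=
    multilinear_ext_homogeneous (prodGrading 𝒜 𝒩) fun d y hy =>
      semidirectTransfer_vanish_of_mem X Y c k (fun r => hPmem r _ _ (hy r)) hst
        (hP s (Or.inl rfl) _) (hP t (Or.inr rfl) _)
  have h1 := DFunLike.congr_fun key x
  rw [MultilinearMap.compLinearMap_apply, zero_apply] at h1
  rw [← h1]
  congr 1
  ext r
  · simp only [P]; split_ifs <;> simp
  · simp only [P]
    split_ifs with h
    · rcases h with rfl | rfl <;> simp [hs, ht]
    · simp

/-- The transferred operations extend the operations of the `LR_∞`-structure. -/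
theorem isMultiderivationExtension_symTransfer [CharZero 𝕜] :
    IsMultiderivationExtension X Y c (symTransfer X Y c) where
  multiderivation := isGradedMultiderivation_symTransfer X Y c
  bracket k _ q := by rw [symTransfer_gen, semidirectTransfer_inr]
  action n q a := by
    have h1 : (Fin.snoc (fun s => gen 𝒜 𝒩 (0, q s)) (gen 𝒜 𝒩 (a, 0)) :
        Fin (n + 1) → GradedSym 𝒜 𝒩) = fun s => gen 𝒜 𝒩
          ((Fin.snoc (fun s => (0, q s)) (a, 0) : Fin (n + 1) → A × N) s) := by
      ext s
      induction s using Fin.lastCases <;> simp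
    rw [h1, symTransfer_gen, lrAction]
    congr 1
    exact Prod.ext rfl (snd_semidirectTransfer_eq_zero X Y c _ _ (Fin.last n) (by simp))
  vanish k x s t hst hs ht := by
    rw [symTransfer_gen, semidirectTransfer_vanish X Y c k x s t hst hs ht, map_zero]

variable {X Y c}

/-- Multiderivations that agree on homogeneous generators are equal. -/
theorem multiderivation_ext {k : ℕ} {f g : MultilinearMap 𝕜 (fun _ : Fin k => GradedSym 𝒜 𝒩)
    (GradedSym 𝒜 𝒩)} (hf : IsGradedMultiderivation (deg 𝒜 𝒩) f)
    (hg : IsGradedMultiderivation (deg 𝒜 𝒩) g)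
    (h : ∀ (d : Fin k → ℤ) (y : Fin k → A × N), (∀ s, y s ∈ prodGrading 𝒜 𝒩 (d s)) →
      f (fun s => gen 𝒜 𝒩 (y s)) = g (fun s => gen 𝒜 𝒩 (y s))) : f = g := by
  -- The induction parameter m bounds the initial slots that need not be generators; the Leibniz
  -- rule in slot m reduces m + 1 to m.
  have key : ∀ m : ℕ, ∀ (d : Fin k → ℤ) (x : Fin k → GradedSym 𝒜 𝒩),
      (∀ s, x s ∈ deg 𝒜 𝒩 (d s)) →
      (∀ s : Fin k, m ≤ s → ∃ y ∈ prodGrading 𝒜 𝒩 (d s), gen 𝒜 𝒩 y = x s) → f x = g x := by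
    intro m
    induction m with
    | zero =>
      intro d x _ hgen
      choose y hy hyx using fun s => hgen s (Nat.zero_le _)
      rw [← funext hyx]
      exact h d y hy
    | succ m ih =>
      intro d x hx hgen
      by_cases hm : m < k
      · have h1 : f (Function.update x ⟨m, hm⟩ (x ⟨m, hm⟩)) =
            g (Function.update x ⟨m, hm⟩ (x ⟨m, hm⟩)) := by
          refine deg_induction (motive := fun _ u =>
            f (Function.update x ⟨m, hm⟩ u) = g (Function.update x ⟨m, hm⟩ u))
            (fun i y hy => ?_) (fun i => ?_) (fun i u v hu hv => ?_)
            (fun i j u v hu hv hu' hv' => ?_) (hx ⟨m, hm⟩)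
          · refine ih (Function.update d ⟨m, hm⟩ i) _ (fun s => ?_) (fun s hs => ?_)
            · by_cases h2 : s = ⟨m, hm⟩
              · subst h2
                simpa using gen_mem hy
              · simpa [h2] using hx s
            · by_cases h2 : s = ⟨m, hm⟩
              · subst h2
                exact ⟨y, by simpa using hy, by simp⟩
              · have : (s : ℕ) ≠ m := fun h3 => h2 (Fin.ext h3)
                simpa [h2] using hgen s (by omega)
          · rw [MultilinearMap.map_update_zero, MultilinearMap.map_update_zero]
          · rw [MultilinearMap.map_update_add, MultilinearMap.map_update_add, hu, hv]
          · rw [hf.leibniz d x hx _ i j u v hu hv, hg.leibniz d x hx _ i j u v hu hv, hu', hv']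
        rwa [Function.update_eq_self] at h1
      · exact ih d x hx fun s hs => absurd (hs.trans_lt s.2) hm
  exact multilinear_ext_homogeneous (deg 𝒜 𝒩) fun d x hx =>
    key k d x hx fun s hs => absurd s.2 (not_lt_of_ge hs)

/-- The multiderivations extending the operations of the `LR_∞`-structure are unique. -/
theorem IsMultiderivationExtension.eq {P Q : Operations 𝕜 (GradedSym 𝒜 𝒩)}
    (hP : IsMultiderivationExtension X Y c P) (hQ : IsMultiderivationExtension X Y c Q) {k : ℕ}
    (hk : 1 ≤ k) : P k = Q k := by
  have key : ∀ (d : Fin k → ℤ) (y : Fin k → A × N), (∀ s, y s ∈ prodGrading 𝒜 𝒩 (d s)) →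
      (∀ s, (y s).1 = 0 ∨ (y s).2 = 0) →
      P k (fun s => gen 𝒜 𝒩 (y s)) = Q k (fun s => gen 𝒜 𝒩 (y s)) := by
    intro d y hy hpure
    by_cases h1 : ∃ s t, s ≠ t ∧ (y s).2 = 0 ∧ (y t).2 = 0
    · obtain ⟨s, t, hst, hs, ht⟩ := h1
      rw [hP.vanish k y s t hst hs ht, hQ.vanish k y s t hst hs ht]
    by_cases h2 : ∃ t, (y t).2 = 0
    · obtain ⟨t, ht⟩ := h2
      obtain ⟨n, rfl⟩ : ∃ n, k = n + 1 := ⟨k - 1, by omega⟩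
      have hne : ∀ s, s ≠ t → (y s).1 = 0 := fun s hs =>
        (hpure s).resolve_right fun h => h1 ⟨s, t, hs, h, ht⟩
      -- The prescribed values concern an A-argument in the last place, so the only one present is
      -- moved there. Graded skew-symmetry produces the same sign for both families.
      have h3 : (fun s => gen 𝒜 𝒩 (y (Equiv.swap t (Fin.last n) s))) =
          (Fin.snoc (fun s => gen 𝒜 𝒩 (0, (y (Equiv.swap t (Fin.last n) s.castSucc)).2))
            (gen 𝒜 𝒩 ((y t).1, 0)) : Fin (n + 1) → GradedSym 𝒜 𝒩) := by
        ext s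
        induction s using Fin.lastCases with
        | last =>
          rw [Equiv.swap_apply_right, Fin.snoc_last, ← ht]
        | cast s =>
          rw [Fin.snoc_castSucc, ← hne (Equiv.swap t (Fin.last n) s.castSucc)]
          intro h
          rw [Equiv.swap_apply_eq_iff, Equiv.swap_apply_left] at h
          exact (Fin.castSucc_lt_last s).ne h
      have h4 := (hP.multiderivation _ hk).skew d _ (fun s => gen_mem (hy s))
        (Equiv.swap t (Fin.last n))
      have h5 := (hQ.multiderivation _ hk).skew d _ (fun s => gen_mem (hy s))
        (Equiv.swap t (Fin.last n))
      rw [h3, hP.action] at h4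
      rw [h3, hQ.action, h4] at h5
      exact (MulAction.injective (β := GradedSym 𝒜 𝒩) _) h5
    · have h3 : (fun s => gen 𝒜 𝒩 (y s)) = fun s => gen 𝒜 𝒩 (0, (y s).2) := by
        ext s
        rw [← (hpure s).resolve_right fun h => h2 ⟨s, h⟩]
      rw [h3, hP.bracket k hk, hQ.bracket k hk]
  refine multiderivation_ext (hP.multiderivation k hk) (hQ.multiderivation k hk) fun d y hy => ?_
  have h1 : (fun s => gen 𝒜 𝒩 (y s)) =
      (fun s => gen 𝒜 𝒩 ((y s).1, 0)) + fun s => gen 𝒜 𝒩 (0, (y s).2) := by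
    ext s
    rw [Pi.add_apply, ← map_add]
    simp
  -- Multilinear expansion reduces generators of A ⊕ N to families in which each entry lies in A or
  -- in N, the only ones whose values are prescribed.
  rw [h1, MultilinearMap.map_add_univ, MultilinearMap.map_add_univ]
  refine Finset.sum_congr rfl fun S _ => ?_
  have h2 : S.piecewise (fun s => gen 𝒜 𝒩 ((y s).1, 0)) (fun s => gen 𝒜 𝒩 (0, (y s).2)) =
      fun s => gen 𝒜 𝒩 (S.piecewise (fun s => ((y s).1, 0)) (fun s => (0, (y s).2)) s) := by
    ext s
    by_cases hs : s ∈ S <;> simp [hs]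
  rw [h2]
  refine key d _ (fun s => ?_) (fun s => ?_) <;> by_cases hs : s ∈ S
  · simpa [hs] using inl_mem (hy s).1
  · simpa [hs] using inr_mem (hy s).2
  · simp [hs]
  · simp [hs]

end Generators

end

end StrongHomotopy

/-! ### Assembly of the proposition -/

theorem mainTheorem3 {𝕜 A K K' : Type*} [Field 𝕜] [CharZero 𝕜]
    [Ring A] [Algebra 𝕜 A]
    [AddCommGroup K] [Module 𝕜 K] [Module A K] [IsScalarTower 𝕜 A K]
    [AddCommGroup K'] [Module 𝕜 K'] [Module A K'] [IsScalarTower 𝕜 A K']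
    (𝒜 : ℤ → Submodule 𝕜 A) [GradedAlgebra 𝒜]
    (𝒦 : ℤ → Submodule 𝕜 K) [DirectSum.Decomposition 𝒦] [SetLike.GradedSMul 𝒜 𝒦]
    (𝒦' : ℤ → Submodule 𝕜 K') [DirectSum.Decomposition 𝒦'] [SetLike.GradedSMul 𝒜 𝒦']
    (D : DGCommStructure 𝒜)
    (X : DGLieRinehartStructure D 𝒦)
    (Y : DGModuleStructure D 𝒦')
    (c : LinearContraction X.toDGModuleStructure Y) :
    IsContraction (GradedSym.deg 𝒜 𝒦) X.symDiff (GradedSym.deg 𝒜 𝒦') Y.symDiff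
        c.symP.toLinearMap c.symJ.toLinearMap c.symH ∧
      IsPoissonLInfinity (GradedSym.deg 𝒜 𝒦') (symTransfer X Y c) ∧
      ∀ P : Operations 𝕜 (GradedSym 𝒜 𝒦'),
        IsMultiderivationExtension X Y c P ↔ ∀ k : ℕ, 1 ≤ k → P k = symTransfer X Y c k := by
  have h := isMultiderivationExtension_symTransfer X Y c
  refine ⟨c.isContraction_sym, ⟨GradedSym.gradedComm, isLInfinity_symTransfer X Y c,
    h.multiderivation⟩, fun P => ⟨fun hP k hk => hP.eq h hk, fun hP => ⟨fun k hk => ?_,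
    fun k hk q => ?_, fun n q a => ?_, fun k x s t hst hs ht => ?_⟩⟩⟩
  · rw [hP k hk]; exact h.multiderivation k hk
  · rw [hP k hk]; exact h.bracket k hk q
  · rw [hP (n + 1) (by omega)]; exact h.action n q a
  · rw [hP k (by have := s.2; omega)]; exact h.vanish k x s t hst hs ht
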